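/- Let $\mathcal V$ be a symmetric monoidal closed category whose underlying ordinary category is locally small, complete and cocomplete; category, functor and natural transformation mean $\mathcal V$-category, $\mathcal V$-functor and $\mathcal V$-natural transformation. A weight is a functor $\phi:\mathcal K^{op}\to\mathcal V$ with $\mathcal K$ small; the limit $\{\phi,T\}$ of $T:\mathcal K^{op}\to\mathcal A$ is characterized by $\mathcal A(a,\{\phi,T\})\cong[\mathcal K^{op},\mathcal V](\phi,\mathcal A(a,T-))$, and the colimit $\phi*S$ of $S:\mathcal K\to\mathcal A$ by $\mathcal A(\phi*S,a)\cong[\mathcal K^{op},\mathcal V](\phi,\mathcal A(S-,a))$. Let $\Phi$ be any class of weights. A category is $\Phi$-cocomplete if it admits all colimits $\phi*S$ with $\phi\in\Phi$. For a full subcategory $\mathcal P$ of $\mathcal B$ and a class $\Psi$ of weights, $\Psi\{\mathcal P\}$ denotes the smallest full replete subcategory of $\mathcal B$ containing $\mathcal P$ and closed under the formation of $\Psi$-weighted colimits in $\mathcal B$. For a small $\mathcal N$, $\Psi(\mathcal N)$ denotes the closure $\Psi\{\mathcal N\}$ of the representables $\mathcal N(-,n)$ in $[\mathcal N^{op},\mathcal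 V]$. Let $\Phi^+$ be the class of $\Phi$-flat weights, that is, of those weights $\phi:\mathcal L^{op}\to\mathcal V$ such that $\phi$-weighted colimits commute in $\mathcal V$ with $\psi$-weighted limits for every $\psi\in\Phi$; equivalently, for every $\psi:\mathcal K^{op}\to\mathcal V$ in $\Phi$ the functor $\{\psi,-\}=[\mathcal K^{op},\mathcal V](\psi,-):[\mathcal K^{op},\mathcal V]\to\mathcal V$ preserves $\phi$-weighted colimits. **Theorem.** Let $\mathcal N$ be a small $\Phi$-cocomplete category, and let $\Phi\text{-}\mathbf{Conts}[\mathcal N^{op},\mathcal V]$ be the full subcategory of $[\mathcal N^{op},\mathcal V]$ consisting of the functors $\mathcal N^{op}\to\mathcal V$ that preserve all $\Phi$-weighted limits. Then $\Phi^+(\mathcal N)\subseteq\Phi\text{-}\mathbf{Conts}[\mathcal N^{op},\mathcal V]$, and this inclusion is an equality if and only if $$\Phi\text{-}\mathbf{Conts}[\mathcal N^{op},\mathcal V]\subseteq\Phi^+\{\Phi(\mathcal N)\},$$ where the closure on the right is taken in $[\mathcal N^{op},\mathcal V]$. In particular, if $\Phi^+\{\Phi(\mathcal N)\}$ is all of $[\mathcal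 N^{op},\mathcal V]$, then $\Phi^+(\mathcal N)=\Phi\text{-}\mathbf{Conts}[\mathcal N^{op},\mathcal V]$; moreover a presheaf $\mathcal N^{op}\to\mathcal V$ is then $\Phi$-flat if and only if it is $\Phi$-continuous. -/

import Mathlib

open CategoryTheory MonoidalCategory BraidedCategory Limits Opposite
open scoped MonoidalClosed

universe w v u u₁ u₂ u₃

noncomputable section

namespace EnrichedWeights

section Graded

variable {V : Type v} [Category.{w} V] [MonoidalCategory V]

theorem comp_tensorHom {X Y Z X' Z' : V} (f : X ⟶ Y) (g : Y ⟶ Z) (h : X' ⟶ Z') :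
    ((f ≫ g) ⊗ₘ h) = (f ▷ X') ≫ (g ⊗ₘ h) := by
  simp [MonoidalCategory.tensorHom_def]

theorem tensorHom_comp {X Y Z X' Z' : V} (f : X ⟶ Y) (g : Y ⟶ Z) (h : X' ⟶ Z') :
    (h ⊗ₘ (f ≫ g)) = (X' ◁ f) ≫ (h ⊗ₘ g) := by
  simp [MonoidalCategory.tensorHom_def']

theorem comp_tensorHom_assoc {X Y Z X' Z' W : V} (f : X ⟶ Y) (g : Y ⟶ Z) (h : X' ⟶ Z')
    (k : Z ⊗ Z' ⟶ W) : ((f ≫ g) ⊗ₘ h) ≫ k = (f ▷ X') ≫ (g ⊗ₘ h) ≫ k := by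
  rw [comp_tensorHom, Category.assoc]

theorem tensorHom_comp_assoc {X Y Z X' Z' W : V} (f : X ⟶ Y) (g : Y ⟶ Z) (h : X' ⟶ Z')
    (k : Z' ⊗ Z ⟶ W) : (h ⊗ₘ (f ≫ g)) ≫ k = (X' ◁ f) ≫ (h ⊗ₘ g) ≫ k := by
  rw [tensorHom_comp, Category.assoc]

theorem eComp_tensor_assoc {C : Type u} [EnrichedCategory V C] {a b c d : C} {X Y Z : V}
    (f : X ⟶ (a ⟶[V] b)) (g : Y ⟶ (b ⟶[V] c)) (h : Z ⟶ (c ⟶[V] d)) :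
    (f ⊗ₘ ((g ⊗ₘ h) ≫ eComp V b c d)) ≫ eComp V a b d =
      (α_ X Y Z).inv ≫ (((f ⊗ₘ g) ≫ eComp V a b c) ⊗ₘ h) ≫ eComp V a c d := by
  have h1 : (f ⊗ₘ ((g ⊗ₘ h) ≫ eComp V b c d)) =
      (f ⊗ₘ (g ⊗ₘ h)) ≫ (_ ◁ eComp V b c d) := by
    simp [MonoidalCategory.tensorHom_def]
  have h2 : (((f ⊗ₘ g) ≫ eComp V a b c) ⊗ₘ h) =
      ((f ⊗ₘ g) ⊗ₘ h) ≫ (eComp V a b c ▷ _) := by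
    simp [MonoidalCategory.tensorHom_def']
  rw [h1, h2, Category.assoc, Category.assoc, ← e_assoc, associator_inv_naturality_assoc]

variable [BraidedCategory V]

/-- The `V`-natural families `A ⟶ D(F x, G x)` indexed by an object `A` of `V`; for the unit object
these are the `V`-natural transformations from `F` to `G`. -/
abbrev Fam {C : Type u₁} [EnrichedCategory V C] {D : Type u₂} [EnrichedCategory V D]
    (A : V) (F G : EnrichedFunctor V C D) :=
  GradedNatTrans ((Center.ofBraided V).obj A) F G

namespace Fam

variable {C : Type u₁} [EnrichedCategory V C] {D : Type u₂} [EnrichedCategory V D]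
  {B : Type u₃} [EnrichedCategory V B]

/-- A `V`-natural family from its components. -/
def mk' {A : V} {F G : EnrichedFunctor V C D} (app : ∀ x : C, A ⟶ (F.obj x ⟶[V] G.obj x))
    (nat : ∀ x y : C, (β_ A (x ⟶[V] y)).hom ≫ (F.map x y ⊗ₘ app y) ≫ eComp V _ _ _ =
      (app x ⊗ₘ G.map x y) ≫ eComp V _ _ _) : Fam A F G where
  app := app
  naturality := nat

/-- The components of a `V`-natural family. -/
def app' {A : V} {F G : EnrichedFunctor V C D} (σ : Fam A F G) (x : C) :
    A ⟶ (F.obj x ⟶[V] G.obj x) := σ.app x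

theorem nat {A : V} {F G : EnrichedFunctor V C D} (σ : Fam A F G) (x y : C) :
    (β_ A (x ⟶[V] y)).hom ≫ (F.map x y ⊗ₘ σ.app' y) ≫ eComp V _ _ _ =
      (σ.app' x ⊗ₘ G.map x y) ≫ eComp V _ _ _ :=
  σ.naturality x y

/-- Reindexing along a morphism `A' ⟶ A`. -/
def reindex {A A' : V} {F G : EnrichedFunctor V C D} (f : A' ⟶ A) (σ : Fam A F G) :
    Fam A' F G :=
  mk' (fun x => f ≫ σ.app' x) fun x y => by
    rw [tensorHom_comp, comp_tensorHom, Category.assoc, Category.assoc, ← σ.nat, braiding_naturality_left_assoc]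

/-- Vertical composition. -/
def vcomp {A A' : V} {F G H : EnrichedFunctor V C D} (σ : Fam A F G) (τ : Fam A' G H) :
    Fam (A ⊗ A') F H :=
  mk' (fun x => (σ.app' x ⊗ₘ τ.app' x) ≫ eComp V _ _ _) fun x y => by
    rw [eComp_tensor_assoc, braiding_tensor_left_hom]
    have e1 := eComp_tensor_assoc (σ.app' x) (τ.app' x) (H.map x y)
    rw [← cancel_epi (α_ _ _ _).hom, Iso.hom_inv_id_assoc] at e1
    rw [← e1, ← τ.nat x y]
    rw [tensorHom_comp, Category.assoc (A ◁ _), eComp_tensor_assoc, ← σ.nat x y]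
    rw [comp_tensorHom (β_ A _).hom]
    simp only [Category.assoc, Iso.hom_inv_id_assoc]

/-- The identity. -/
def one (F : EnrichedFunctor V C D) : Fam (𝟙_ V) F F :=
  mk' (fun x => eId V (F.obj x)) fun x y => by
    have h1 : (F.map x y ⊗ₘ eId V (F.obj y)) =
        (F.map x y ▷ 𝟙_ V) ≫ (_ ◁ eId V (F.obj y)) := MonoidalCategory.tensorHom_def _ _
    have h2 : (eId V (F.obj x) ⊗ₘ F.map x y) =
        (𝟙_ V ◁ F.map x y) ≫ (eId V (F.obj x) ▷ _) := MonoidalCategory.tensorHom_def' _ _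
    have h3 : (_ ◁ eId V (F.obj y)) ≫ eComp V (F.obj x) _ _ = (ρ_ _).hom := by
      rw [← cancel_epi (ρ_ _).inv, e_comp_id, Iso.inv_hom_id]
    have h4 : (eId V (F.obj x) ▷ _) ≫ eComp V _ _ (F.obj y) = (λ_ _).hom := by
      rw [← cancel_epi (λ_ _).inv, e_id_comp, Iso.inv_hom_id]
    rw [h1, h2, Category.assoc, Category.assoc, h3, h4]
    simp

/-- Restriction along a `V`-functor. -/
def restrict {A : V} {F G : EnrichedFunctor V C D} (T : EnrichedFunctor V B C) (σ : Fam A F G) :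
    Fam A (T.comp V F) (T.comp V G) :=
  mk' (fun x => σ.app' (T.obj x)) fun x y => by
    change (β_ A (x ⟶[V] y)).hom ≫ ((T.map x y ≫ F.map _ _) ⊗ₘ σ.app' (T.obj y)) ≫
      eComp V (F.obj (T.obj x)) _ _ = (σ.app' (T.obj x) ⊗ₘ (T.map x y ≫ G.map _ _)) ≫
      eComp V (F.obj (T.obj x)) _ _
    rw [comp_tensorHom, tensorHom_comp, Category.assoc, Category.assoc, ← σ.nat,
      braiding_naturality_right_assoc]

/-- Reassociation of the target. -/
def assocTarget {D' : Type u} [EnrichedCategory V D'] {A : V} {F : EnrichedFunctor V B D'}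
    {T : EnrichedFunctor V B C} {G : EnrichedFunctor V C D} {H : EnrichedFunctor V D D'}
    (σ : Fam A F (T.comp V (G.comp V H))) : Fam A F ((T.comp V G).comp V H) :=
  mk' (fun x => σ.app' x) fun x y => by
    have e : ((T.comp V G).comp V H).map x y = (T.comp V (G.comp V H)).map x y :=
      Category.assoc _ _ _
    rw [e]
    exact σ.nat x y

end Fam

end Graded

section FunctorCategory

variable {V : Type v} [Category.{w} V] [MonoidalCategory V] [SymmetricCategory V]
  [MonoidalClosed V] [HasLimits V]
variable {C : Type w} [EnrichedCategory V C] {D : Type u₂} [EnrichedCategory V D]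

section HomObject

variable (F G : EnrichedFunctor V C D)

/-- `∏ D(F x, G x)`. -/
def homProd : V := ∏ᶜ fun x : C => (F.obj x ⟶[V] G.obj x)

/-- `∏ [C(x, y), D(F x, G y)]`. -/
def homProd₂ : V :=
  ∏ᶜ fun p : C × C => (ihom (p.1 ⟶[V] p.2)).obj (F.obj p.1 ⟶[V] G.obj p.2)

/-- The projections of `∏ D(F x, G x)`. -/
def homProdπ (x : C) : homProd F G ⟶ (F.obj x ⟶[V] G.obj x) :=
  Pi.π (fun x : C => (F.obj x ⟶[V] G.obj x)) x

/-- The map with components `C(x, y) ⊗ D(F y, G y) ⟶ D(F x, F y) ⊗ D(F y, G y) ⟶ D(F x, G y)`. -/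
def homLeft : homProd F G ⟶ homProd₂ F G :=
  Pi.lift fun p : C × C => MonoidalClosed.curry
    ((F.map p.1 p.2 ⊗ₘ homProdπ F G p.2) ≫ eComp V _ _ _)

/-- The map with components `D(F x, G x) ⊗ C(x, y) ⟶ D(F x, G x) ⊗ D(G x, G y) ⟶ D(F x, G y)`. -/
def homRight : homProd F G ⟶ homProd₂ F G :=
  Pi.lift fun p : C × C => MonoidalClosed.curry
    ((β_ _ _).hom ≫ (homProdπ F G p.1 ⊗ₘ G.map p.1 p.2) ≫ eComp V _ _ _)

/-- The object `∫ₓ D(F x, G x)` of `V`-natural transformations from `F` to `G`, as the equalizer of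
`∏ D(F x, G x) ⇉ ∏ [C(x, y), D(F x, G y)]`. -/
def natObj : V := equalizer (homLeft F G) (homRight F G)

/-- The projections `∫ₓ D(F x, G x) ⟶ D(F x, G x)`. -/
def natπ (x : C) : natObj F G ⟶ (F.obj x ⟶[V] G.obj x) :=
  equalizer.ι (homLeft F G) (homRight F G) ≫ homProdπ F G x

variable {F G}

theorem homLeft_homRight_iff {A : V} (f : A ⟶ homProd F G) :
    f ≫ homLeft F G = f ≫ homRight F G ↔ ∀ x y : C,
      (β_ A (x ⟶[V] y)).hom ≫ (F.map x y ⊗ₘ (f ≫ homProdπ F G y)) ≫ eComp V _ _ _ =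
        ((f ≫ homProdπ F G x) ⊗ₘ G.map x y) ≫ eComp V _ _ _ := by
  have key : ∀ x y : C,
      f ≫ MonoidalClosed.curry ((F.map x y ⊗ₘ homProdπ F G y) ≫ eComp V _ _ _) =
        f ≫ MonoidalClosed.curry
          ((β_ _ _).hom ≫ (homProdπ F G x ⊗ₘ G.map x y) ≫ eComp V _ _ _) ↔
      (β_ A (x ⟶[V] y)).hom ≫ (F.map x y ⊗ₘ (f ≫ homProdπ F G y)) ≫ eComp V _ _ _ =
        ((f ≫ homProdπ F G x) ⊗ₘ G.map x y) ≫ eComp V _ _ _ := by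
    intro x y
    rw [← MonoidalClosed.curry_natural_left, ← MonoidalClosed.curry_natural_left,
      MonoidalClosed.curry_injective.eq_iff, tensorHom_comp, comp_tensorHom, Category.assoc,
      Category.assoc, ← cancel_epi (β_ A (x ⟶[V] y)).hom, braiding_naturality_right_assoc,
      SymmetricCategory.symmetry_assoc]
  constructor
  · intro h x y
    rw [← key]
    have := congrArg (· ≫ Pi.π (fun p : C × C =>
      (ihom (p.1 ⟶[V] p.2)).obj (F.obj p.1 ⟶[V] G.obj p.2)) (x, y)) h
    simpa [homLeft, homRight, homProd₂] using this
  · intro h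
    refine Pi.hom_ext _ _ fun p => ?_
    have := (key p.1 p.2).2 (h p.1 p.2)
    simpa [homLeft, homRight, homProd₂] using this

/-- The projections are `V`-natural. -/
def natFam (F G : EnrichedFunctor V C D) : Fam (natObj F G) F G :=
  Fam.mk' (natπ F G) ((homLeft_homRight_iff _).1 (equalizer.condition _ _))

/-- The universal property of `∫ₓ D(F x, G x)`. -/
def natLift {A : V} (σ : Fam A F G) : A ⟶ natObj F G :=
  equalizer.lift (Pi.lift fun x => σ.app' x) ((homLeft_homRight_iff _).2 fun x y => by
    simpa [homProdπ, homProd] using σ.nat x y)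

@[simp]
theorem natLift_π {A : V} (σ : Fam A F G) (x : C) : natLift σ ≫ natπ F G x = σ.app' x :=
  (equalizer.lift_ι_assoc _ _ _).trans (Pi.lift_π (fun x => σ.app' x) x)

theorem natObj_hom_ext {A : V} {f g : A ⟶ natObj F G}
    (h : ∀ x, f ≫ natπ F G x = g ≫ natπ F G x) : f = g := by
  refine equalizer.hom_ext (Pi.hom_ext _ _ fun x => ?_)
  exact (Category.assoc _ _ _).trans ((h x).trans (Category.assoc _ _ _).symm)

end HomObject

/-- Composition of `V`-natural transformations, as a morphism of `V`. -/
def natComp (F G H : EnrichedFunctor V C D) : natObj F G ⊗ natObj G H ⟶ natObj F H :=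
  natLift ((natFam F G).vcomp (natFam G H))

theorem natComp_π (F G H : EnrichedFunctor V C D) (x : C) :
    natComp F G H ≫ natπ F H x = (natπ F G x ⊗ₘ natπ G H x) ≫ eComp V _ _ _ :=
  natLift_π _ _

/-- The identity `V`-natural transformation, as an element of `∫ₓ D(F x, F x)`. -/
def natId (F : EnrichedFunctor V C D) : 𝟙_ V ⟶ natObj F F := natLift (Fam.one F)

theorem natId_π (F : EnrichedFunctor V C D) (x : C) :
    natId F ≫ natπ F F x = eId V (F.obj x) :=
  natLift_π _ _

/-- The `V`-category `[C, D]` of `V`-functors from a small `V`-category `C` to `D`. -/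
instance functorCategory : EnrichedCategory V (EnrichedFunctor V C D) where
  Hom F G := natObj F G
  id F := natId F
  comp F G H := natComp F G H
  id_comp F G := natObj_hom_ext fun x => by
    rw [Category.assoc, Category.assoc, natComp_π, MonoidalCategory.tensorHom_def_assoc,
      ← comp_whiskerRight_assoc, natId_π, ← whisker_exchange_assoc,
      ← leftUnitor_inv_naturality_assoc, e_id_comp]
    simp
  comp_id F G := natObj_hom_ext fun x => by
    rw [Category.assoc, Category.assoc, natComp_π, MonoidalCategory.tensorHom_def'_assoc,
      ← MonoidalCategory.whiskerLeft_comp_assoc, natId_π, whisker_exchange_assoc,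
      ← rightUnitor_inv_naturality_assoc, e_comp_id]
    simp
  assoc F G H K := natObj_hom_ext fun x => by
    rw [Category.assoc, Category.assoc, Category.assoc, natComp_π, natComp_π, ← comp_tensorHom_assoc,
      ← tensorHom_comp_assoc, natComp_π, natComp_π, eComp_tensor_assoc]

end FunctorCategory

section Representable

variable {V : Type v} [Category.{w} V] [MonoidalCategory V] [MonoidalClosed V]

theorem uncurry_tensor_comp {A B X Y Z : V} (f : A ⟶ (ihom X).obj Y) (g : B ⟶ (ihom Y).obj Z) :
    MonoidalClosed.uncurry ((f ⊗ₘ g) ≫ eComp V X Y Z) =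
      (α_ X A B).inv ≫ (MonoidalClosed.uncurry f ▷ B) ≫ MonoidalClosed.uncurry g := by
  rw [MonoidalClosed.uncurry_natural_left, MonoidalClosed.enrichedCategorySelf_comp,
    MonoidalClosed.comp_eq, MonoidalClosed.uncurry_curry, MonoidalClosed.compTranspose_eq,
    MonoidalClosed.uncurry_eq, MonoidalClosed.uncurry_eq, MonoidalCategory.tensorHom_def]
  simp only [MonoidalCategory.whiskerLeft_comp, Category.assoc, comp_whiskerRight]
  rw [associator_inv_naturality_right_assoc, whisker_exchange_assoc,
    associator_inv_naturality_middle_assoc]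
  rfl

variable {A : Type u₁} [EnrichedCategory V A] {B : Type u₂} [EnrichedCategory V B]

/-- The representable `V`-functor `A(a, -) : A ⟶ V`. -/
abbrev rep (a : A) : EnrichedFunctor V A V where
  obj x := (a ⟶[V] x)
  map x y := MonoidalClosed.curry (eComp V a x y)
  map_id x := by
    apply MonoidalClosed.uncurry_injective
    rw [MonoidalClosed.uncurry_natural_left, MonoidalClosed.uncurry_curry,
      MonoidalClosed.enrichedCategorySelf_id, MonoidalClosed.id_eq, MonoidalClosed.uncurry_curry,
      ← cancel_epi (ρ_ _).inv, e_comp_id, Iso.inv_hom_id]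
  map_comp x y z := by
    apply MonoidalClosed.uncurry_injective
    rw [uncurry_tensor_comp, MonoidalClosed.uncurry_natural_left, MonoidalClosed.uncurry_curry,
      MonoidalClosed.uncurry_curry, MonoidalClosed.uncurry_curry, e_assoc]

/-- The underlying transformation `A(l, -) ⟶ B(F l, F -)` of a `V`-functor `F`. -/
def mapFam [BraidedCategory V] (F : EnrichedFunctor V A B) (l : A) :
    Fam (𝟙_ V) (rep l) (F.comp V (rep (F.obj l))) :=
  Fam.mk' (fun x => MonoidalClosed.curry' (F.map l x)) fun x y => by
    have e : ∀ z : A, MonoidalClosed.uncurry (MonoidalClosed.curry' (F.map l z)) =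
        (ρ_ _).hom ≫ F.map l z := fun z => MonoidalClosed.uncurry_curry _
    change (β_ (𝟙_ V) (x ⟶[V] y)).hom ≫ (MonoidalClosed.curry (eComp V l x y) ⊗ₘ
        MonoidalClosed.curry' (F.map l y)) ≫
          eComp V (l ⟶[V] x) (l ⟶[V] y) (F.obj l ⟶[V] F.obj y) =
      (MonoidalClosed.curry' (F.map l x) ⊗ₘ
        (F.map x y ≫ MonoidalClosed.curry (eComp V (F.obj l) (F.obj x) (F.obj y)))) ≫
          eComp V (l ⟶[V] x) (F.obj l ⟶[V] F.obj x) (F.obj l ⟶[V] F.obj y)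
    apply MonoidalClosed.uncurry_injective
    rw [MonoidalClosed.uncurry_natural_left, uncurry_tensor_comp, uncurry_tensor_comp, e, e,
      MonoidalClosed.uncurry_natural_left, MonoidalClosed.uncurry_curry,
      MonoidalClosed.uncurry_curry, braiding_tensorUnit_left, rightUnitor_naturality_assoc,
      F.map_comp, MonoidalCategory.tensorHom_def, comp_whiskerRight]
    simp

/-- The transformation `A(l, -) ⟶ A(a, -)` given by composition, indexed by `A(a, l)`. -/
def yonedaFam [SymmetricCategory V] (a l : A) : Fam (a ⟶[V] l) (rep l) (rep a) :=
  Fam.mk' (fun x => MonoidalClosed.curry ((β_ _ _).hom ≫ eComp V a l x)) fun x y => by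
    change (β_ (a ⟶[V] l) (x ⟶[V] y)).hom ≫ (MonoidalClosed.curry (eComp V l x y) ⊗ₘ
        MonoidalClosed.curry ((β_ _ _).hom ≫ eComp V a l y)) ≫
          eComp V (l ⟶[V] x) (l ⟶[V] y) (a ⟶[V] y) =
      (MonoidalClosed.curry ((β_ _ _).hom ≫ eComp V a l x) ⊗ₘ
        MonoidalClosed.curry (eComp V a x y)) ≫ eComp V (l ⟶[V] x) (a ⟶[V] x) (a ⟶[V] y)
    apply MonoidalClosed.uncurry_injective
    rw [MonoidalClosed.uncurry_natural_left, uncurry_tensor_comp, uncurry_tensor_comp]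
    simp only [MonoidalClosed.uncurry_curry]
    rw [braiding_naturality_left_assoc, ← e_assoc, comp_whiskerRight, Category.assoc]
    simp only [← Category.assoc]
    congr 2
    simp only [braiding_tensor_left_hom, Category.assoc, Iso.hom_inv_id, Category.comp_id]
    rw [Iso.inv_hom_id_assoc, ← MonoidalCategory.whiskerLeft_comp_assoc,
      SymmetricCategory.symmetry, MonoidalCategory.whiskerLeft_id, Category.id_comp]

end Representable

section Opposite

variable {V : Type v} [Category.{w} V] [MonoidalCategory V] [BraidedCategory V]
variable {A : Type u₁} [EnrichedCategory V A] {B : Type u₂} [EnrichedCategory V B]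

/-- The opposite `Aᵒᵖ ⟶ Bᵒᵖ` of a `V`-functor. -/
abbrev opFunctor (F : EnrichedFunctor V A B) : EnrichedFunctor V Aᵒᵖ Bᵒᵖ where
  obj x := op (F.obj x.unop)
  map x y := F.map y.unop x.unop
  map_id x := F.map_id x.unop
  map_comp x y z := by
    rw [eComp_op_eq, eComp_op_eq, Category.assoc, F.map_comp]
    exact (braiding_naturality_assoc _ _ _).symm

end Opposite

section WeightedLimits

variable {V : Type v} [Category.{w} V] [MonoidalCategory V] [SymmetricCategory V]
  [MonoidalClosed V] [HasLimits V]
variable {J : Type w} [EnrichedCategory V J] {A : Type u₁} [EnrichedCategory V A]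
  {B : Type u₂} [EnrichedCategory V B]

/-- For a counit `μ : φ ⟶ A(l, T -)` (a `V`-natural transformation, given as an element
`𝟙_ V ⟶ [J, V](φ, A(l, T -))` of the hom-object of `[J, V]`), the
morphism `A(a, l) ⟶ [J, V](φ, A(a, T -))` of `V` that it induces. -/
def limitComparison (φ : EnrichedFunctor V J V) (T : EnrichedFunctor V J A) (l : A)
    (μ : 𝟙_ V ⟶ (φ ⟶[V] T.comp V (rep l))) (a : A) :
    (a ⟶[V] l) ⟶ (φ ⟶[V] T.comp V (rep a)) :=
  (λ_ _).inv ≫ (μ ⊗ₘ natLift ((yonedaFam a l).restrict T)) ≫ eComp V φ _ _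

/-- `l`, with counit `μ : φ ⟶ A(l, T -)`, is the limit `{φ, T}` of `T` weighted by `φ`. -/
def IsWeightedLimit (φ : EnrichedFunctor V J V) (T : EnrichedFunctor V J A) (l : A)
    (μ : 𝟙_ V ⟶ (φ ⟶[V] T.comp V (rep l))) : Prop :=
  ∀ a : A, IsIso (limitComparison φ T l μ a)

/-- The composite `φ ⟶ A(l, T -) ⟶ B(F l, F T -)`. -/
def mapCounit (F : EnrichedFunctor V A B) (φ : EnrichedFunctor V J V)
    (T : EnrichedFunctor V J A) (l : A) (μ : 𝟙_ V ⟶ (φ ⟶[V] T.comp V (rep l))) :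
    𝟙_ V ⟶ (φ ⟶[V] (T.comp V F).comp V (rep (F.obj l))) :=
  (λ_ _).inv ≫ (μ ⊗ₘ natLift (((mapFam F l).restrict T).assocTarget)) ≫ eComp V φ _ _

/-- `F` preserves the limits of `T` weighted by `φ` (all those that exist). -/
def PreservesWeightedLimit (F : EnrichedFunctor V A B) (φ : EnrichedFunctor V J V)
    (T : EnrichedFunctor V J A) : Prop :=
  ∀ (l : A) (μ : 𝟙_ V ⟶ (φ ⟶[V] T.comp V (rep l))), IsWeightedLimit φ T l μ →
    IsWeightedLimit φ (T.comp V F) (F.obj l) (mapCounit F φ T l μ)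

variable {K : Type w} [EnrichedCategory V K]

/-- `c`, with unit `η : φ ⟶ A(S -, c)`, is the colimit `φ * S` of `S : K ⟶ A` weighted by
`φ : Kᵒᵖ ⟶ V`, that is, the limit of `Sᵒᵖ` weighted by `φ`. -/
def IsWeightedColimit (φ : EnrichedFunctor V Kᵒᵖ V) (S : EnrichedFunctor V K A) (c : A)
    (η : 𝟙_ V ⟶ (φ ⟶[V] (opFunctor S).comp V (rep (op c)))) : Prop :=
  IsWeightedLimit φ (opFunctor S) (op c) η

/-- `F` preserves the colimits of `S` weighted by `φ` (all those that exist). -/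
def PreservesWeightedColimit (F : EnrichedFunctor V A B) (φ : EnrichedFunctor V Kᵒᵖ V)
    (S : EnrichedFunctor V K A) : Prop :=
  PreservesWeightedLimit (opFunctor F) φ (opFunctor S)

end WeightedLimits

section Classes

variable (V : Type v) [Category.{w} V] [MonoidalCategory V] [SymmetricCategory V]
  [MonoidalClosed V]

/-- A class of weights: for each small `V`-category `K`, a class of presheaves `Kᵒᵖ ⟶ V`.
Small means that the objects form a type in the universe `w` of the hom-sets of `V`. -/
def WeightClass :=
  ∀ (K : Type w) [EnrichedCategory V K], Set (EnrichedFunctor V Kᵒᵖ V)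

variable {V} [HasLimits V]

namespace WeightClass

/-- `A` is `Φ`-cocomplete: it admits all `Φ`-weighted colimits. -/
def Cocomplete (Φ : WeightClass V) (A : Type u) [EnrichedCategory V A] : Prop :=
  ∀ (K : Type w) [EnrichedCategory V K], ∀ φ ∈ Φ K, ∀ S : EnrichedFunctor V K A,
    ∃ c η, IsWeightedColimit φ S c η

/-- The full subcategory `Q` of `B` is closed under the formation of `Φ`-colimits in `B`. -/
def ClosedUnder (Φ : WeightClass V) {B : Type u} [EnrichedCategory V B] (Q : Set B) : Prop :=
  ∀ (K : Type w) [EnrichedCategory V K], ∀ φ ∈ Φ K, ∀ S : EnrichedFunctor V K B,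
    (∀ k, S.obj k ∈ Q) → ∀ c η, IsWeightedColimit φ S c η → c ∈ Q

/-- The full subcategory `Q` of `B` is replete. -/
def _root_.EnrichedWeights.Replete {B : Type u} [EnrichedCategory V B] (Q : Set B) : Prop :=
  ∀ b b' : B, b ∈ Q → Nonempty (ForgetEnrichment.of V b ≅ ForgetEnrichment.of V b') → b' ∈ Q

/-- The closure `Φ{P}` of the full subcategory `P` in `B` under `Φ`-colimits: the smallest full
replete subcategory of `B` that contains `P` and is closed under `Φ`-colimits. -/
def closure (Φ : WeightClass V) {B : Type u} [EnrichedCategory V B] (P : Set B) : Set B :=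
  ⋂₀ {Q | P ⊆ Q ∧ Replete (V := V) Q ∧ Φ.ClosedUnder Q}

/-- The free `Φ`-cocompletion `Φ(N)` of a small `N`, as the closure under `Φ`-colimits in
`[Nᵒᵖ, V]` of the representables `N(-, n) = Nᵒᵖ(n, -)`. -/
def freeCocompletion (Φ : WeightClass V) (N : Type w) [EnrichedCategory V N] :
    Set (EnrichedFunctor V Nᵒᵖ V) :=
  Φ.closure (Set.range fun n : N => rep (op n))

/-- The class `Φ⁺` of `Φ`-flat weights: those `φ : Lᵒᵖ ⟶ V` such that `φ`-colimits commute in `V`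
with `Φ`-limits, i.e. such that `{ψ, -} = [Kᵒᵖ, V](ψ, -) : [Kᵒᵖ, V] ⟶ V` preserves `φ`-colimits
for every `ψ : Kᵒᵖ ⟶ V` in `Φ`. -/
def flat (Φ : WeightClass V) : WeightClass V := fun L _ =>
  {φ | ∀ (K : Type w) [EnrichedCategory V K], ∀ ψ ∈ Φ K,
    ∀ S : EnrichedFunctor V L (EnrichedFunctor V Kᵒᵖ V), PreservesWeightedColimit (rep ψ) φ S}

/-- `Φ-Conts[Nᵒᵖ, V]`: the presheaves `Nᵒᵖ ⟶ V` that preserve all `Φ`-weighted limits. -/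
def continuous (Φ : WeightClass V) (N : Type w) [EnrichedCategory V N] :
    Set (EnrichedFunctor V Nᵒᵖ V) :=
  {G | ∀ (K : Type w) [EnrichedCategory V K], ∀ φ ∈ Φ K, ∀ T : EnrichedFunctor V Kᵒᵖ Nᵒᵖ,
    PreservesWeightedLimit G φ T}

end WeightClass

end Classes

end EnrichedWeights

end

noncomputable section

set_option linter.unusedSectionVars false

/-! Write `C` for the presheaves preserving `Φ`-limits and `Y` for the Yoneda embedding of `N`.

The inclusion. For a limit `l = {ψ, T}` in `Nᵒᵖ`, a presheaf `G` preserves it exactly when the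
canonical map `G l ⟶ {ψ, G T}` (`limitMap`) is invertible. This map is natural in `G`. Its source is
evaluation at `l`, its target is restriction along `T` followed by `{ψ, -}`. Evaluation and
restriction preserve all colimits because colimits of presheaves are pointwise, and `{ψ, -}`
preserves `Φ`-flat ones by definition. So `C` is closed under flat colimits
(`closedUnder_continuous`); it is replete and contains the representables, hence contains `Φ⁺(N)`.

The criterion. One direction holds because `Φ(N)` contains the representables. For the other, call
`u : x ⟶ y` orthogonal to `C` if `[y, z] ⟶ [x, z]` is invertible for every `z` in `C`. When the
targets lie in `C`, a family of orthogonal maps out of a diagram makes the targets a diagram too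
(`universalFunctor`), and the induced map of colimits is again orthogonal; the target cocone needs
to be a colimit only as seen by members of `C` (`exists_isOrthogonal_of_isWeightedColimit`). Applied
with representable targets, whose colimits are computed in `N` and which `C` sees as colimits of
presheaves (`isIso_comparison_yonedaFunctor`), this sends every object of `Φ(N)` to a representable.
Applied with targets in `Φ⁺(N)`, it sends every object of `Φ⁺{Φ(N)}` to an object of `Φ⁺(N)`. If
such an object `G` is itself in `C`, then its orthogonal map to `Φ⁺(N) ⊆ C` has both ends in `C`, so
it is invertible and `G` lies in `Φ⁺(N)`.

Flat presheaves. `Φ⁺(N)` consists exactly of the flat presheaves on `N`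
(`freeCocompletion_flat_eq`). Colimits with representable weights are absolute, and flat weights are
closed under flat colimits since `(φ * S) * T` is `φ * (S - * T)`. Conversely each presheaf is the
colimit of `Y` weighted by itself.

Limits and colimits are both handled as universal elements of a `V`-functor (`IsUniversal`), and the
fact that partial left adjoints preserve colimits, in the pointwise form `isIso_comparison_iff`,
serves both the orthogonality argument and the iterated colimit of weights. -/

namespace EnrichedWeights

open MonoidalClosed (curry uncurry curry' uncurry' uncurry_curry curry_uncurry
  uncurry_natural_left uncurry_natural_right curry_natural_left uncurry_injective)

/-! ### Calculus of elements `𝟙_ V ⟶ (x ⟶[V] y)` of hom-objects -/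

section Basic

variable {V : Type v} [Category.{w} V] [MonoidalCategory V]
variable {A : Type u₁} [EnrichedCategory V A] {B : Type u₂} [EnrichedCategory V B]
  {E : Type u₃} [EnrichedCategory V E]

/-- Precomposition with an element of a hom-object. -/
def ePre {x y : A} (f : 𝟙_ V ⟶ (x ⟶[V] y)) (z : A) : (y ⟶[V] z) ⟶ (x ⟶[V] z) :=
  (λ_ _).inv ≫ (f ▷ _) ≫ eComp V x y z

/-- Postcomposition with an element of a hom-object. -/
def ePost {y z : A} (f : 𝟙_ V ⟶ (y ⟶[V] z)) (x : A) : (x ⟶[V] y) ⟶ (x ⟶[V] z) :=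
  (ρ_ _).inv ≫ (_ ◁ f) ≫ eComp V x y z

theorem ePre_eId (x z : A) : ePre (eId V x) z = 𝟙 _ := e_id_comp V x z

theorem ePost_eId (x z : A) : ePost (eId V x) z = 𝟙 _ := e_comp_id V z x

theorem eId_ePre {x y : A} (f : 𝟙_ V ⟶ (x ⟶[V] y)) : eId V y ≫ ePre f y = f := by
  have h := congrArg (f ≫ ·) (e_comp_id V x y)
  simp only [Category.comp_id] at h
  rw [ePre, leftUnitor_inv_naturality_assoc, whisker_exchange_assoc, unitors_inv_equal,
    ← rightUnitor_inv_naturality_assoc, h]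

theorem eId_ePost {x y : A} (f : 𝟙_ V ⟶ (x ⟶[V] y)) : eId V x ≫ ePost f x = f := by
  have h := congrArg (f ≫ ·) (e_id_comp V x y)
  simp only [Category.comp_id] at h
  rw [ePost, rightUnitor_inv_naturality_assoc, ← whisker_exchange_assoc, ← unitors_inv_equal,
    ← leftUnitor_inv_naturality_assoc, h]

theorem ePre_whiskerRight_eComp {w x y z : A} (f : 𝟙_ V ⟶ (w ⟶[V] x)) :
    (ePre f y ▷ (y ⟶[V] z)) ≫ eComp V w y z = eComp V x y z ≫ ePre f z := by
  rw [ePre, ePre, leftUnitor_inv_naturality_assoc, whisker_exchange_assoc, ← e_assoc]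
  simp [comp_whiskerRight, e_assoc']

theorem whiskerLeft_ePost_eComp {w x y z : A} (f : 𝟙_ V ⟶ (y ⟶[V] z)) :
    ((w ⟶[V] x) ◁ ePost f x) ≫ eComp V w x z = eComp V w x y ≫ ePost f w := by
  rw [ePost, ePost, rightUnitor_inv_naturality_assoc, ← whisker_exchange_assoc, ← e_assoc']
  simp [MonoidalCategory.whiskerLeft_comp]

theorem ePost_whiskerRight_eComp {w x y z : A} (f : 𝟙_ V ⟶ (x ⟶[V] y)) :
    (ePost f w ▷ (y ⟶[V] z)) ≫ eComp V w y z = ((w ⟶[V] x) ◁ ePre f z) ≫ eComp V w x z := by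
  simp only [ePre, ePost, comp_whiskerRight, MonoidalCategory.whiskerLeft_comp, Category.assoc]
  rw [← e_assoc]
  simp

theorem ePre_ePost {w x y z : A} (f : 𝟙_ V ⟶ (w ⟶[V] x)) (g : 𝟙_ V ⟶ (y ⟶[V] z)) :
    ePre f y ≫ ePost g w = ePost g x ≫ ePre f z := by
  rw [ePost, rightUnitor_inv_naturality_assoc, ← whisker_exchange_assoc, ePre_whiskerRight_eComp]
  simp [ePost]

/-- The composite of two elements is written `f ≫ ePost g w` throughout; the other bracketing is
available through this equation. -/
theorem comp_ePost_eq_comp_ePre {w x y : A} (f : 𝟙_ V ⟶ (w ⟶[V] x)) (g : 𝟙_ V ⟶ (x ⟶[V] y)) :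
    f ≫ ePost g w = g ≫ ePre f y := by
  rw [ePre, ePost, rightUnitor_inv_naturality_assoc, leftUnitor_inv_naturality_assoc,
    ← whisker_exchange_assoc, unitors_inv_equal]

theorem ePre_comp {w x y : A} (f : 𝟙_ V ⟶ (w ⟶[V] x)) (g : 𝟙_ V ⟶ (x ⟶[V] y)) (z : A) :
    ePre (f ≫ ePost g w) z = ePre g z ≫ ePre f z := by
  rw [comp_ePost_eq_comp_ePre]
  have : ePre (g ≫ ePre f y) z =
      (λ_ _).inv ≫ (g ▷ _) ≫ (ePre f y ▷ (y ⟶[V] z)) ≫ eComp V w y z := by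
    rw [ePre, comp_whiskerRight, Category.assoc]
  rw [this, ePre_whiskerRight_eComp]
  simp [ePre]

theorem ePost_comp {x y z : A} (f : 𝟙_ V ⟶ (x ⟶[V] y)) (g : 𝟙_ V ⟶ (y ⟶[V] z)) (w : A) :
    ePost (f ≫ ePost g x) w = ePost f w ≫ ePost g w := by
  have : ePost (f ≫ ePost g x) w =
      (ρ_ _).inv ≫ (_ ◁ f) ≫ ((w ⟶[V] x) ◁ ePost g x) ≫ eComp V w x z := by
    rw [ePost, MonoidalCategory.whiskerLeft_comp, Category.assoc]
  rw [this, whiskerLeft_ePost_eComp]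
  simp [ePost]

theorem map_ePre (F : EnrichedFunctor V A B) {x y : A} (f : 𝟙_ V ⟶ (x ⟶[V] y)) (z : A) :
    ePre f z ≫ F.map x z = F.map y z ≫ ePre (f ≫ F.map x y) (F.obj z) := by
  simp only [ePre, Category.assoc, F.map_comp, MonoidalCategory.tensorHom_def, comp_whiskerRight]
  rw [leftUnitor_inv_naturality_assoc, whisker_exchange_assoc, whisker_exchange_assoc]

theorem map_ePre_assoc (F : EnrichedFunctor V A B) {x y : A} (f : 𝟙_ V ⟶ (x ⟶[V] y)) (z : A) {Z : V}
    (h : (F.obj x ⟶[V] F.obj z) ⟶ Z) :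
    ePre f z ≫ F.map x z ≫ h = F.map y z ≫ ePre (f ≫ F.map x y) (F.obj z) ≫ h := by
  rw [← Category.assoc, map_ePre, Category.assoc]

theorem map_ePost (F : EnrichedFunctor V A B) {y z : A} (f : 𝟙_ V ⟶ (y ⟶[V] z)) (x : A) :
    ePost f x ≫ F.map x z = F.map x y ≫ ePost (f ≫ F.map y z) (F.obj x) := by
  simp only [ePost, Category.assoc, F.map_comp, MonoidalCategory.tensorHom_def',
    MonoidalCategory.whiskerLeft_comp]
  rw [rightUnitor_inv_naturality_assoc, ← whisker_exchange_assoc, ← whisker_exchange_assoc]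

/-- `V`-naturality of a family of elements `𝟙_ V ⟶ B(F x, G x)`. -/
def IsENat (F G : EnrichedFunctor V A B) (α : ∀ x, 𝟙_ V ⟶ (F.obj x ⟶[V] G.obj x)) : Prop :=
  ∀ x y, F.map x y ≫ ePost (α y) (F.obj x) = G.map x y ≫ ePre (α x) (G.obj y)

/-- The element `u` of `E(e, I a)` exhibits `a` as a partial left adjoint of `I` at `e`. -/
def IsUniversal (I : EnrichedFunctor V A E) (e : E) (a : A) (u : 𝟙_ V ⟶ (e ⟶[V] I.obj a)) :
    Prop :=
  ∀ b, IsIso (I.map a b ≫ ePre u (I.obj b))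

/-- The elements `f` and `g` are inverse to each other. -/
structure AreInverse {x y : A} (f : 𝟙_ V ⟶ (x ⟶[V] y)) (g : 𝟙_ V ⟶ (y ⟶[V] x)) : Prop where
  left : f ≫ ePost g x = eId V x
  right : g ≫ ePost f y = eId V y

namespace AreInverse

variable {x y : A} {f : 𝟙_ V ⟶ (x ⟶[V] y)} {g : 𝟙_ V ⟶ (y ⟶[V] x)}

theorem symm (h : AreInverse f g) : AreInverse g f := ⟨h.2, h.1⟩

theorem isIso_ePre (h : AreInverse f g) (z : A) : IsIso (ePre f z) :=
  ⟨ePre g z, by rw [← ePre_comp, h.2, ePre_eId], by rw [← ePre_comp, h.1, ePre_eId]⟩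

theorem isIso_ePost (h : AreInverse f g) (z : A) : IsIso (ePost f z) :=
  ⟨ePost g z, by rw [← ePost_comp, h.1, ePost_eId], by rw [← ePost_comp, h.2, ePost_eId]⟩

theorem map (h : AreInverse f g) (F : EnrichedFunctor V A B) :
    AreInverse (f ≫ F.map x y) (g ≫ F.map y x) :=
  ⟨by rw [Category.assoc, ← map_ePost, ← Category.assoc, h.1, F.map_id],
   by rw [Category.assoc, ← map_ePost, ← Category.assoc, h.2, F.map_id]⟩

end AreInverse

/-- An element is invertible if precomposition with it is. -/
theorem exists_areInverse_of_isIso_ePre {x y : A} (f : 𝟙_ V ⟶ (x ⟶[V] y)) [IsIso (ePre f x)]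
    [IsIso (ePre f y)] : ∃ g, AreInverse f g := by
  refine ⟨eId V x ≫ inv (ePre f x), ?_, ?_⟩
  · rw [comp_ePost_eq_comp_ePre]; simp
  · rw [← cancel_mono (ePre f y), Category.assoc, ← ePre_ePost, eId_ePre, Category.assoc,
      IsIso.inv_hom_id_assoc, eId_ePost]

theorem exists_areInverse_of_ePre {x y : A} (f : 𝟙_ V ⟶ (x ⟶[V] y)) (h : ∀ z, IsIso (ePre f z)) :
    ∃ g, AreInverse f g := by
  have := h x
  have := h y
  exact exists_areInverse_of_isIso_ePre f

theorem homOf_comp_homOf {x y z : A} (f : 𝟙_ V ⟶ (x ⟶[V] y)) (g : 𝟙_ V ⟶ (y ⟶[V] z)) :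
    ForgetEnrichment.homOf V f ≫ ForgetEnrichment.homOf V g =
      ForgetEnrichment.homOf V (f ≫ ePost g x) := by
  rw [← ForgetEnrichment.homOf_comp, ePost, rightUnitor_inv_naturality_assoc,
    MonoidalCategory.tensorHom_def, unitors_inv_equal]
  simp

theorem exists_areInverse_of_iso {x y : A}
    (h : Nonempty (ForgetEnrichment.of V x ≅ ForgetEnrichment.of V y)) :
    ∃ (f : 𝟙_ V ⟶ (x ⟶[V] y)) (g : 𝟙_ V ⟶ (y ⟶[V] x)), AreInverse f g := by
  obtain ⟨i⟩ := h
  refine ⟨ForgetEnrichment.homTo V i.hom, ForgetEnrichment.homTo V i.inv, ?_, ?_⟩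
  · have h := homOf_comp_homOf (A := A) (ForgetEnrichment.homTo V i.hom)
      (ForgetEnrichment.homTo V i.inv)
    exact h.symm.trans (i.hom_inv_id.trans (ForgetEnrichment.homOf_eId V x).symm)
  · have h := homOf_comp_homOf (A := A) (ForgetEnrichment.homTo V i.inv)
      (ForgetEnrichment.homTo V i.hom)
    exact h.symm.trans (i.inv_hom_id.trans (ForgetEnrichment.homOf_eId V y).symm)

theorem nonempty_iso_of_areInverse {x y : A} {f : 𝟙_ V ⟶ (x ⟶[V] y)} {g : 𝟙_ V ⟶ (y ⟶[V] x)}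
    (h : AreInverse f g) : Nonempty (ForgetEnrichment.of V x ≅ ForgetEnrichment.of V y) :=
  ⟨⟨ForgetEnrichment.homOf V f, ForgetEnrichment.homOf V g,
    by rw [homOf_comp_homOf, h.1]; exact ForgetEnrichment.homOf_eId V x,
    by rw [homOf_comp_homOf, h.2]; exact ForgetEnrichment.homOf_eId V y⟩⟩

end Basic

/-! ### Elements of internal homs and morphisms of `V` -/

section Self

variable {V : Type v} [Category.{w} V] [MonoidalCategory V] [MonoidalClosed V]

/-- The element of the internal hom given by a morphism. -/
def elt {X Y : V} (f : X ⟶ Y) : 𝟙_ V ⟶ EnrichedCategory.Hom X Y := curry' f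

/-- The morphism given by an element of the internal hom. -/
def unelt {X Y : V} (f : 𝟙_ V ⟶ EnrichedCategory.Hom X Y) : X ⟶ Y := uncurry' f

@[simp]
theorem elt_unelt {X Y : V} (f : 𝟙_ V ⟶ EnrichedCategory.Hom X Y) : elt (unelt f) = f :=
  MonoidalClosed.curry'_uncurry' f

@[simp]
theorem unelt_elt {X Y : V} (f : X ⟶ Y) : unelt (elt f) = f :=
  MonoidalClosed.uncurry'_curry' f

theorem unelt_eq {X Y : V} (f : 𝟙_ V ⟶ EnrichedCategory.Hom X Y) : unelt f = (ρ_ X).inv ≫ uncurry f := rfl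

theorem uncurry_eq_unelt {X Y : V} (f : 𝟙_ V ⟶ EnrichedCategory.Hom X Y) :
    uncurry f = (ρ_ X).hom ≫ unelt f := by
  rw [unelt_eq, Iso.hom_inv_id_assoc]

theorem uncurry_comp_ePost {X Y Z W : V} (g : W ⟶ EnrichedCategory.Hom X Y) (f : 𝟙_ V ⟶ EnrichedCategory.Hom Y Z) :
    uncurry (g ≫ ePost f X) = uncurry g ≫ unelt f := by
  have : ePost f X = (ihom X).map (unelt f) := by
    rw [← MonoidalClosed.enrichedOrdinaryCategorySelf_eHomWhiskerLeft]
    conv_lhs => rw [← elt_unelt f]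
    rfl
  rw [this]
  exact uncurry_natural_right g _

theorem uncurry_comp_ePre {X Y Z W : V} (g : W ⟶ EnrichedCategory.Hom Y Z)
    (f : 𝟙_ V ⟶ EnrichedCategory.Hom X Y) :
    uncurry (g ≫ ePre f Z) = (unelt f ▷ W) ≫ uncurry g := by
  have : ePre f Z = (MonoidalClosed.pre (unelt f)).app Z := by
    rw [← MonoidalClosed.enrichedOrdinaryCategorySelf_eHomWhiskerRight]
    conv_lhs => rw [← elt_unelt f]
    rfl
  rw [this]
  exact MonoidalClosed.uncurry_pre_app (A := Y) (X := Z) (Y := W) g (unelt f)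

theorem unelt_comp_ePost {X Y Z : V} (f : 𝟙_ V ⟶ EnrichedCategory.Hom X Y) (g : 𝟙_ V ⟶ EnrichedCategory.Hom Y Z) :
    unelt (f ≫ ePost g X) = unelt f ≫ unelt g := by
  rw [unelt_eq, uncurry_comp_ePost, unelt_eq f, Category.assoc]

theorem unelt_injective {X Y : V} :
    Function.Injective (unelt : (𝟙_ V ⟶ EnrichedCategory.Hom X Y) → (X ⟶ Y)) :=
  Function.LeftInverse.injective elt_unelt

@[simp]
theorem unelt_eId (X : V) : unelt (eId V X) = 𝟙 X :=
  (congrArg uncurry' (MonoidalClosed.curry'_id X).symm).trans (MonoidalClosed.uncurry'_curry' _)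

theorem exists_areInverse_of_isIso {X Y : V} (f : 𝟙_ V ⟶ EnrichedCategory.Hom X Y) [IsIso (unelt f)] :
    ∃ g, AreInverse f g :=
  ⟨elt (inv (unelt f)), unelt_injective (by simp [unelt_comp_ePost]),
    unelt_injective (by simp [unelt_comp_ePost])⟩

theorem AreInverse.isIso_unelt {X Y : V} {f : 𝟙_ V ⟶ EnrichedCategory.Hom X Y} {g : 𝟙_ V ⟶ EnrichedCategory.Hom Y X}
    (h : AreInverse f g) : IsIso (unelt f) :=
  ⟨unelt g, by rw [← unelt_comp_ePost, h.1, unelt_eId],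
    by rw [← unelt_comp_ePost, h.2, unelt_eId]⟩

end Self

/-! ### Elements of `[J, D]` and their components -/

section FunctorCategory

variable {V : Type v} [Category.{w} V] [MonoidalCategory V] [SymmetricCategory V]
  [MonoidalClosed V] [HasLimits V]
variable {J : Type w} [EnrichedCategory V J] {K : Type w} [EnrichedCategory V K]
  {A : Type u₁} [EnrichedCategory V A] {D : Type u₂} [EnrichedCategory V D]
  {E : Type u₃} [EnrichedCategory V E]

/-- Evaluation at an object. -/
abbrev evalAt (D : Type u₂) [EnrichedCategory V D] (j : J) :
    EnrichedFunctor V (EnrichedFunctor V J D) D where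
  obj F := F.obj j
  map F G := natπ F G j
  map_id F := natId_π F j
  map_comp F G H := natComp_π F G H j

/-- Restriction along a `V`-functor. -/
abbrev restrictAlong (D : Type u₂) [EnrichedCategory V D] (T : EnrichedFunctor V J K) :
    EnrichedFunctor V (EnrichedFunctor V K D) (EnrichedFunctor V J D) where
  obj F := T.comp V F
  map F G := natLift ((natFam F G).restrict T)
  map_id F := natObj_hom_ext fun j => by
    rw [Category.assoc, natLift_π]
    exact (natId_π F (T.obj j)).trans (natId_π (T.comp V F) j).symm
  map_comp F G H := natObj_hom_ext fun j => by
    rw [Category.assoc, natLift_π, Category.assoc]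
    refine (natComp_π F G H (T.obj j)).trans ?_
    have h := natComp_π (T.comp V F) (T.comp V G) (T.comp V H) j
    refine Eq.trans ?_ (congrArg (_ ≫ ·) h).symm
    rw [MonoidalCategory.tensorHom_comp_tensorHom_assoc, natLift_π, natLift_π]
    rfl

theorem restrictAlong_map_π (T : EnrichedFunctor V J K) (F G : EnrichedFunctor V K D) (j : J) :
    (restrictAlong D T).map F G ≫ natπ (T.comp V F) (T.comp V G) j = natπ F G (T.obj j) :=
  natLift_π _ _

/-- Over the unit object the braiding is a composite of unitors, so graded naturality is the usual
naturality square between pre- and postcomposition. -/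
theorem graded_unit_iff {x y z : D} {x' : D} {H : V} (f : H ⟶ (x ⟶[V] y)) (a : 𝟙_ V ⟶ (y ⟶[V] z))
    (b : 𝟙_ V ⟶ (x ⟶[V] x')) (g : H ⟶ (x' ⟶[V] z)) :
    (β_ (𝟙_ V) H).hom ≫ (f ⊗ₘ a) ≫ eComp V _ _ _ = (b ⊗ₘ g) ≫ eComp V _ _ _ ↔
      f ≫ ePost a x = g ≫ ePre b z := by
  rw [← cancel_epi (λ_ H).inv, braiding_tensorUnit_left, MonoidalCategory.tensorHom_def f a,
    MonoidalCategory.tensorHom_def' b g, ePre, ePost, rightUnitor_inv_naturality_assoc,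
    leftUnitor_inv_naturality_assoc]
  simp

/-- The element of `[J, D](F, G)` given by a `V`-natural transformation. -/
def natElt {F G : EnrichedFunctor V J D} (α : ∀ x, 𝟙_ V ⟶ (F.obj x ⟶[V] G.obj x))
    (h : IsENat F G α) : 𝟙_ V ⟶ (F ⟶[V] G) :=
  natLift (Fam.mk' α fun x y => (graded_unit_iff _ _ _ _).2 (h x y))

@[simp]
theorem natElt_π {F G : EnrichedFunctor V J D} (α : ∀ x, 𝟙_ V ⟶ (F.obj x ⟶[V] G.obj x))
    (h : IsENat F G α) (j : J) : natElt α h ≫ natπ F G j = α j :=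
  natLift_π _ _

theorem isENat_elt {F G : EnrichedFunctor V J D} (μ : 𝟙_ V ⟶ (F ⟶[V] G)) :
    IsENat F G fun j => μ ≫ natπ F G j := fun x y =>
  (graded_unit_iff _ _ _ _).1 (((natFam F G).reindex μ).nat x y)

theorem ePre_natπ {F G : EnrichedFunctor V J D} (μ : 𝟙_ V ⟶ (F ⟶[V] G))
    (H : EnrichedFunctor V J D) (j : J) :
    ePre μ H ≫ natπ F H j = natπ G H j ≫ ePre (μ ≫ natπ F G j) (H.obj j) :=
  map_ePre (evalAt D j) μ H

theorem ePost_natπ {G H : EnrichedFunctor V J D} (μ : 𝟙_ V ⟶ (G ⟶[V] H))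
    (F : EnrichedFunctor V J D) (j : J) :
    ePost μ F ≫ natπ F H j = natπ F G j ≫ ePost (μ ≫ natπ G H j) (F.obj j) :=
  map_ePost (evalAt D j) μ F

theorem isENat_of_evalAt {P Q : EnrichedFunctor V A (EnrichedFunctor V J D)}
    {α : ∀ a, 𝟙_ V ⟶ (P.obj a ⟶[V] Q.obj a)}
    (h : ∀ j, IsENat (P.comp V (evalAt D j)) (Q.comp V (evalAt D j))
      fun a => α a ≫ natπ (P.obj a) (Q.obj a) j) : IsENat P Q α := fun a b =>
  natObj_hom_ext fun j => by
    have h' := h j a b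
    rw [Category.assoc, Category.assoc, ePost_natπ, ePre_natπ]
    exact (Category.assoc _ _ _).symm.trans (h'.trans (Category.assoc _ _ _))

/-- Componentwise inverses are automatically natural: compose the naturality square of `μ` with the
inverse of its precomposition on one side and of its postcomposition on the other. -/
theorem exists_areInverse_natElt {F G : EnrichedFunctor V J D} (μ : 𝟙_ V ⟶ (F ⟶[V] G))
    (h : ∀ j, ∃ g, AreInverse (μ ≫ natπ F G j) g) : ∃ ν, AreInverse μ ν := by
  choose g hg using h
  have hn : IsENat G F g := fun x y => by
    have e1 := isENat_elt μ x y
    have e2 : ePre (μ ≫ natπ F G x) (G.obj y) ≫ ePre (g x) (G.obj y) = 𝟙 _ := by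
      rw [← ePre_comp, (hg x).2, ePre_eId]
    have e3 : ePost (μ ≫ natπ F G y) (F.obj x) ≫ ePost (g y) (F.obj x) = 𝟙 _ := by
      rw [← ePost_comp, (hg y).1, ePost_eId]
    calc G.map x y ≫ ePost (g y) (G.obj x)
        = (G.map x y ≫ ePre (μ ≫ natπ F G x) (G.obj y)) ≫
            ePre (g x) (G.obj y) ≫ ePost (g y) (G.obj x) := by
          rw [Category.assoc, reassoc_of% e2]
      _ = F.map x y ≫ ePre (g x) (F.obj y) := by
          rw [← e1, ePre_ePost, Category.assoc, reassoc_of% e3]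
  refine ⟨natElt g hn, natObj_hom_ext fun j => ?_, natObj_hom_ext fun j => ?_⟩
  · rw [Category.assoc, ePost_natπ, natElt_π, ← Category.assoc, (hg j).1]
    exact (natId_π F j).symm
  · rw [Category.assoc, ePost_natπ, ← Category.assoc, natElt_π, (hg j).2]
    exact (natId_π G j).symm

end FunctorCategory

/-! ### Weighted limits and colimits as universal elements -/

section Comparison

variable {V : Type v} [Category.{w} V] [MonoidalCategory V] [SymmetricCategory V]
  [MonoidalClosed V] [HasLimits V]
variable {J : Type w} [EnrichedCategory V J] {K : Type w} [EnrichedCategory V K]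
  {A : Type u₁} [EnrichedCategory V A] {D : Type u₂} [EnrichedCategory V D]
  {E : Type u₃} [EnrichedCategory V E]

/-- The `V`-functor `a ↦ A(a, T -)`. -/
abbrev limHom (T : EnrichedFunctor V J A) : EnrichedFunctor V Aᵒᵖ (EnrichedFunctor V J V) where
  obj a := T.comp V (rep a.unop)
  map a b := natLift ((yonedaFam b.unop a.unop).restrict T)
  map_id a := natObj_hom_ext fun j => by
    rw [Category.assoc, natLift_π]
    refine Eq.trans ?_ (natId_π (T.comp V (rep a.unop)) j).symm
    apply uncurry_injective
    change uncurry (eId V a.unop ≫ curry ((β_ _ _).hom ≫ eComp V a.unop a.unop (T.obj j))) =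
      uncurry (curry (ρ_ _).hom)
    rw [uncurry_natural_left, uncurry_curry, uncurry_curry, braiding_naturality_right_assoc,
      braiding_tensorUnit_right, Category.assoc, e_id_comp]
    simp
  map_comp a b c := natObj_hom_ext fun j => by
    have h := natComp_π (T.comp V (rep a.unop)) (T.comp V (rep b.unop)) (T.comp V (rep c.unop)) j
    refine Eq.trans ?_ ((Category.assoc _ _ _).trans (congrArg (_ ≫ ·) h)).symm
    rw [MonoidalCategory.tensorHom_comp_tensorHom_assoc, natLift_π, natLift_π, Category.assoc,
      natLift_π]
    apply uncurry_injective
    change uncurry (((β_ _ _).hom ≫ eComp V c.unop b.unop a.unop) ≫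
        curry ((β_ _ _).hom ≫ eComp V c.unop a.unop (T.obj j))) =
      uncurry ((curry ((β_ _ _).hom ≫ eComp V b.unop a.unop (T.obj j)) ⊗ₘ
        curry ((β_ _ _).hom ≫ eComp V c.unop b.unop (T.obj j))) ≫
          eComp V (a.unop ⟶[V] T.obj j) (b.unop ⟶[V] T.obj j) (c.unop ⟶[V] T.obj j))
    rw [uncurry_tensor_comp, uncurry_natural_left, uncurry_curry, uncurry_curry, uncurry_curry,
      braiding_naturality_right_assoc, comp_whiskerRight, Category.assoc,
      braiding_naturality_left_assoc, ← e_assoc', ← braiding_naturality_right_assoc,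
      braiding_tensor_right_hom, braiding_tensor_left_hom]
    simp

theorem limHom_map_π (T : EnrichedFunctor V J A) (a b : Aᵒᵖ) (j : J) :
    (limHom T).map a b ≫ natπ (T.comp V (rep a.unop)) (T.comp V (rep b.unop)) j =
      curry ((β_ _ _).hom ≫ eComp V b.unop a.unop (T.obj j)) :=
  natLift_π _ _

theorem limitComparison_eq (φ : EnrichedFunctor V J V) (T : EnrichedFunctor V J A) (l : A)
    (μ : 𝟙_ V ⟶ (φ ⟶[V] T.comp V (rep l))) (a : A) :
    limitComparison φ T l μ a = (limHom T).map (op l) (op a) ≫ ePre μ (T.comp V (rep a)) := by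
  rw [limitComparison, ePre, MonoidalCategory.tensorHom_def', leftUnitor_inv_naturality_assoc]
  simp only [Category.assoc]
  rfl

/-- The form in which the universal property is used: a limit is a partial left adjoint of `limHom
T` at the weight, so facts about `IsUniversal` apply to it. -/
theorem isWeightedLimit_iff (φ : EnrichedFunctor V J V) (T : EnrichedFunctor V J A) (l : A)
    (μ : 𝟙_ V ⟶ (φ ⟶[V] T.comp V (rep l))) :
    IsWeightedLimit φ T l μ ↔ IsUniversal (limHom T) φ (op l) μ := by
  refine ⟨fun h b => ?_, fun h a => ?_⟩
  · have := h b.unop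
    rwa [limitComparison_eq] at this
  · have := h (op a)
    rw [limitComparison_eq]
    exact this

/-- The `V`-functor `a ↦ A(S -, a)`. -/
abbrev colimHom (S : EnrichedFunctor V K A) :
    EnrichedFunctor V A (EnrichedFunctor V Kᵒᵖ V) where
  obj a := (opFunctor S).comp V (rep (op a))
  map a b := natLift ((yonedaFam (op b) (op a)).restrict (opFunctor S))
  map_id a := (limHom (opFunctor S)).map_id (op (op a))
  map_comp a b c := by
    have h := (limHom (opFunctor S)).map_comp (op (op a)) (op (op b)) (op (op c))
    refine Eq.trans ?_ h
    -- Composition in the double opposite carries two braidings, which cancel by symmetry.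
    change _ = ((β_ (a ⟶[V] b) (b ⟶[V] c)).hom ≫ (β_ _ _).hom ≫ eComp V a b c) ≫ _
    rw [SymmetricCategory.symmetry_assoc]

theorem colimHom_map_π (S : EnrichedFunctor V K A) (a b : A) (k : Kᵒᵖ) :
    (colimHom S).map a b ≫ natπ ((opFunctor S).comp V (rep (op a)))
      ((opFunctor S).comp V (rep (op b))) k = curry (eComp V (S.obj k.unop) a b) := by
  refine (limHom_map_π (opFunctor S) (op (op a)) (op (op b)) k).trans ?_
  change curry ((β_ _ _).hom ≫ (β_ _ _).hom ≫ eComp V (S.obj k.unop) a b) = _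
  rw [SymmetricCategory.symmetry_assoc]

/-- Replaces testing against the double opposite of `A` by testing against `A` itself. -/
theorem isWeightedColimit_iff (φ : EnrichedFunctor V Kᵒᵖ V) (S : EnrichedFunctor V K A) (c : A)
    (η : 𝟙_ V ⟶ (φ ⟶[V] (opFunctor S).comp V (rep (op c)))) :
    IsWeightedColimit φ S c η ↔ IsUniversal (colimHom S) φ c η := by
  rw [IsWeightedColimit, isWeightedLimit_iff]
  exact ⟨fun h b => h (op (op b)), fun h b => h b.unop.unop⟩

theorem uncurry_opFunctor_rep_map (S : EnrichedFunctor V K A) (a : A) (k k' : Kᵒᵖ) :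
    uncurry (((opFunctor S).comp V (rep (op a))).map k k') =
      (β_ _ _).hom ≫ (S.map k'.unop k.unop ▷ _) ≫ eComp V _ _ a := by
  change uncurry (S.map k'.unop k.unop ≫ curry ((β_ _ _).hom ≫ eComp V _ _ a)) = _
  rw [uncurry_natural_left, uncurry_curry, braiding_naturality_right_assoc]

theorem comp_ePost_whiskerRight {x y z z' : A} {H H' : V} (f : H ⟶ (x ⟶[V] y))
    (u : 𝟙_ V ⟶ (y ⟶[V] z)) (g : H' ⟶ (z ⟶[V] z')) :
    ((f ≫ ePost u x) ▷ H') ≫ (_ ◁ g) ≫ eComp V _ _ _ =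
      (f ▷ H') ≫ (_ ◁ (g ≫ ePre u z')) ≫ eComp V _ _ _ := by
  rw [comp_whiskerRight, Category.assoc, MonoidalCategory.whiskerLeft_comp, Category.assoc,
    ← ePost_whiskerRight_eComp, whisker_exchange_assoc]

/-- The components `A(R k, a) ⟶ E(S k, I a)` induced by a transformation from `S` to `R ≫ I`. -/
def transposeHom (I : EnrichedFunctor V A E) {S : EnrichedFunctor V K E}
    {R : EnrichedFunctor V K A} {u : ∀ k, 𝟙_ V ⟶ (S.obj k ⟶[V] I.obj (R.obj k))}
    (hu : IsENat S (R.comp V I) u) (a : A) :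
    𝟙_ V ⟶ ((colimHom R).obj a ⟶[V] (colimHom S).obj (I.obj a)) :=
  natElt (fun k => elt (I.map (R.obj k.unop) a ≫ ePre (u k.unop) (I.obj a))) fun k k' => by
    apply uncurry_injective
    rw [uncurry_comp_ePost, uncurry_comp_ePre, unelt_elt, unelt_elt]
    refine (congrArg (· ≫ _) (uncurry_opFunctor_rep_map R a k k')).trans (Eq.trans ?_
      (congrArg (_ ≫ ·) (uncurry_opFunctor_rep_map S (I.obj a) k k')).symm)
    have hk : S.map _ _ ≫ ePost (u k.unop) _ =
        R.map _ _ ≫ I.map _ _ ≫ ePre (u k'.unop) (I.obj (R.obj k.unop)) :=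
      (hu k'.unop k.unop).trans (Category.assoc _ _ _)
    change ((β_ (R.obj k.unop ⟶[V] a) (k'.unop ⟶[V] k.unop)).hom ≫
        (R.map k'.unop k.unop ▷ (R.obj k.unop ⟶[V] a)) ≫ eComp V _ _ a) ≫
          I.map (R.obj k'.unop) a ≫ ePre (u k'.unop) (I.obj a) =
      ((I.map (R.obj k.unop) a ≫ ePre (u k.unop) (I.obj a)) ▷ (k'.unop ⟶[V] k.unop)) ≫
        (β_ (S.obj k.unop ⟶[V] I.obj a) (k'.unop ⟶[V] k.unop)).hom ≫
        (S.map k'.unop k.unop ▷ (S.obj k.unop ⟶[V] I.obj a)) ≫ eComp V _ _ (I.obj a)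
    rw [braiding_naturality_left_assoc]
    simp only [Category.assoc]
    congr 1
    rw [I.map_comp_assoc, ← ePre_whiskerRight_eComp, MonoidalCategory.tensorHom_def_assoc,
      ← comp_whiskerRight_assoc, ← whisker_exchange_assoc,
      ← comp_whiskerRight_assoc, Category.assoc, ← hk, whisker_exchange_assoc,
      comp_ePost_whiskerRight, whisker_exchange_assoc]

theorem transposeHom_π (I : EnrichedFunctor V A E) {S : EnrichedFunctor V K E}
    {R : EnrichedFunctor V K A} {u : ∀ k, 𝟙_ V ⟶ (S.obj k ⟶[V] I.obj (R.obj k))}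
    (hu : IsENat S (R.comp V I) u) (a : A) (k : Kᵒᵖ) :
    transposeHom I hu a ≫ natπ ((colimHom R).obj a) ((colimHom S).obj (I.obj a)) k =
      elt (I.map (R.obj k.unop) a ≫ ePre (u k.unop) (I.obj a)) :=
  natLift_π _ _

/-- Naturality in `a`, where `transposeHom` itself was natural in `k`. Both sides compose `S k ⟶ I
(R k)` with the images under `I` of `R k ⟶ a` and `a ⟶ b`. -/
theorem isENat_transposeHom (I : EnrichedFunctor V A E) {S : EnrichedFunctor V K E}
    {R : EnrichedFunctor V K A} {u : ∀ k, 𝟙_ V ⟶ (S.obj k ⟶[V] I.obj (R.obj k))}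
    (hu : IsENat S (R.comp V I) u) :
    IsENat (colimHom R) (I.comp V (colimHom S)) (transposeHom I hu) :=
  isENat_of_evalAt fun k a b => by
    apply uncurry_injective
    have e1 := colimHom_map_π R a b k
    have e2 := colimHom_map_π S (I.obj a) (I.obj b) k
    refine (congrArg uncurry (congrArg₂ (· ≫ ·) e1
      (congrArg (ePost · _) (transposeHom_π I hu b k)))).trans (Eq.trans ?_
        (congrArg uncurry (congrArg₂ (· ≫ ·)
          ((Category.assoc _ _ _).trans (congrArg (I.map a b ≫ ·) e2))
          (congrArg (ePre · _) (transposeHom_π I hu a k)))).symm)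
    refine (uncurry_comp_ePost _ _).trans (Eq.trans ?_ (uncurry_comp_ePre _ _).symm)
    change uncurry (curry (eComp V (R.obj k.unop) a b)) ≫
        unelt (elt (I.map (R.obj k.unop) b ≫ ePre (u k.unop) (I.obj b))) =
      (unelt (elt (I.map (R.obj k.unop) a ≫ ePre (u k.unop) (I.obj a))) ▷ (a ⟶[V] b)) ≫
        uncurry (I.map a b ≫ curry (eComp V (S.obj k.unop) (I.obj a) (I.obj b)))
    rw [unelt_elt, unelt_elt, uncurry_curry, uncurry_natural_left, uncurry_curry,
      I.map_comp_assoc, ← ePre_whiskerRight_eComp, MonoidalCategory.tensorHom_def_assoc,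
      whisker_exchange_assoc, comp_whiskerRight_assoc]

/-- The hypothesis says that the cocone `η` followed by `v` is the transpose of `θ`. Following it by
the image of a map `t ⟶ a` and using naturality of the transposition in `a` gives the square. -/
theorem transposeHom_comparison (I : EnrichedFunctor V A E) {S : EnrichedFunctor V K E}
    {R : EnrichedFunctor V K A} {u : ∀ k, 𝟙_ V ⟶ (S.obj k ⟶[V] I.obj (R.obj k))}
    (hu : IsENat S (R.comp V I) u) {φ : EnrichedFunctor V Kᵒᵖ V} {c : E} {t : A}
    {η : 𝟙_ V ⟶ (φ ⟶[V] (colimHom S).obj c)} {θ : 𝟙_ V ⟶ (φ ⟶[V] (colimHom R).obj t)}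
    {v : 𝟙_ V ⟶ (c ⟶[V] I.obj t)}
    (hv : v ≫ (colimHom S).map c (I.obj t) ≫ ePre η _ = θ ≫ ePost (transposeHom I hu t) _)
    (a : A) :
    ((colimHom R).map t a ≫ ePre θ _) ≫ ePost (transposeHom I hu a) φ =
      (I.map t a ≫ ePre v (I.obj a)) ≫ (colimHom S).map c (I.obj a) ≫ ePre η _ := by
  have h1 := isENat_transposeHom I hu t a
  calc ((colimHom R).map t a ≫ ePre θ _) ≫ ePost (transposeHom I hu a) φ
      = ((colimHom R).map t a ≫ ePost (transposeHom I hu a) _) ≫ ePre θ _ := by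
        rw [Category.assoc, ePre_ePost, Category.assoc]
    _ = ((I.map t a ≫ (colimHom S).map (I.obj t) (I.obj a)) ≫ ePre (transposeHom I hu t) _) ≫
          ePre θ _ := congrArg (· ≫ _) h1
    _ = I.map t a ≫ (colimHom S).map (I.obj t) (I.obj a) ≫
          ePre (v ≫ (colimHom S).map c (I.obj t) ≫ ePre η _) _ := by
        rw [hv, ePre_comp]; simp only [Category.assoc]
    _ = _ := by
        rw [← Category.assoc v, ← comp_ePost_eq_comp_ePre, ePre_comp, Category.assoc,
          map_ePre_assoc]

theorem isIso_ePost_transposeHom (I : EnrichedFunctor V A E) {S : EnrichedFunctor V K E}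
    {R : EnrichedFunctor V K A} {u : ∀ k, 𝟙_ V ⟶ (S.obj k ⟶[V] I.obj (R.obj k))}
    (hu : IsENat S (R.comp V I) u) (a : A)
    (h : ∀ k, IsIso (I.map (R.obj k) a ≫ ePre (u k) (I.obj a))) (φ : EnrichedFunctor V Kᵒᵖ V) :
    IsIso (ePost (transposeHom I hu a) φ) := by
  obtain ⟨ν, hν⟩ := exists_areInverse_natElt (transposeHom I hu a) fun k => by
    have := h k.unop
    have e := transposeHom_π I hu a k
    have : IsIso (unelt (transposeHom I hu a ≫
        natπ ((colimHom R).obj a) ((colimHom S).obj (I.obj a)) k)) := by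
      refine (congrArg (fun f => IsIso (unelt f)) e).mpr ?_
      change IsIso (unelt (elt (I.map (R.obj k.unop) a ≫ ePre (u k.unop) (I.obj a))))
      rwa [unelt_elt]
    exact exists_areInverse_of_isIso _
  exact hν.isIso_ePost φ

/-- A choice of universal elements `u k` of `E(S k, I -)` is `V`-functorial in `k`. -/
def universalFunctor (I : EnrichedFunctor V A E) (S : EnrichedFunctor V K E) (R : K → A)
    (u : ∀ k, 𝟙_ V ⟶ (S.obj k ⟶[V] I.obj (R k)))
    (h : ∀ k k', IsIso (I.map (R k) (R k') ≫ ePre (u k) (I.obj (R k')))) :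
    EnrichedFunctor V K A where
  obj := R
  map k k' := S.map k k' ≫ ePost (u k') (S.obj k) ≫ inv (I.map (R k) (R k') ≫ ePre (u k) _)
  map_id k := by
    rw [← cancel_mono (I.map (R k) (R k) ≫ ePre (u k) _)]
    simp only [Category.assoc, IsIso.inv_hom_id, Category.comp_id]
    rw [S.map_id_assoc, I.map_id_assoc, eId_ePre, eId_ePost]
  map_comp k k' k'' := by
    rw [← cancel_mono (I.map (R k) (R k'') ≫ ePre (u k) _)]
    have e : ∀ k k' : K, (S.map k k' ≫ ePost (u k') (S.obj k) ≫
        inv (I.map (R k) (R k') ≫ ePre (u k) _)) ≫ I.map (R k) (R k') ≫ ePre (u k) _ =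
        S.map k k' ≫ ePost (u k') (S.obj k) := fun k k' => by
      simp only [Category.assoc, IsIso.inv_hom_id, Category.comp_id]
    have e1 := e k k'
    have e2 := e k' k''
    have e3 := e k k''
    generalize S.map k k' ≫ ePost (u k') (S.obj k) ≫
      inv (I.map (R k) (R k') ≫ ePre (u k) _) = r at *
    generalize S.map k' k'' ≫ ePost (u k'') (S.obj k') ≫
      inv (I.map (R k') (R k'') ≫ ePre (u k') _) = s at *
    rw [Category.assoc, e3, Category.assoc, I.map_comp_assoc, ← ePre_whiskerRight_eComp,
      S.map_comp_assoc, ← whiskerLeft_ePost_eComp, MonoidalCategory.tensorHom_comp_tensorHom_assoc,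
      MonoidalCategory.tensorHom_def_assoc (S.map _ _),
      MonoidalCategory.tensorHom_def_assoc (r ≫ _), whisker_exchange_assoc,
      ← comp_whiskerRight_assoc, Category.assoc, e1,
      comp_ePost_whiskerRight, Category.assoc, e2,
      MonoidalCategory.whiskerLeft_comp_assoc]

/-- The action of `universalFunctor` on homs is defined by inverting the comparison, so the
naturality square is a cancellation. -/
theorem isENat_universalFunctor (I : EnrichedFunctor V A E) (S : EnrichedFunctor V K E) (R : K → A)
    (u : ∀ k, 𝟙_ V ⟶ (S.obj k ⟶[V] I.obj (R k)))
    (h : ∀ k k', IsIso (I.map (R k) (R k') ≫ ePre (u k) (I.obj (R k')))) :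
    IsENat S ((universalFunctor I S R u h).comp V I) u := fun k k' => by
  change _ = ((S.map k k' ≫ ePost (u k') (S.obj k) ≫ inv (I.map (R k) (R k') ≫ ePre (u k) _)) ≫
    I.map (R k) (R k')) ≫ ePre (u k) (I.obj (R k'))
  simp only [Category.assoc, IsIso.inv_hom_id, Category.comp_id]
  rfl

end Comparison

/-! ### `V`-valued functors as actions -/

section Action

variable {V : Type v} [Category.{w} V] [MonoidalCategory V] [MonoidalClosed V]
  {A : Type u₁} [EnrichedCategory V A]

/-- The action `G x ⊗ A(x, y) ⟶ G y` of a `V`-functor `G : A ⟶ V`. -/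
def act (G : EnrichedFunctor V A V) (x y : A) : G.obj x ⊗ (x ⟶[V] y) ⟶ G.obj y :=
  uncurry (G.map x y)

theorem act_rep (a x y : A) : act (rep a) x y = eComp V a x y := uncurry_curry _

theorem act_id (G : EnrichedFunctor V A V) (x : A) :
    (G.obj x ◁ eId V x) ≫ act G x x = (ρ_ _).hom := by
  rw [act, ← uncurry_natural_left, G.map_id]
  exact uncurry_curry _

theorem act_assoc (G : EnrichedFunctor V A V) (x y z : A) :
    (act G x y ▷ (y ⟶[V] z)) ≫ act G y z = (α_ _ _ _).hom ≫ (_ ◁ eComp V x y z) ≫ act G x z := by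
  have h := congrArg uncurry (G.map_comp x y z)
  rw [uncurry_natural_left, uncurry_tensor_comp] at h
  rw [act, act, act, h, Iso.hom_inv_id_assoc]

end Action

/-! ### Morphisms into `[J, V](F, G)` by uncurried components -/

section NatObj

variable {V : Type v} [Category.{w} V] [MonoidalCategory V] [SymmetricCategory V]
  [MonoidalClosed V] [HasLimits V]
variable {J : Type w} [EnrichedCategory V J] 

theorem uncurried_nat_iff {F G : EnrichedFunctor V J V} {H : V}
    (f : ∀ x, H ⟶ EnrichedCategory.Hom (F.obj x) (G.obj x)) (x y : J) :
    (β_ H (x ⟶[V] y)).hom ≫ (F.map x y ⊗ₘ f y) ≫ eComp V _ _ _ =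
        (f x ⊗ₘ G.map x y) ≫ eComp V _ _ _ ↔
    (F.obj x ◁ (β_ H (x ⟶[V] y)).hom) ≫ (α_ _ _ _).inv ≫ (act F x y ▷ H) ≫ uncurry (f y) =
      (α_ _ _ _).inv ≫ (uncurry (f x) ▷ (x ⟶[V] y)) ≫ act G x y := by
  rw [← uncurry_injective.eq_iff, uncurry_natural_left, uncurry_tensor_comp, uncurry_tensor_comp]
  rfl

/-- The components `F x ⊗ H ⟶ G x` of a morphism from `H` to the object of transformations. -/
def cmp {F G : EnrichedFunctor V J V} {H : V} (f : H ⟶ (F ⟶[V] G)) (x : J) :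
    F.obj x ⊗ H ⟶ G.obj x :=
  uncurry (f ≫ natπ F G x)

theorem cmp_ext {F G : EnrichedFunctor V J V} {H : V} {f g : H ⟶ (F ⟶[V] G)}
    (h : ∀ x, cmp f x = cmp g x) : f = g :=
  natObj_hom_ext fun x => uncurry_injective (h x)

theorem cmp_nat {F G : EnrichedFunctor V J V} {H : V} (f : H ⟶ (F ⟶[V] G)) (x y : J) :
    (F.obj x ◁ (β_ H (x ⟶[V] y)).hom) ≫ (α_ _ _ _).inv ≫ (act F x y ▷ H) ≫ cmp f y =
      (α_ _ _ _).inv ≫ (cmp f x ▷ (x ⟶[V] y)) ≫ act G x y :=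
  (uncurried_nat_iff (fun x => f ≫ natπ F G x) x y).1 (((natFam F G).reindex f).nat x y)

theorem comp_cmp {F G : EnrichedFunctor V J V} {H H' : V} (g : H' ⟶ H) (f : H ⟶ (F ⟶[V] G))
    (x : J) : cmp (g ≫ f) x = (F.obj x ◁ g) ≫ cmp f x := by
  rw [cmp, Category.assoc, uncurry_natural_left]
  rfl

/-- The morphism to the object of transformations with given components. -/
def cmpLift {F G : EnrichedFunctor V J V} {H : V} (τ : ∀ x, F.obj x ⊗ H ⟶ G.obj x)
    (h : ∀ x y, (F.obj x ◁ (β_ H (x ⟶[V] y)).hom) ≫ (α_ _ _ _).inv ≫ (act F x y ▷ H) ≫ τ y =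
      (α_ _ _ _).inv ≫ (τ x ▷ (x ⟶[V] y)) ≫ act G x y) : H ⟶ (F ⟶[V] G) :=
  natLift (Fam.mk' (fun x => curry (τ x)) fun x y =>
    (uncurried_nat_iff (fun x => curry (τ x)) x y).2 (by simpa only [uncurry_curry] using h x y))

@[simp]
theorem cmp_cmpLift {F G : EnrichedFunctor V J V} {H : V} (τ : ∀ x, F.obj x ⊗ H ⟶ G.obj x)
    (h : ∀ x y, (F.obj x ◁ (β_ H (x ⟶[V] y)).hom) ≫ (α_ _ _ _).inv ≫ (act F x y ▷ H) ≫ τ y =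
      (α_ _ _ _).inv ≫ (τ x ▷ (x ⟶[V] y)) ≫ act G x y) (x : J) : cmp (cmpLift τ h) x = τ x :=
  (congrArg uncurry (natLift_π _ x)).trans (uncurry_curry _)

theorem cmp_comp_ePre {F F' G : EnrichedFunctor V J V} {H : V} (f : H ⟶ (F ⟶[V] G))
    (μ : 𝟙_ V ⟶ (F' ⟶[V] F)) (x : J) :
    cmp (f ≫ ePre μ G) x = (unelt (μ ≫ natπ F' F x) ▷ H) ≫ cmp f x := by
  rw [cmp, Category.assoc, ePre_natπ, ← Category.assoc, uncurry_comp_ePre]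
  rfl

theorem cmp_comp_ePost {F G G' : EnrichedFunctor V J V} {H : V} (f : H ⟶ (F ⟶[V] G))
    (μ : 𝟙_ V ⟶ (G ⟶[V] G')) (x : J) :
    cmp (f ≫ ePost μ F) x = cmp f x ≫ unelt (μ ≫ natπ G G' x) := by
  rw [cmp, Category.assoc, ePost_natπ, ← Category.assoc, uncurry_comp_ePost]
  rfl

end NatObj

/-! ### The Yoneda isomorphism `[J, V](J(n, -), G) ≅ G n` -/

section Yoneda

variable {V : Type v} [Category.{w} V] [MonoidalCategory V] [SymmetricCategory V]
  [MonoidalClosed V] [HasLimits V]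
variable {J : Type w} [EnrichedCategory V J]

/-- Evaluation of a transformation at the identity. -/
def yonedaEval (n : J) (G : EnrichedFunctor V J V) : (rep n ⟶[V] G) ⟶ G.obj n :=
  (λ_ _).inv ≫ (eId V n ▷ _) ≫ cmp (F := rep n) (G := G) (𝟙 _) n

/-- The transformation `J(n, -) ⟶ G` corresponding to an element of `G n`. -/
def yonedaLift (n : J) (G : EnrichedFunctor V J V) : G.obj n ⟶ (rep n ⟶[V] G) :=
  cmpLift (fun x => (β_ _ _).hom ≫ act G n x) fun x y => by
    rw [act_rep, braiding_naturality_left_assoc, comp_whiskerRight, Category.assoc, act_assoc]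
    have : ∀ {P Q R : V} , (P ◁ (β_ R Q).hom) ≫ (α_ _ _ _).inv ≫ (β_ (P ⊗ Q) R).hom =
      (α_ _ _ _).inv ≫ ((β_ P R).hom ▷ Q) ≫ (α_ _ _ _).hom := fun {P Q R} => by
        simp [braiding_tensor_left_hom, ← MonoidalCategory.whiskerLeft_comp_assoc]
    rw [reassoc_of% this]

theorem cmp_yonedaLift (n : J) (G : EnrichedFunctor V J V) (x : J) :
    cmp (yonedaLift n G) x = (β_ _ _).hom ≫ act G n x := cmp_cmpLift _ _ x

theorem comp_yonedaEval {H : V} (n : J) (G : EnrichedFunctor V J V) (f : H ⟶ (rep n ⟶[V] G)) :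
    f ≫ yonedaEval n G = (λ_ _).inv ≫ (eId V n ▷ _) ≫ cmp f n := by
  have h := comp_cmp (F := rep n) (G := G) f (𝟙 _) n
  rw [Category.comp_id] at h
  rw [h, yonedaEval, leftUnitor_inv_naturality_assoc, whisker_exchange_assoc]

theorem yonedaLift_eval (n : J) (G : EnrichedFunctor V J V) :
    yonedaLift n G ≫ yonedaEval n G = 𝟙 _ := by
  rw [comp_yonedaEval, cmp_yonedaLift, braiding_naturality_left_assoc, act_id]
  simp

/-- A transformation out of `J(n, -)` is determined by its value at the identity: by naturality from
`n` to `x`, its value at an arrow is the action of that arrow on this value. -/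
theorem yonedaEval_lift (n : J) (G : EnrichedFunctor V J V) :
    yonedaEval n G ≫ yonedaLift n G = 𝟙 _ := cmp_ext fun x => by
  rw [comp_cmp, cmp_yonedaLift, braiding_naturality_right_assoc]
  have h := cmp_nat (F := rep n) (G := G) (𝟙 _) n x
  rw [act_rep] at h
  rw [yonedaEval, comp_whiskerRight, comp_whiskerRight, Category.assoc, Category.assoc]
  rw [(Iso.inv_comp_eq _).1 h.symm, associator_naturality_left_assoc, ← whisker_exchange_assoc,
    associator_inv_naturality_left_assoc, ← comp_whiskerRight_assoc,
    (Iso.inv_comp_eq _).1 (e_id_comp V n x)]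
  simp

instance isIso_yonedaEval (n : J) (G : EnrichedFunctor V J V) : IsIso (yonedaEval n G) :=
  ⟨yonedaLift n G, yonedaEval_lift n G, yonedaLift_eval n G⟩

instance isIso_yonedaLift (n : J) (G : EnrichedFunctor V J V) : IsIso (yonedaLift n G) :=
  ⟨yonedaEval n G, yonedaLift_eval n G, yonedaEval_lift n G⟩

end Yoneda

/-! ### Uniqueness and transport of universal elements -/

section Universal

variable {V : Type v} [Category.{w} V] [MonoidalCategory V]
variable {A : Type u₁} [EnrichedCategory V A] {E : Type u₂} [EnrichedCategory V E]

theorem comp_comparison (I : EnrichedFunctor V A E) {e : E} {a a' : A}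
    (u : 𝟙_ V ⟶ (e ⟶[V] I.obj a)) (i : 𝟙_ V ⟶ (a ⟶[V] a')) (b : A) :
    I.map a' b ≫ ePre (i ≫ I.map a a' ≫ ePre u (I.obj a')) (I.obj b) =
      ePre i b ≫ I.map a b ≫ ePre u (I.obj b) := by
  rw [← Category.assoc i, ← comp_ePost_eq_comp_ePre, ePre_comp, map_ePre_assoc]

/-- `u'` factors through `u` by some `i`. The comparison of `u'` is then precomposition with `i`
followed by the comparison of `u`, so precomposition with `i` is invertible by two out of three. -/
theorem IsUniversal.exists_areInverse {I : EnrichedFunctor V A E} {e : E} {a a' : A}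
    {u : 𝟙_ V ⟶ (e ⟶[V] I.obj a)} {u' : 𝟙_ V ⟶ (e ⟶[V] I.obj a')} (h : IsUniversal I e a u)
    (h' : IsUniversal I e a' u') :
    ∃ i j, AreInverse i j ∧ i ≫ I.map a a' ≫ ePre u (I.obj a') = u' := by
  have := h a'
  have hi : (u' ≫ inv (I.map a a' ≫ ePre u (I.obj a'))) ≫ I.map a a' ≫ ePre u (I.obj a') = u' := by
    simp
  obtain ⟨j, hj⟩ := exists_areInverse_of_ePre (u' ≫ inv (I.map a a' ≫ ePre u (I.obj a')))
    fun z => by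
      have e := comp_comparison I u (u' ≫ inv (I.map a a' ≫ ePre u (I.obj a'))) z
      rw [hi] at e
      have := h z
      have := h' z
      rw [← isIso_comp_right_iff _ (I.map a z ≫ ePre u (I.obj z)), ← e]
      infer_instance
  exact ⟨_, j, hj, hi⟩

theorem IsUniversal.of_areInverse {I : EnrichedFunctor V A E} {e : E} {a a' : A}
    {u : 𝟙_ V ⟶ (e ⟶[V] I.obj a)} (h : IsUniversal I e a u) {i : 𝟙_ V ⟶ (a ⟶[V] a')}
    {j : 𝟙_ V ⟶ (a' ⟶[V] a)} (hij : AreInverse i j) :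
    IsUniversal I e a' (i ≫ I.map a a' ≫ ePre u (I.obj a')) := fun b => by
  rw [comp_comparison]
  have := h b
  have := hij.isIso_ePre b
  infer_instance

end Universal

/-! ### Preservation of limits by a `V`-functor -/

section Preservation

variable {V : Type v} [Category.{w} V] [MonoidalCategory V] [SymmetricCategory V]
  [MonoidalClosed V] [HasLimits V]
variable {J : Type w} [EnrichedCategory V J] {A : Type u₁} [EnrichedCategory V A]
  {B : Type u₂} [EnrichedCategory V B]

/-- The transformation `A(l, T -) ⟶ B(F l, F T -)`. -/
def mapElt (F : EnrichedFunctor V A B) (T : EnrichedFunctor V J A) (l : A) :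
    𝟙_ V ⟶ (T.comp V (rep l) ⟶[V] (T.comp V F).comp V (rep (F.obj l))) :=
  natLift (((mapFam F l).restrict T).assocTarget)

theorem mapElt_π (F : EnrichedFunctor V A B) (T : EnrichedFunctor V J A) (l : A) (j : J) :
    mapElt F T l ≫ natπ (T.comp V (rep l)) ((T.comp V F).comp V (rep (F.obj l))) j =
      elt (F.map l (T.obj j)) :=
  natLift_π _ _

theorem mapCounit_eq (F : EnrichedFunctor V A B) (φ : EnrichedFunctor V J V)
    (T : EnrichedFunctor V J A) (l : A) (μ : 𝟙_ V ⟶ (φ ⟶[V] T.comp V (rep l))) :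
    mapCounit F φ T l μ = μ ≫ ePost (mapElt F T l) φ := by
  rw [comp_ePost_eq_comp_ePre, ePre, leftUnitor_inv_naturality_assoc, mapCounit,
    MonoidalCategory.tensorHom_def', Category.assoc]
  rfl

theorem isENat_mapElt (F : EnrichedFunctor V A B) (T : EnrichedFunctor V J A) :
    IsENat (limHom T) ((opFunctor F).comp V (limHom (T.comp V F)))
      fun a => mapElt F T a.unop :=
  isENat_of_evalAt fun j a b => by
    apply uncurry_injective
    have e1 := limHom_map_π T a b j
    have e2 := limHom_map_π (T.comp V F) (op (F.obj a.unop)) (op (F.obj b.unop)) j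
    refine (congrArg uncurry (congrArg₂ (· ≫ ·) e1
      (congrArg (ePost · _) (mapElt_π F T b.unop j)))).trans (Eq.trans ?_
        (congrArg uncurry (congrArg₂ (· ≫ ·)
          ((Category.assoc _ _ _).trans (congrArg (F.map b.unop a.unop ≫ ·) e2))
          (congrArg (ePre · _) (mapElt_π F T a.unop j)))).symm)
    refine (uncurry_comp_ePost _ _).trans (Eq.trans ?_ (uncurry_comp_ePre _ _).symm)
    change uncurry (curry ((β_ _ _).hom ≫ eComp V b.unop a.unop (T.obj j))) ≫
        unelt (elt (F.map b.unop (T.obj j))) =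
      (unelt (elt (F.map a.unop (T.obj j))) ▷ (b.unop ⟶[V] a.unop)) ≫
        uncurry (F.map b.unop a.unop ≫ curry ((β_ _ _).hom ≫
          eComp V (F.obj b.unop) (F.obj a.unop) (F.obj (T.obj j))))
    rw [unelt_elt, unelt_elt, uncurry_curry, uncurry_natural_left, uncurry_curry, Category.assoc,
      F.map_comp, braiding_naturality_right_assoc, braiding_naturality_left_assoc,
      MonoidalCategory.tensorHom_def'_assoc]

/-- Sending `a ⟶ l` to a cone and then applying `F` agrees with applying `F` first, by naturality of
`mapElt` in its object. -/
theorem mapCounit_comparison (F : EnrichedFunctor V A B) (φ : EnrichedFunctor V J V)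
    (T : EnrichedFunctor V J A) (l : A) (μ : 𝟙_ V ⟶ (φ ⟶[V] T.comp V (rep l))) (a : A) :
    F.map a l ≫ (limHom (T.comp V F)).map (op (F.obj l)) (op (F.obj a)) ≫
        ePre (mapCounit F φ T l μ) _ =
      ((limHom T).map (op l) (op a) ≫ ePre μ _) ≫ ePost (mapElt F T a) φ := by
  have h : (limHom T).map (op l) (op a) ≫ ePost (mapElt F T a) _ =
      (F.map a l ≫ (limHom (T.comp V F)).map (op (F.obj l)) (op (F.obj a))) ≫
        ePre (mapElt F T l) _ := isENat_mapElt F T (op l) (op a)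
  rw [mapCounit_eq, Category.assoc, ePre_ePost, reassoc_of% h, ePre_comp]

/-- Preservation quantifies over all limiting cones; it is enough to test one, since any other
differs by an isomorphism, which `F` and `mapCounit` respect. -/
theorem preservesWeightedLimit_of_exists {F : EnrichedFunctor V A B} {φ : EnrichedFunctor V J V}
    {T : EnrichedFunctor V J A} {l : A} {μ : 𝟙_ V ⟶ (φ ⟶[V] T.comp V (rep l))}
    (h : IsWeightedLimit φ T l μ)
    (hF : IsWeightedLimit φ (T.comp V F) (F.obj l) (mapCounit F φ T l μ)) :
    PreservesWeightedLimit F φ T := fun l' μ' h' => by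
  rw [isWeightedLimit_iff] at h h' hF ⊢
  obtain ⟨i, j, hij, hi⟩ := h.exists_areInverse h'
  have e : mapCounit F φ T l' μ' = (i ≫ F.map l' l) ≫
      (limHom (T.comp V F)).map (op (F.obj l)) (op (F.obj l')) ≫
        ePre (mapCounit F φ T l μ) _ := by
    rw [Category.assoc, mapCounit_comparison, mapCounit_eq, ← hi, Category.assoc]
  rw [e]
  exact hF.of_areInverse (hij.map (opFunctor F))

end Preservation

/-! ### Invertible elements in the opposite category -/

section OppositeInverse

variable {V : Type v} [Category.{w} V] [MonoidalCategory V] [SymmetricCategory V]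
variable {A : Type u₁} [EnrichedCategory V A]

theorem ePost_op {x y : A} (f : 𝟙_ V ⟶ (x ⟶[V] y)) (z : A) :
    ePost (A := Aᵒᵖ) (y := op y) (z := op x) f (op z) = ePre f z := by
  change (ρ_ (y ⟶[V] z)).inv ≫ (_ ◁ f) ≫ (β_ _ _).hom ≫ eComp V x y z = _
  rw [braiding_naturality_right_assoc, ePre]
  simp

theorem areInverse_op {x y : A} {f : 𝟙_ V ⟶ (x ⟶[V] y)} {g : 𝟙_ V ⟶ (y ⟶[V] x)}
    (h : AreInverse f g) : AreInverse (A := Aᵒᵖ) (x := op y) (y := op x) f g :=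
  ⟨by rw [ePost_op, ← comp_ePost_eq_comp_ePre]; exact h.2,
   by rw [ePost_op, ← comp_ePost_eq_comp_ePre]; exact h.1⟩

theorem areInverse_of_op {x y : A} {f : 𝟙_ V ⟶ (x ⟶[V] y)} {g : 𝟙_ V ⟶ (y ⟶[V] x)}
    (h : AreInverse (A := Aᵒᵖ) (x := op y) (y := op x) f g) : AreInverse f g :=
  ⟨by have := h.2; rw [ePost_op, ← comp_ePost_eq_comp_ePre] at this; exact this,
   by have := h.1; rw [ePost_op, ← comp_ePost_eq_comp_ePre] at this; exact this⟩

end OppositeInverse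

/-! ### Weighted limits in `V`, and preservation of limits by functors to `V` -/

section SelfLimits

variable {V : Type v} [Category.{w} V] [MonoidalCategory V] [SymmetricCategory V]
  [MonoidalClosed V] [HasLimits V]
variable {J : Type w} [EnrichedCategory V J] {A : Type u₁} [EnrichedCategory V A]

/-- The symmetric coherence behind naturality of the inverse comparison in `isWeightedLimit_self`:
both sides are the same permutation of four tensor factors. -/
theorem swap_tensor_aux (P X N C : V) :
    (P ◁ (β_ (X ⊗ N) C).hom) ≫ (α_ _ _ _).inv ≫ (α_ _ _ _).inv ≫ ((β_ (P ⊗ C) X).hom ▷ N) ≫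
      (α_ _ _ _).hom = (α_ _ _ _).inv ≫ ((α_ _ _ _).inv ▷ C) ≫ (((β_ P X).hom ▷ N) ▷ C) ≫
      ((α_ _ _ _).hom ▷ C) ≫ (α_ _ _ _).hom ≫ (X ◁ (α_ _ _ _).hom) ≫ (X ◁ (P ◁ (β_ N C).hom)) ≫
      (X ◁ (α_ _ _ _).inv) := by
  have h : (P ◁ (β_ X C).hom ▷ N) ≫ (P ◁ (β_ C X).hom ▷ N) = 𝟙 _ := by
    rw [← MonoidalCategory.whiskerLeft_comp, ← comp_whiskerRight, SymmetricCategory.symmetry]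
    simp
  rw [braiding_tensor_left_hom, braiding_tensor_left_hom]
  simp only [MonoidalCategory.whiskerLeft_comp, comp_whiskerRight, Category.assoc]
  simp
  rw [reassoc_of% h, associator_naturality_left_assoc, ← associator_naturality_right_assoc,
    ← whisker_exchange_assoc]
  simp

theorem cmp_limHom_comparison {φ : EnrichedFunctor V J V} {T : EnrichedFunctor V J A} {l : A}
    {μ : 𝟙_ V ⟶ (φ ⟶[V] T.comp V (rep l))} {j : J} {m : φ.obj j ⟶ (l ⟶[V] T.obj j)}
    (hm : μ ≫ natπ φ (T.comp V (rep l)) j = elt m) (a : A) :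
    cmp ((limHom T).map (op l) (op a) ≫ ePre μ (T.comp V (rep a))) j =
      (m ▷ (a ⟶[V] l)) ≫ (β_ _ _).hom ≫ eComp V a l (T.obj j) := by
  refine (cmp_comp_ePre (F := T.comp V (rep l)) _ μ j).trans ?_
  refine congrArg₂ (fun s t => (s ▷ _) ≫ t) ((congrArg unelt hm).trans (unelt_elt m)) ?_
  exact (congrArg uncurry (limHom_map_π T (op l) (op a) j)).trans (uncurry_curry _)

theorem isENat_elt_iff {F G : EnrichedFunctor V A V} (g : ∀ x, F.obj x ⟶ G.obj x) :
    IsENat F G (fun x => elt (g x)) ↔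
      ∀ x y, act F x y ≫ g y = (g x ▷ (x ⟶[V] y)) ≫ act G x y := by
  refine forall_congr' fun x => forall_congr' fun y => ?_
  rw [← uncurry_injective.eq_iff, uncurry_comp_ePost, uncurry_comp_ePre, unelt_elt, unelt_elt]
  rfl

theorem act_comp_rep {B : Type u₂} [EnrichedCategory V B] (Q : EnrichedFunctor V B A) (a : A)
    (x y : B) :
    act (Q.comp V (rep a)) x y = (_ ◁ Q.map x y) ≫ eComp V a (Q.obj x) (Q.obj y) := by
  change uncurry (Q.map x y ≫ curry (eComp V a (Q.obj x) (Q.obj y))) = _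
  rw [uncurry_natural_left, uncurry_curry]

theorem uncurry_whiskerRight_act (Q : EnrichedFunctor V J V) {X P : V} {x y : J}
    (p : P ⟶ EnrichedCategory.Hom X (Q.obj x)) :
    uncurry ((p ▷ (x ⟶[V] y)) ≫ act (Q.comp V (rep X)) x y) =
      (α_ _ _ _).inv ≫ (uncurry p ▷ _) ≫ act Q x y := by
  refine (congrArg (fun t => uncurry ((p ▷ (x ⟶[V] y)) ≫ t)) (act_comp_rep Q X x y)).trans ?_
  rw [act, ← uncurry_tensor_comp, MonoidalCategory.tensorHom_def_assoc]
  rfl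

/-- The counit of the limit `[J, V](ψ, Q)` of `Q : J ⟶ V`. -/
def selfLimitCounit (ψ Q : EnrichedFunctor V J V) :
    𝟙_ V ⟶ (ψ ⟶[V] Q.comp V (rep (ψ ⟶[V] Q))) :=
  natElt (fun j => elt (curry ((β_ (ψ ⟶[V] Q) (ψ.obj j)).hom ≫ cmp (F := ψ) (G := Q) (𝟙 _) j)))
    ((isENat_elt_iff (G := Q.comp V (rep (ψ ⟶[V] Q))) _).2 fun x y => by
      apply uncurry_injective
      refine Eq.trans ?_ (uncurry_whiskerRight_act Q _).symm
      change uncurry (act ψ x y ≫ curry ((β_ (ψ ⟶[V] Q) (ψ.obj y)).hom ≫ cmp _ y)) = _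
      rw [uncurry_natural_left, uncurry_curry, uncurry_curry]
      have h := cmp_nat (F := ψ) (G := Q) (𝟙 _) x y
      have h' := (Iso.inv_comp_eq _).1 h.symm
      rw [comp_whiskerRight, Category.assoc, h', braiding_naturality_right_assoc]
      simp only [← Category.assoc]
      congr 2
      simp)

/-- A map `X ⟶ [J, V](ψ, Q)` and a transformation from `ψ` to `[X, Q -]` are both a natural family
`ψ j ⊗ X ⟶ Q j`, up to symmetry. The inverse `L` of the comparison is this transposition carried out
on the generic transformation. -/
theorem isWeightedLimit_self (ψ Q : EnrichedFunctor V J V) :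
    IsWeightedLimit ψ Q (ψ ⟶[V] Q) (selfLimitCounit ψ Q) := by
  rw [isWeightedLimit_iff]
  intro X
  obtain ⟨X⟩ := X
  set N : V := (ψ ⟶[V] Q.comp V (rep X)) with hN
  set M : V := (ψ ⟶[V] Q) with hM
  let c : ∀ j, ψ.obj j ⊗ M ⟶ Q.obj j := fun j => cmp (F := ψ) (G := Q) (𝟙 _) j
  let d : ∀ j, ψ.obj j ⊗ N ⟶ EnrichedCategory.Hom X (Q.obj j) :=
    fun j => cmp (F := ψ) (G := Q.comp V (rep X)) (𝟙 _) j
  let K : EnrichedCategory.Hom X M ⟶ N :=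
    (limHom Q).map (op M) (op X) ≫ ePre (selfLimitCounit ψ Q) _
  have hK : ∀ j, cmp K j = (β_ _ _).hom ≫ (_ ◁ curry ((β_ M (ψ.obj j)).hom ≫ c j)) ≫
      eComp V X M (Q.obj j) := fun j => by
    refine (cmp_limHom_comparison (m := curry ((β_ M (ψ.obj j)).hom ≫ c j))
      (natElt_π _ _ j) X).trans ?_
    rw [braiding_naturality_left_assoc]
  have hK' : ∀ j, (_ ◁ K) ≫ d j = (β_ _ _).hom ≫ (_ ◁ curry ((β_ M (ψ.obj j)).hom ≫ c j)) ≫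
      eComp V X M (Q.obj j) := fun j => by
    rw [← hK]
    have := (comp_cmp (F := ψ) (G := Q.comp V (rep X)) K (𝟙 _) j).symm
    rw [Category.comp_id] at this
    exact this
  have hK2 : ∀ j, (X ◁ (ψ.obj j ◁ K)) ≫ uncurry (d j) =
    (X ◁ (β_ _ _).hom) ≫ (α_ _ _ _).inv ≫ (uncurry (𝟙 (EnrichedCategory.Hom X M)) ▷ ψ.obj j) ≫
      (β_ M (ψ.obj j)).hom ≫ c j := fun j => by
    rw [← uncurry_natural_left, hK']
    have := uncurry_tensor_comp (𝟙 (EnrichedCategory.Hom X M))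
      (curry ((β_ M (ψ.obj j)).hom ≫ c j))
    rw [uncurry_curry, MonoidalCategory.id_tensorHom] at this
    rw [uncurry_natural_left, this]
  let L : N ⟶ EnrichedCategory.Hom X M := curry (cmpLift (F := ψ) (G := Q) (fun j =>
    (α_ _ _ _).inv ≫ ((β_ _ _).hom ▷ N) ≫ (α_ _ _ _).hom ≫ uncurry (d j)) fun x y => by
      have h := congrArg uncurry (cmp_nat (F := ψ) (G := Q.comp V (rep X)) (𝟙 _) x y)
      change uncurry ((ψ.obj x ◁ (β_ N (x ⟶[V] y)).hom) ≫ (α_ _ _ _).inv ≫ (act ψ x y ▷ N) ≫ d y) =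
        uncurry ((α_ _ _ _).inv ≫ (d x ▷ _) ≫ act (Q.comp V (rep X)) x y) at h
      rw [uncurry_natural_left, uncurry_natural_left, uncurry_natural_left] at h
      have h := h.trans (uncurry_natural_left _ _)
      have h := h.trans (congrArg (_ ≫ ·) (uncurry_whiskerRight_act Q (d x)))
      have h' : (uncurry (d x) ▷ (x ⟶[V] y)) ≫ act Q x y = (α_ _ _ _).hom ≫ (X ◁ (α_ _ _ _).hom) ≫
          (X ◁ ψ.obj x ◁ (β_ N (x ⟶[V] y)).hom) ≫ (X ◁ (α_ _ _ _).inv) ≫ (X ◁ (act ψ x y ▷ N)) ≫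
            uncurry (d y) := by
        rw [h]; simp
      rw [comp_whiskerRight, comp_whiskerRight, comp_whiskerRight]
      simp only [Category.assoc]
      rw [h', associator_inv_naturality_left_assoc, ← comp_whiskerRight_assoc,
        braiding_naturality_left, comp_whiskerRight_assoc, associator_naturality_middle_assoc]
      have hp := swap_tensor_aux (ψ.obj x) X N (x ⟶[V] y)
      simp only [← Category.assoc] at hp ⊢
      rw [hp])
  have hL : ∀ j, (_ ◁ uncurry L) ≫ c j =
      (α_ _ _ _).inv ≫ ((β_ _ _).hom ▷ N) ≫ (α_ _ _ _).hom ≫ uncurry (d j) := fun j => by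
    rw [← comp_cmp, Category.comp_id, uncurry_curry, cmp_cmpLift]
  have h1 : K ≫ L = 𝟙 _ := by
    apply uncurry_injective
    refine cmp_ext (F := ψ) (G := Q) fun j => ?_
    have e : ∀ {H : V} (f : H ⟶ M), cmp (F := ψ) (G := Q) f j = (_ ◁ f) ≫ c j := fun f => by
      rw [← comp_cmp, Category.comp_id]
    rw [e, e, uncurry_natural_left, MonoidalCategory.whiskerLeft_comp, Category.assoc, hL,
      associator_inv_naturality_right_assoc, whisker_exchange_assoc,
      associator_naturality_right_assoc, hK2]
    have hp : (α_ _ _ _).inv ≫ ((β_ (ψ.obj j) X).hom ▷ _) ≫ (α_ _ _ _).hom ≫ (X ◁ (β_ _ _).hom) ≫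
      (α_ X (EnrichedCategory.Hom X M) (ψ.obj j)).inv = (β_ (ψ.obj j) _).hom := by
        rw [braiding_tensor_right_hom]
    rw [reassoc_of% hp, ← braiding_naturality_right_assoc, SymmetricCategory.symmetry_assoc]
  have h2 : L ≫ K = 𝟙 _ := by
    refine cmp_ext (F := ψ) (G := Q.comp V (rep X)) fun j => ?_
    apply uncurry_injective
    have e : ∀ {H : V} (f : H ⟶ N), cmp (F := ψ) (G := Q.comp V (rep X)) f j =
        (_ ◁ f) ≫ d j := fun f => by
      have := (comp_cmp (F := ψ) (G := Q.comp V (rep X)) f (𝟙 _) j).symm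
      rw [Category.comp_id] at this
      exact this.symm
    rw [e, e, MonoidalCategory.whiskerLeft_comp, Category.assoc, uncurry_natural_left, 
      uncurry_natural_left, uncurry_natural_left, hK2, ← MonoidalCategory.whiskerLeft_comp_assoc,
      braiding_naturality_right, MonoidalCategory.whiskerLeft_comp_assoc,
      associator_inv_naturality_middle_assoc, ← comp_whiskerRight_assoc, ← uncurry_natural_left,
      Category.comp_id, braiding_naturality_left_assoc, hL]
    have hp : (X ◁ (β_ (ψ.obj j) N).hom) ≫ (α_ _ _ _).inv ≫ (β_ _ _).hom ≫ (α_ _ _ _).inv ≫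
        ((β_ (ψ.obj j) X).hom ▷ N) ≫ (α_ _ _ _).hom = 𝟙 _ := by
      rw [braiding_tensor_left_hom]
      simp [← comp_whiskerRight_assoc]
      rw [← MonoidalCategory.whiskerLeft_comp, SymmetricCategory.symmetry,
        MonoidalCategory.whiskerLeft_id]
    rw [reassoc_of% hp]
    simp
  exact ⟨L, h1, h2⟩

theorem cmp_restrictAlong {K : Type w} [EnrichedCategory V K] (T : EnrichedFunctor V J K)
    {F G : EnrichedFunctor V K V} {H : V} (f : H ⟶ (F ⟶[V] G)) (j : J) :
    cmp (f ≫ (restrictAlong V T).map F G) j = cmp f (T.obj j) := by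
  rw [cmp, cmp, Category.assoc]
  exact congrArg (fun t => uncurry (f ≫ t)) (restrictAlong_map_π T F G j)

theorem cmp_unit {F G : EnrichedFunctor V J V} (μ : 𝟙_ V ⟶ (F ⟶[V] G)) (j : J) :
    cmp μ j = (ρ_ _).hom ≫ unelt (μ ≫ natπ F G j) := uncurry_eq_unelt _

theorem whiskerLeft_elt_comparison {x y z : A} {P : V} (m : P ⟶ (y ⟶[V] z))
    (g : 𝟙_ V ⟶ (x ⟶[V] y)) :
    (P ◁ g) ≫ (m ▷ _) ≫ (β_ _ _).hom ≫ eComp V x y z = (ρ_ _).hom ≫ m ≫ ePre g z := by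
  rw [whisker_exchange_assoc, braiding_naturality_right_assoc, ePre]
  simp

/-- A `V`-functor `G : K ⟶ V` preserves a limit if and only if `[K, V](K(l, -), G)` is the
corresponding object of transformations. -/
theorem isWeightedLimit_mapCounit_iff {K : Type w} [EnrichedCategory V K]
    (G : EnrichedFunctor V K V) (ψ : EnrichedFunctor V J V) (T : EnrichedFunctor V J K) (l : K)
    (μ : 𝟙_ V ⟶ (ψ ⟶[V] T.comp V (rep l))) :
    IsWeightedLimit ψ (T.comp V G) (G.obj l) (mapCounit G ψ T l μ) ↔
      IsIso ((restrictAlong V T).map (rep l) G ≫ ePre μ (T.comp V G)) := by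
  set M : V := (ψ ⟶[V] T.comp V G) with hM
  let f : G.obj l ⟶ M :=
    yonedaLift l G ≫ (restrictAlong V T).map (rep l) G ≫ ePre μ (T.comp V G)
  -- The image of `μ` under `G` is the limiting cone of `M` pulled back along the canonical `f : G l
  -- ⟶ M`. As `M` is a limit, `G l` is one exactly when `f` is invertible.
  have key : mapCounit G ψ T l μ = elt f ≫ (limHom (T.comp V G)).map (op M) (op (G.obj l)) ≫
      ePre (selfLimitCounit ψ (T.comp V G)) _ := by
    refine cmp_ext (G := (T.comp V G).comp V (rep (G.obj l))) fun j => ?_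
    let m : ψ.obj j ⟶ (l ⟶[V] T.obj j) := unelt (μ ≫ natπ ψ (T.comp V (rep l)) j)
    let c : ψ.obj j ⊗ M ⟶ G.obj (T.obj j) := cmp (F := ψ) (G := T.comp V G) (𝟙 _) j
    have hc : ∀ {H : V} (f : H ⟶ M), (ψ.obj j ◁ f) ≫ c = cmp (F := ψ) (G := T.comp V G) f j :=
      fun f => by
        have := comp_cmp (F := ψ) (G := T.comp V G) f (𝟙 _) j
        rw [Category.comp_id] at this
        exact this.symm
    have e1 : cmp (G := (T.comp V G).comp V (rep (G.obj l))) (mapCounit G ψ T l μ) j =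
        (ρ_ _).hom ≫ m ≫ G.map l (T.obj j) := by
      rw [mapCounit_eq]
      refine (cmp_comp_ePost _ _ j).trans ?_
      rw [cmp_unit, Category.assoc]
      exact congrArg (fun t => (ρ_ _).hom ≫ m ≫ t)
        ((congrArg unelt (mapElt_π G T l j)).trans (unelt_elt _))
    have e2 := whiskerLeft_elt_comparison (x := G.obj l) (y := M) (z := G.obj (T.obj j))
      (curry ((β_ M (ψ.obj j)).hom ≫ c)) (elt f)
    have e4 : cmp (G := (T.comp V G).comp V (rep (G.obj l)))
        ((limHom (T.comp V G)).map (op M) (op (G.obj l)) ≫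
          ePre (selfLimitCounit ψ (T.comp V G)) _) j =
        (curry ((β_ M (ψ.obj j)).hom ≫ c) ▷ _) ≫
          (β_ _ _).hom ≫ eComp V (G.obj l) M (G.obj (T.obj j)) :=
      cmp_limHom_comparison (natElt_π _ _ j) (G.obj l)
    refine e1.trans (Eq.trans ?_ (comp_cmp (elt f) _ j).symm)
    refine Eq.trans ?_ (congrArg (fun t => (ψ.obj j ◁ elt f) ≫ t) e4).symm
    refine Eq.trans ?_ e2.symm
    congr 1
    apply uncurry_injective
    rw [uncurry_comp_ePre, unelt_elt, uncurry_curry, uncurry_natural_left,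
      braiding_naturality_left_assoc, hc]
    have e3 : cmp (F := ψ) (G := T.comp V G) f j = (β_ _ _).hom ≫ (_ ◁ m) ≫ act G l (T.obj j) := by
      dsimp only [f]
      rw [← Category.assoc]
      refine (cmp_comp_ePre (F := T.comp V (rep l)) (G := T.comp V G) _ μ j).trans ?_
      refine (congrArg (_ ≫ ·) ((cmp_restrictAlong T _ j).trans (cmp_yonedaLift l G _))).trans ?_
      exact braiding_naturality_left_assoc m _ _
    rw [e3, SymmetricCategory.symmetry_assoc]
    rfl
  have hf : IsIso f ↔ IsIso ((restrictAlong V T).map (rep l) G ≫ ePre μ (T.comp V G)) :=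
    isIso_comp_left_iff _ _
  rw [← hf, key, isWeightedLimit_iff]
  have hM' := (isWeightedLimit_iff _ _ _ _).1 (isWeightedLimit_self ψ (T.comp V G))
  let i : 𝟙_ V ⟶ EnrichedCategory.Hom (G.obj l) M := elt f
  -- `limHom` lives on `Vᵒᵖ`, where `i` is an arrow from `M` to `G l`, so that universality passes
  -- along it.
  have e : ∀ b, (limHom (T.comp V G)).map (op (G.obj l)) b ≫ ePre (i ≫
      (limHom (T.comp V G)).map (op M) (op (G.obj l)) ≫
        ePre (selfLimitCounit ψ (T.comp V G)) _) _ = ePre (V := V) (A := Vᵒᵖ) (x := op M)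
          (y := op (G.obj l)) i b ≫ (limHom (T.comp V G)).map (op M) b ≫
            ePre (selfLimitCounit ψ (T.comp V G)) _ :=
    fun b => comp_comparison (limHom (T.comp V G)) (a := op M) (a' := op (G.obj l)) _ i b
  constructor
  · intro h
    obtain ⟨g, hg⟩ := exists_areInverse_of_ePre (V := V) (A := Vᵒᵖ) (x := op M) (y := op (G.obj l)) i
      fun z => by
        have h1 := h z
        have h2 := hM' z
        have h1 := (congrArg (fun t => IsIso t) (e z)).mp h1
        exact (isIso_comp_right_iff _ _).1 h1
    have := (areInverse_of_op hg).isIso_unelt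
    rwa [unelt_elt] at this
  · intro h
    have : IsIso (unelt (elt f)) := by rwa [unelt_elt]
    obtain ⟨g, hg⟩ := exists_areInverse_of_isIso (elt f)
    intro b
    refine (congrArg (fun t => IsIso t) (e b)).mpr ?_
    have h1 := hM' b
    have h2 := (areInverse_op hg).isIso_ePre b
    exact IsIso.comp_isIso' h2 h1

end SelfLimits

/-! ### Coends in `V` -/

section Coend

variable {V : Type v} [Category.{w} V] [MonoidalCategory V] [SymmetricCategory V]
  [MonoidalClosed V]
variable {K : Type w} [EnrichedCategory V K]

/-- The two maps `S k ⊗ (φ k' ⊗ K(k, k')) ⇉ S k ⊗ φ k, S k' ⊗ φ k'` are coequalized by `ι`. -/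
def IsCowedge (φ : EnrichedFunctor V Kᵒᵖ V) (s : K → V) (a : ∀ k k', s k ⊗ (k ⟶[V] k') ⟶ s k')
    {Z : V} (ι : ∀ k, s k ⊗ φ.obj (op k) ⟶ Z) : Prop :=
  ∀ k k' : K, (s k ◁ act φ (op k') (op k)) ≫ ι k =
    (s k ◁ (β_ (φ.obj (op k')) (k ⟶[V] k')).hom) ≫ (α_ _ _ _).inv ≫ (a k k' ▷ _) ≫ ι k'

/-- The coend `∫ᵏ S k ⊗ φ k`, with its universal property stable under tensoring. -/
structure IsCoend (φ : EnrichedFunctor V Kᵒᵖ V) (s : K → V) (a : ∀ k k', s k ⊗ (k ⟶[V] k') ⟶ s k')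
    {W : V} (ι : ∀ k, s k ⊗ φ.obj (op k) ⟶ W) : Prop where
  cowedge : IsCowedge φ s a ι
  exists_desc : ∀ {H Z : V} (τ : ∀ k, (s k ⊗ φ.obj (op k)) ⊗ H ⟶ Z),
    (∀ k k' : K, ((s k ◁ act φ (op k') (op k)) ▷ H) ≫ τ k =
      (((s k ◁ (β_ (φ.obj (op k')) (k ⟶[V] k')).hom) ≫ (α_ _ _ _).inv ≫ (a k k' ▷ _)) ▷ H) ≫
        τ k') → ∃ f : W ⊗ H ⟶ Z, ∀ k, (ι k ▷ H) ≫ f = τ k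
  hom_ext : ∀ {H Z : V} {f g : W ⊗ H ⟶ Z}, (∀ k, (ι k ▷ H) ≫ f = (ι k ▷ H) ≫ g) → f = g

/-- The coend is a coequalizer of coproducts. It stays universal after tensoring with `H` because
maps `W ⊗ H ⟶ Z` are maps `W ⟶ [H, Z]`. -/
theorem exists_isCoend [HasColimits V] (φ : EnrichedFunctor V Kᵒᵖ V) (s : K → V)
    (a : ∀ k k', s k ⊗ (k ⟶[V] k') ⟶ s k') :
    ∃ (W : V) (ι : ∀ k, s k ⊗ φ.obj (op k) ⟶ W), IsCoend φ s a ι := by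
  let X : V := ∐ fun p : K × K => s p.1 ⊗ (φ.obj (op p.2) ⊗ (p.1 ⟶[V] p.2))
  let Y : V := ∐ fun k : K => s k ⊗ φ.obj (op k)
  let i : ∀ k, s k ⊗ φ.obj (op k) ⟶ Y := Sigma.ι fun k : K => s k ⊗ φ.obj (op k)
  let f : X ⟶ Y := Sigma.desc fun p : K × K => (s p.1 ◁ act φ (op p.2) (op p.1)) ≫ i p.1
  let g : X ⟶ Y := Sigma.desc fun p : K × K =>
    (s p.1 ◁ (β_ (φ.obj (op p.2)) (p.1 ⟶[V] p.2)).hom) ≫ (α_ _ _ _).inv ≫ (a p.1 p.2 ▷ _) ≫ i p.2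
  let e : ∀ {H Z : V}, (coequalizer f g ⊗ H ⟶ Z) → (coequalizer f g ⟶ (ihom H).obj Z) :=
    fun h => curry ((β_ _ _).hom ≫ h)
  have he : ∀ {H Z P : V} (h : coequalizer f g ⊗ H ⟶ Z) (t : P ⟶ coequalizer f g),
      t ≫ e h = curry ((β_ _ _).hom ≫ (t ▷ H) ≫ h) := fun h t => by
    rw [← braiding_naturality_right_assoc, curry_natural_left]
  refine ⟨coequalizer f g, fun k => i k ≫ coequalizer.π f g, ?_, ?_, ?_⟩
  · intro k k'
    have := congrArg (Sigma.ι (fun p : K × K => s p.1 ⊗ (φ.obj (op p.2) ⊗ (p.1 ⟶[V] p.2))) (k, k') ≫ ·)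
      (coequalizer.condition f g)
    simpa [f, g, X] using this
  · intro H Z τ hτ
    refine ⟨(β_ _ _).hom ≫ uncurry (coequalizer.desc (Sigma.desc fun k =>
      curry ((β_ _ _).hom ≫ τ k)) ?_), fun k => ?_⟩
    · refine Sigma.hom_ext _ _ fun p => ?_
      have h := congrArg (fun t => curry ((β_ _ _).hom ≫ t)) (hτ p.1 p.2)
      simp only [← braiding_naturality_right_assoc, curry_natural_left] at h
      simpa [f, g, X, i] using h
    · rw [braiding_naturality_left_assoc, ← uncurry_natural_left, Category.assoc,
        coequalizer.π_desc]
      refine (congrArg (fun t => (β_ _ _).hom ≫ uncurry t)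
        (Sigma.ι_desc (fun k => curry ((β_ _ _).hom ≫ τ k)) k)).trans ?_
      rw [uncurry_curry, SymmetricCategory.symmetry_assoc]
  · intro H Z f' g' h
    have : e f' = e g' := by
      refine coequalizer.hom_ext (Sigma.hom_ext _ _ fun k => ?_)
      have := congrArg (fun t => curry ((β_ _ _).hom ≫ t)) (h k)
      rw [← he, ← he] at this
      simpa [i] using this
    have := MonoidalClosed.curry_injective this
    exact (cancel_epi _).1 this

end Coend

/-! ### Pointwise coends are weighted colimits -/

section Pointwise

variable {V : Type v} [Category.{w} V] [MonoidalCategory V] [SymmetricCategory V]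
  [MonoidalClosed V]
variable {D : Type u₂} [EnrichedCategory V D]

/-- The morphism `P X ⊗ H ⟶ P Y` induced by `f : H ⟶ D(X, Y)` and `P : D ⟶ V`. -/
def actAt (P : EnrichedFunctor V D V) {X Y : D} {H : V} (f : H ⟶ (X ⟶[V] Y)) :
    P.obj X ⊗ H ⟶ P.obj Y :=
  uncurry (f ≫ P.map X Y)

theorem comp_actAt (P : EnrichedFunctor V D V) {X Y : D} {H H' : V} (g : H' ⟶ H)
    (f : H ⟶ (X ⟶[V] Y)) : actAt P (g ≫ f) = (P.obj X ◁ g) ≫ actAt P f := by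
  rw [actAt, Category.assoc, uncurry_natural_left]
  rfl

theorem actAt_tensor_comp (P : EnrichedFunctor V D V) {X Y Z : D} {H H' : V}
    (f : H ⟶ (X ⟶[V] Y)) (g : H' ⟶ (Y ⟶[V] Z)) :
    actAt P ((f ⊗ₘ g) ≫ eComp V X Y Z) = (α_ _ _ _).inv ≫ (actAt P f ▷ H') ≫ actAt P g := by
  rw [actAt, Category.assoc, P.map_comp, MonoidalCategory.tensorHom_comp_tensorHom_assoc,
    uncurry_tensor_comp]
  rfl

theorem actAt_whiskerRight_comp (P : EnrichedFunctor V D V) {X Y Z : D} {H : V}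
    (f : H ⟶ (X ⟶[V] Y)) :
    actAt P ((f ▷ _) ≫ eComp V X Y Z) = (α_ _ _ _).inv ≫ (actAt P f ▷ _) ≫ actAt P (𝟙 _) := by
  rw [← actAt_tensor_comp, MonoidalCategory.tensorHom_id]

variable [HasLimits V]
variable {K : Type w} [EnrichedCategory V K]

/-- The component `φ k ⊗ H ⟶ D(S k, b)` of a morphism from `H` to the object of cocones. -/
def coconeCmp {φ : EnrichedFunctor V Kᵒᵖ V} {S : EnrichedFunctor V K D} {b : D} {H : V}
    (δ : H ⟶ (φ ⟶[V] (colimHom S).obj b)) (k : K) : φ.obj (op k) ⊗ H ⟶ (S.obj k ⟶[V] b) :=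
  cmp (G := (colimHom S).obj b) δ (op k)

theorem comp_coconeCmp {φ : EnrichedFunctor V Kᵒᵖ V} {S : EnrichedFunctor V K D} {b : D} {H H' : V}
    (g : H' ⟶ H) (δ : H ⟶ (φ ⟶[V] (colimHom S).obj b)) (k : K) :
    coconeCmp (g ≫ δ) k = (φ.obj (op k) ◁ g) ≫ coconeCmp δ k :=
  comp_cmp g δ (op k)

theorem coconeCmp_ext {φ : EnrichedFunctor V Kᵒᵖ V} {S : EnrichedFunctor V K D} {b : D} {H : V}
    {δ δ' : H ⟶ (φ ⟶[V] (colimHom S).obj b)} (h : ∀ k, coconeCmp δ k = coconeCmp δ' k) : δ = δ' :=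
  cmp_ext fun k => h k.unop

/-- The component `φ k ⟶ D(S k, c)` of a cocone. -/
def unitCmp {φ : EnrichedFunctor V Kᵒᵖ V} {S : EnrichedFunctor V K D} {c : D}
    (η : 𝟙_ V ⟶ (φ ⟶[V] (colimHom S).obj c)) (k : K) : φ.obj (op k) ⟶ (S.obj k ⟶[V] c) :=
  unelt (η ≫ natπ φ ((colimHom S).obj c) (op k))

theorem coconeCmp_comparison {φ : EnrichedFunctor V Kᵒᵖ V} {S : EnrichedFunctor V K D} {c : D}
    (η : 𝟙_ V ⟶ (φ ⟶[V] (colimHom S).obj c)) {b : D} {H : V} (g : H ⟶ (c ⟶[V] b)) (k : K) :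
    coconeCmp (g ≫ (colimHom S).map c b ≫ ePre η ((colimHom S).obj b)) k =
      (unitCmp η k ⊗ₘ g) ≫ eComp V (S.obj k) c b := by
  rw [← Category.assoc]
  refine (cmp_comp_ePre (F := (colimHom S).obj c) _ η (op k)).trans ?_
  have h : coconeCmp (φ := (colimHom S).obj c) (g ≫ (colimHom S).map c b) k =
      (_ ◁ g) ≫ eComp V (S.obj k) c b := by
    refine (comp_cmp _ _ _).trans (congrArg (_ ≫ ·) ?_)
    exact (congrArg uncurry (colimHom_map_π S c b (op k))).trans (uncurry_curry _)
  refine (congrArg (_ ≫ ·) h).trans ?_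
  change (unitCmp η k ▷ H) ≫ (_ ◁ g) ≫ eComp V (S.obj k) c b = _
  rw [MonoidalCategory.tensorHom_def_assoc]

/-- The component at `k` of the unit of a colimit, evaluated by `P`. -/
abbrev unitAt (P : EnrichedFunctor V D V) {φ : EnrichedFunctor V Kᵒᵖ V} {S : EnrichedFunctor V K D}
    {c : D} (η : 𝟙_ V ⟶ (φ ⟶[V] (colimHom S).obj c)) (k : K) :
    P.obj (S.obj k) ⊗ φ.obj (op k) ⟶ P.obj c :=
  actAt P (unitCmp η k)

/-- The functor `P` takes the cocone `η` to a coend. -/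
def IsCoendAt (P : EnrichedFunctor V D V) {φ : EnrichedFunctor V Kᵒᵖ V} {S : EnrichedFunctor V K D}
    {c : D} (η : 𝟙_ V ⟶ (φ ⟶[V] (colimHom S).obj c)) : Prop :=
  IsCoend φ (fun k => P.obj (S.obj k)) (fun k k' => actAt P (S.map k k')) (unitAt P η)

theorem actAt_comparison (P : EnrichedFunctor V D V) {φ : EnrichedFunctor V Kᵒᵖ V}
    {S : EnrichedFunctor V K D} {c : D} (η : 𝟙_ V ⟶ (φ ⟶[V] (colimHom S).obj c)) {b : D} {H : V}
    (g : H ⟶ (c ⟶[V] b)) (k : K) :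
    actAt P (coconeCmp (g ≫ (colimHom S).map c b ≫ ePre η ((colimHom S).obj b)) k) =
      (α_ _ _ _).inv ≫ (unitAt P η k ▷ H) ≫ actAt P g := by
  rw [coconeCmp_comparison, actAt_tensor_comp]

theorem act_colimHom (S : EnrichedFunctor V K D) (b : D) (k k' : K) :
    act ((colimHom S).obj b) (op k') (op k) =
      (β_ (S.obj k' ⟶[V] b) (k ⟶[V] k')).hom ≫ (S.map k k' ▷ (S.obj k' ⟶[V] b)) ≫
        eComp V (S.obj k) (S.obj k') b :=
  uncurry_opFunctor_rep_map S b (op k') (op k)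

theorem whiskerRight_act_colimHom (S : EnrichedFunctor V K D) (b : D) (k k' : K) {H : V}
    (f : H ⟶ (S.obj k' ⟶[V] b)) :
    (f ▷ (k ⟶[V] k')) ≫ act ((colimHom S).obj b) (op k') (op k) =
      (β_ H (k ⟶[V] k')).hom ≫ (S.map k k' ⊗ₘ f) ≫ eComp V (S.obj k) (S.obj k') b := by
  refine (congrArg (_ ≫ ·) (act_colimHom S b k k')).trans ?_
  change (f ▷ (k ⟶[V] k')) ≫ (β_ (S.obj k' ⟶[V] b) (k ⟶[V] k')).hom ≫
    (S.map k k' ▷ (S.obj k' ⟶[V] b)) ≫ eComp V (S.obj k) (S.obj k') b = _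
  rw [braiding_naturality_left_assoc, MonoidalCategory.tensorHom_def'_assoc]

theorem coconeCmp_nat {φ : EnrichedFunctor V Kᵒᵖ V} {S : EnrichedFunctor V K D} {b : D} {H : V}
    (δ : H ⟶ (φ ⟶[V] (colimHom S).obj b)) (k k' : K) :
    (act φ (op k') (op k) ▷ H) ≫ coconeCmp δ k = ((β_ _ (k ⟶[V] k')).hom ▷ H) ≫ (α_ _ _ _).hom ≫
      (S.map k k' ⊗ₘ coconeCmp δ k') ≫ eComp V (S.obj k) (S.obj k') b := by
  have hn : (φ.obj (op k') ◁ (β_ H (k ⟶[V] k')).hom) ≫ (α_ _ _ _).inv ≫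
      (act φ (op k') (op k) ▷ H) ≫ coconeCmp δ k = (α_ _ _ _).inv ≫ (β_ _ (k ⟶[V] k')).hom ≫
        (S.map k k' ⊗ₘ coconeCmp δ k') ≫ eComp V (S.obj k) (S.obj k') b := by
    refine (cmp_nat (G := (colimHom S).obj b) δ (op k') (op k)).trans ?_
    exact congrArg (_ ≫ ·) (whiskerRight_act_colimHom S b k k' (coconeCmp δ k'))
  have e : φ.obj (op k') ◁ (β_ H (k ⟶[V] k')).inv ≫ (α_ _ _ _).inv ≫
      (β_ _ (k ⟶[V] k')).hom = (α_ _ _ _).inv ≫ ((β_ _ _).hom ▷ H) ≫ (α_ _ _ _).hom := by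
    rw [braiding_tensor_left_hom, ← SymmetricCategory.braiding_swap_eq_inv_braiding]
    simp [← MonoidalCategory.whiskerLeft_comp_assoc]
  have hn' := congrArg (φ.obj (op k') ◁ (β_ H (k ⟶[V] k')).inv ≫ ·) hn
  simp only [reassoc_of% e, ← MonoidalCategory.whiskerLeft_comp_assoc, Iso.inv_hom_id,
    MonoidalCategory.whiskerLeft_id, Category.id_comp] at hn'
  exact (cancel_epi _).1 hn'

/-- A family of cocones on `b` indexed by `H`, evaluated by `P`, is a cowedge with parameter `H`;
stability of the coend under tensoring is what makes it factor. -/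
theorem IsCoendAt.exists_desc {P : EnrichedFunctor V D V} {φ : EnrichedFunctor V Kᵒᵖ V}
    {S : EnrichedFunctor V K D} {c : D} {η : 𝟙_ V ⟶ (φ ⟶[V] (colimHom S).obj c)}
    (h : IsCoendAt P η) {b : D} {H : V} (δ : H ⟶ (φ ⟶[V] (colimHom S).obj b)) :
    ∃ f : P.obj c ⊗ H ⟶ P.obj b, ∀ k, (unitAt P η k ▷ H) ≫ f =
      (α_ _ _ _).hom ≫ actAt P (coconeCmp δ k) := by
  refine IsCoend.exists_desc h _ fun k k' => ?_
  rw [associator_naturality_middle_assoc, ← comp_actAt, coconeCmp_nat, comp_actAt, comp_actAt,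
    actAt_tensor_comp]
  change (α_ (P.obj (S.obj k)) (φ.obj (op k') ⊗ (k ⟶[V] k')) H).hom ≫ _ = _
  simp

/-- The inverse of the comparison comes from factoring the generic cocone, with `H` the whole object
of cocones; both inverse laws are checked on the coend inclusions. -/
theorem isWeightedColimit_of_isCoendAt_id {φ : EnrichedFunctor V Kᵒᵖ V} {S : EnrichedFunctor V K V}
    {c : V} {η : 𝟙_ V ⟶ (φ ⟶[V] (colimHom S).obj c)}
    (h : IsCoendAt (EnrichedFunctor.id V V) η) : IsWeightedColimit φ S c η := by
  rw [isWeightedColimit_iff]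
  intro b
  obtain ⟨f, hf⟩ := h.exists_desc (b := b) (𝟙 _)
  let M : V := EnrichedCategory.Hom c b
  let P := EnrichedFunctor.id V V
  have hP : ∀ {X Y H : V} (f : H ⟶ EnrichedCategory.Hom X Y), actAt P f = uncurry f := fun f => by
    rw [actAt]
    exact congrArg uncurry (Category.comp_id f)
  let κ : M ⟶ (φ ⟶[V] (colimHom S).obj b) := (colimHom S).map c b ≫ ePre η _
  let δ : (φ ⟶[V] (colimHom S).obj b) ⟶ M := curry f
  have hδ : uncurry δ = f := uncurry_curry _
  have hκ : ∀ {H : V} (g : H ⟶ M) k, actAt P (coconeCmp (g ≫ κ) k) =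
      (α_ _ _ _).inv ≫ (unitAt P η k ▷ H) ≫ actAt P g := fun g k => actAt_comparison P η g k
  refine ⟨δ, ?_, ?_⟩
  · change κ ≫ δ = 𝟙 _
    apply uncurry_injective
    rw [uncurry_natural_left, hδ]
    refine IsCoend.hom_ext h fun k => ?_
    refine (whisker_exchange_assoc _ _ _).symm.trans ?_
    refine (congrArg (_ ≫ ·) (hf k)).trans ?_
    refine (associator_naturality_right_assoc _ _ _ _).trans ?_
    refine (congrArg (_ ≫ ·) (comp_actAt P _ _)).symm.trans ?_
    have h1 := hκ (𝟙 _) k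
    rw [Category.id_comp] at h1
    rw [← comp_coconeCmp, Category.comp_id]
    refine (congrArg (_ ≫ ·) h1).trans ?_
    rw [hP]
    exact Iso.hom_inv_id_assoc _ _
  · change δ ≫ κ = 𝟙 _
    refine coconeCmp_ext fun k => ?_
    apply uncurry_injective
    rw [← hP, ← hP]
    refine (hκ δ k).trans ?_
    rw [hP, hδ]
    exact (congrArg (_ ≫ ·) (hf k)).trans (Iso.inv_hom_id_assoc _ _)

theorem cmp_tensor_comp {J : Type w} [EnrichedCategory V J] {F G G' : EnrichedFunctor V J V}
    {H H' : V} (f : H ⟶ (F ⟶[V] G)) (g : H' ⟶ (G ⟶[V] G')) (x : J) :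
    cmp ((f ⊗ₘ g) ≫ eComp V F G G') x = (α_ _ _ _).inv ≫ (cmp f x ▷ H') ≫ cmp g x :=
  actAt_tensor_comp (evalAt V x) f g

theorem cmp_whiskerRight_act {J : Type w} [EnrichedCategory V J] {F G : EnrichedFunctor V J V}
    {H : V} (f : H ⟶ (F ⟶[V] G)) (x y : J) : (cmp f x ▷ (x ⟶[V] y)) ≫ act G x y =
      (α_ _ _ _).hom ≫ (F.obj x ◁ (β_ H (x ⟶[V] y)).hom) ≫ (α_ _ _ _).inv ≫
        (act F x y ▷ H) ≫ cmp f y :=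
  (Iso.inv_comp_eq _).1 (cmp_nat f x y).symm

theorem isWeightedColimit_of_isCoendAt_evalAt {J : Type w} [EnrichedCategory V J]
    {φ : EnrichedFunctor V Kᵒᵖ V} {S : EnrichedFunctor V K (EnrichedFunctor V J V)}
    {c : EnrichedFunctor V J V} {η : 𝟙_ V ⟶ (φ ⟶[V] (colimHom S).obj c)}
    (h : ∀ x, IsCoendAt (evalAt V x) η) : IsWeightedColimit φ S c η := by
  rw [isWeightedColimit_iff]
  intro b
  have h' : ∀ x : J, ∃ f : c.obj x ⊗ (φ ⟶[V] (colimHom S).obj b) ⟶ b.obj x, ∀ k,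
      (unitAt (evalAt V x) η k ▷ _) ≫ f =
        (α_ _ _ _).hom ≫ cmp (coconeCmp (φ := φ) (𝟙 _) k) x :=
    fun x => (h x).exists_desc (b := b) (𝟙 _)
  choose f hf using h'
  have hP : ∀ (x : J) {X Y : EnrichedFunctor V J V} {H : V} (f : H ⟶ (X ⟶[V] Y)),
    actAt (evalAt V x) f = cmp f x := fun x _ _ _ f => rfl
  let M : V := c ⟶[V] b
  let κ : M ⟶ (φ ⟶[V] (colimHom S).obj b) := (colimHom S).map c b ≫ ePre η _
  -- The factorizations `f x` are chosen separately for each `x`. Their naturality in `x` is tested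
  -- on the coend inclusions, where it follows from naturality of the components of `η` and of the
  -- generic cocone.
  let δ : (φ ⟶[V] (colimHom S).obj b) ⟶ M := cmpLift f fun x y => by
    refine IsCoend.hom_ext (h x) fun k => ?_
    let N : V := (φ ⟶[V] (colimHom S).obj b)
    let d : φ.obj (op k) ⊗ N ⟶ (S.obj k ⟶[V] b) := coconeCmp (φ := φ) (𝟙 _) k
    let i : ∀ x, (S.obj k).obj x ⊗ φ.obj (op k) ⟶ c.obj x := cmp (unitCmp η k)
    have hi : (i x ▷ (x ⟶[V] y)) ≫ act c x y = (α_ _ _ _).hom ≫ (_ ◁ (β_ _ _).hom) ≫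
        (α_ _ _ _).inv ≫ (act (S.obj k) x y ▷ _) ≫ i y := cmp_whiskerRight_act _ x y
    have hd : (cmp d x ▷ (x ⟶[V] y)) ≫ act b x y = (α_ _ _ _).hom ≫ (_ ◁ (β_ _ _).hom) ≫
        (α_ _ _ _).inv ≫ (act (S.obj k) x y ▷ _) ≫ cmp d y := cmp_whiskerRight_act _ x y
    have hf' : ∀ x, (i x ▷ N) ≫ f x = (α_ _ _ _).hom ≫ cmp d x := fun x => hf x k
    change (i x ▷ (N ⊗ (x ⟶[V] y))) ≫ (c.obj x ◁ (β_ N (x ⟶[V] y)).hom) ≫ (α_ _ _ _).inv ≫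
        (act c x y ▷ N) ≫ f y =
      (i x ▷ (N ⊗ (x ⟶[V] y))) ≫ (α_ _ _ _).inv ≫ (f x ▷ (x ⟶[V] y)) ≫ act b x y
    rw [← whisker_exchange_assoc, associator_inv_naturality_left_assoc,
      associator_inv_naturality_left_assoc, ← comp_whiskerRight_assoc, ← comp_whiskerRight_assoc,
      hi, hf', comp_whiskerRight_assoc, comp_whiskerRight_assoc, comp_whiskerRight_assoc,
      comp_whiskerRight_assoc, comp_whiskerRight_assoc, hd, hf',
      associator_naturality_left_assoc, braiding_tensor_left_hom]
    simp
  have hδ : ∀ x, cmp (F := c) δ x = f x := fun x => cmp_cmpLift _ _ x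
  have hκ : ∀ {H : V} (g : H ⟶ M) x k, cmp (coconeCmp (g ≫ κ) k) x =
      (α_ _ _ _).inv ≫ (unitAt (evalAt V x) η k ▷ H) ≫ cmp g x :=
    fun g x k => actAt_comparison (evalAt V x) η g k
  refine ⟨δ, ?_, ?_⟩
  · change κ ≫ δ = 𝟙 _
    refine cmp_ext (F := c) fun x => ?_
    rw [comp_cmp, hδ]
    refine IsCoend.hom_ext (h x) fun k => ?_
    refine (whisker_exchange_assoc _ _ _).symm.trans ?_
    rw [hf, associator_naturality_right_assoc, ← comp_cmp]
    have h1 := hκ (𝟙 _) x k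
    rw [Category.id_comp] at h1
    rw [← comp_coconeCmp, Category.comp_id, h1, Iso.hom_inv_id_assoc]
  · change δ ≫ κ = 𝟙 _
    refine coconeCmp_ext fun k => cmp_ext fun x => ?_
    rw [hκ, hδ, hf, Iso.inv_hom_id_assoc]

end Pointwise

/-! ### From an action to a `V`-functor -/

section FunctorOfAction

variable {V : Type v} [Category.{w} V] [MonoidalCategory V] [MonoidalClosed V]
  {A : Type u₁} [EnrichedCategory V A]

/-- The `V`-functor given by an action. -/
def functorOfAction (c : A → V) (a : ∀ x y, c x ⊗ (x ⟶[V] y) ⟶ c y)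
    (h1 : ∀ x, (c x ◁ eId V x) ≫ a x x = (ρ_ _).hom)
    (h2 : ∀ x y z, (a x y ▷ (y ⟶[V] z)) ≫ a y z =
      (α_ _ _ _).hom ≫ (_ ◁ eComp V x y z) ≫ a x z) : EnrichedFunctor V A V where
  obj := c
  map x y := curry (a x y)
  map_id x := by
    apply uncurry_injective
    rw [uncurry_natural_left, uncurry_curry, h1]
    exact (uncurry_curry _).symm
  map_comp x y z := by
    apply uncurry_injective
    rw [uncurry_tensor_comp, uncurry_natural_left, uncurry_curry, uncurry_curry, uncurry_curry, h2,
      Iso.inv_hom_id_assoc]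

theorem act_functorOfAction (c : A → V) (a : ∀ x y, c x ⊗ (x ⟶[V] y) ⟶ c y)
    (h1 : ∀ x, (c x ◁ eId V x) ≫ a x x = (ρ_ _).hom)
    (h2 : ∀ x y z, (a x y ▷ (y ⟶[V] z)) ≫ a y z =
      (α_ _ _ _).hom ≫ (_ ◁ eComp V x y z) ≫ a x z) (x y : A) :
    act (functorOfAction c a h1 h2) x y = a x y := uncurry_curry _

end FunctorOfAction

/-! ### Existence of pointwise colimits of presheaves -/

section Existence

variable {V : Type v} [Category.{w} V] [MonoidalCategory V] [SymmetricCategory V]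
  [MonoidalClosed V] [HasLimits V] [HasColimits V]
variable {K : Type w} [EnrichedCategory V K] {J : Type w} [EnrichedCategory V J]

/-- Take the coend separately at each `x`. The actions of `J` on the presheaves `S k` descend to the
coends by existence in the universal property, and the functor laws hold by its uniqueness. -/
theorem exists_isCoendAt (φ : EnrichedFunctor V Kᵒᵖ V)
    (S : EnrichedFunctor V K (EnrichedFunctor V J V)) :
    ∃ (c : EnrichedFunctor V J V) (η : 𝟙_ V ⟶ (φ ⟶[V] (colimHom S).obj c)),
      ∀ x, IsCoendAt (evalAt V x) η := by
  choose c i hi using fun x : J => exists_isCoend φ (fun k => (S.obj k).obj x)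
    fun k k' => cmp (S.map k k') x
  have hw : ∀ x k k', (_ ◁ act φ (op k') (op k)) ≫ i x k =
      (_ ◁ (β_ (φ.obj (op k')) (k ⟶[V] k')).hom) ≫ (α_ _ _ _).inv ≫
        (cmp (S.map k k') x ▷ _) ≫ i x k' := fun x => (hi x).cowedge
  have ha : ∀ x y : J, ∃ f : c x ⊗ (x ⟶[V] y) ⟶ c y, ∀ k, (i x k ▷ (x ⟶[V] y)) ≫ f =
      (α_ _ _ _).hom ≫ (_ ◁ (β_ _ _).hom) ≫ (α_ _ _ _).inv ≫ (act (S.obj k) x y ▷ _) ≫ i y k :=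
    fun x y => (hi x).exists_desc _ fun k k' => by
      have hs : (cmp (S.map k k') x ▷ (x ⟶[V] y)) ≫ act (S.obj k') x y =
        (α_ _ _ _).hom ≫ (_ ◁ (β_ _ _).hom) ≫ (α_ _ _ _).inv ≫
          (act (S.obj k) x y ▷ _) ≫ cmp (S.map k k') y := cmp_whiskerRight_act _ x y
      change ((_ ◁ act φ (op k') (op k)) ▷ (x ⟶[V] y)) ≫ (α_ _ _ _).hom ≫
          (_ ◁ (β_ _ _).hom) ≫ (α_ _ _ _).inv ≫ (act (S.obj k) x y ▷ _) ≫ i y k =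
        ((_ ◁ (β_ (φ.obj (op k')) (k ⟶[V] k')).hom ≫ (α_ _ _ _).inv ≫
          (cmp (S.map k k') x ▷ φ.obj (op k'))) ▷ (x ⟶[V] y)) ≫ (α_ _ _ _).hom ≫
            (_ ◁ (β_ _ _).hom) ≫ (α_ _ _ _).inv ≫ (act (S.obj k') x y ▷ _) ≫ i y k'
      rw [associator_naturality_middle_assoc, ← MonoidalCategory.whiskerLeft_comp_assoc,
        braiding_naturality_left, MonoidalCategory.whiskerLeft_comp_assoc,
        associator_inv_naturality_right_assoc, whisker_exchange_assoc, hw,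
        ← whisker_exchange_assoc, associator_inv_naturality_left_assoc,
        ← associator_inv_naturality_right_assoc, ← MonoidalCategory.whiskerLeft_comp_assoc,
        ← braiding_naturality_left, MonoidalCategory.whiskerLeft_comp_assoc,
        ← associator_naturality_middle_assoc, comp_whiskerRight_assoc, comp_whiskerRight_assoc,
        associator_naturality_left_assoc, ← whisker_exchange_assoc,
        associator_inv_naturality_left_assoc, ← comp_whiskerRight_assoc (cmp _ x ▷ _), hs,
        braiding_tensor_left_hom]
      simp
      rfl
  choose a ha using ha
  let F : EnrichedFunctor V J V := functorOfAction c a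
    (fun x => by
      refine IsCoend.hom_ext (H := 𝟙_ V) (hi x) fun k => ?_
      rw [← whisker_exchange_assoc, ha, associator_naturality_right_assoc,
        ← MonoidalCategory.whiskerLeft_comp_assoc, braiding_naturality_right,
        MonoidalCategory.whiskerLeft_comp_assoc, associator_inv_naturality_middle_assoc,
        ← comp_whiskerRight_assoc, act_id]
      simp [braiding_tensorUnit_right])
    fun x y z => by
      rw [← cancel_epi (α_ _ _ _).inv, Iso.inv_hom_id_assoc]
      refine IsCoend.hom_ext (hi x) fun k => ?_
      rw [associator_inv_naturality_left_assoc, ← comp_whiskerRight_assoc, ha,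
        ← whisker_exchange_assoc, ha, comp_whiskerRight_assoc, comp_whiskerRight_assoc,
        comp_whiskerRight_assoc, comp_whiskerRight_assoc, ha, associator_naturality_left_assoc,
        ← whisker_exchange_assoc, associator_inv_naturality_left_assoc,
        ← comp_whiskerRight_assoc (act (S.obj k) x y ▷ _), act_assoc, associator_naturality_right_assoc, ← MonoidalCategory.whiskerLeft_comp_assoc,
        braiding_naturality_right, MonoidalCategory.whiskerLeft_comp_assoc,
        associator_inv_naturality_middle_assoc, ← comp_whiskerRight_assoc (_ ◁ eComp V x y z),
        braiding_tensor_right_hom]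
      simp
  have hF : ∀ x y, act F x y = a x y := fun x y => act_functorOfAction _ _ _ _ x y
  let g : ∀ k, φ.obj (op k) ⟶ (S.obj k ⟶[V] F) := fun k => cmpLift (G := F) (fun x => i x k)
    fun x y => by
      rw [hF]
      exact ((congrArg (_ ≫ ·) (ha x y k)).trans (Iso.inv_hom_id_assoc _ _)).symm
  have hg : ∀ k x, cmp (g k) x = i x k := fun k x => cmp_cmpLift (G := F) _ _ x
  let η : 𝟙_ V ⟶ (φ ⟶[V] (colimHom S).obj F) := natElt (fun k => elt (g k.unop))
    ((isENat_elt_iff (G := (colimHom S).obj F) fun k => g k.unop).2 fun k k' => by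
      refine Eq.trans ?_ (whiskerRight_act_colimHom S F k'.unop k.unop (g k.unop)).symm
      refine cmp_ext fun x => ?_
      change cmp (act φ k k' ≫ g k'.unop) x = _
      refine (comp_cmp _ _ x).trans (Eq.trans ?_ (comp_cmp _ _ x).symm)
      have e : cmp ((S.map k'.unop k.unop ⊗ₘ g k.unop) ≫ eComp V _ _ F) x =
          (α_ _ _ _).inv ≫ (cmp (S.map k'.unop k.unop) x ▷ _) ≫ cmp (g k.unop) x :=
        actAt_tensor_comp (evalAt V x) _ _
      rw [e, hg, hg]
      exact hw x _ _)
  have hη : ∀ k, unitCmp η k = g k := fun k =>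
    (congrArg unelt (natElt_π _ _ (op k))).trans (unelt_elt _)
  refine ⟨F, η, fun x => ?_⟩
  have : unitAt (evalAt V x) η = i x := by
    funext k
    rw [unitAt, hη]
    exact hg k x
  rw [IsCoendAt, this]
  exact hi x

end Existence

/-! ### Evaluation and restriction preserve colimits -/

section ColimitPreservation

variable {V : Type v} [Category.{w} V] [MonoidalCategory V] [SymmetricCategory V]
  [MonoidalClosed V] [HasLimits V]
variable {K : Type w} [EnrichedCategory V K] {A : Type u₁} [EnrichedCategory V A]
  {B : Type u₂} [EnrichedCategory V B]

/-- The image of a cocone. -/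
def mapUnit (F : EnrichedFunctor V A B) {φ : EnrichedFunctor V Kᵒᵖ V} {S : EnrichedFunctor V K A}
    {c : A} (η : 𝟙_ V ⟶ (φ ⟶[V] (colimHom S).obj c)) :
    𝟙_ V ⟶ (φ ⟶[V] (colimHom (S.comp V F)).obj (F.obj c)) :=
  mapCounit (opFunctor F) φ (opFunctor S) (op c) η

theorem unitCmp_mapUnit (F : EnrichedFunctor V A B) {φ : EnrichedFunctor V Kᵒᵖ V}
    {S : EnrichedFunctor V K A} {c : A} (η : 𝟙_ V ⟶ (φ ⟶[V] (colimHom S).obj c)) (k : K) :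
    unitCmp (mapUnit F η) k = unitCmp η k ≫ F.map (S.obj k) c := by
  refine (congrArg (fun t => unelt (t ≫ natπ _ _ (op k))) (mapCounit_eq _ _ _ _ _)).trans ?_
  refine (congrArg unelt ((Category.assoc _ _ _).trans
    (congrArg (η ≫ ·) (ePost_natπ (mapElt (opFunctor F) (opFunctor S) (op c)) φ (op k))))).trans ?_
  rw [← Category.assoc]
  refine (unelt_comp_ePost _ _).trans (congrArg (_ ≫ ·) ?_)
  exact (congrArg unelt (mapElt_π (opFunctor F) (opFunctor S) (op c) (op k))).trans (unelt_elt _)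

theorem preservesWeightedColimit_iff {F : EnrichedFunctor V A B} {φ : EnrichedFunctor V Kᵒᵖ V}
    {S : EnrichedFunctor V K A} : PreservesWeightedColimit F φ S ↔
      ∀ c (η : 𝟙_ V ⟶ (φ ⟶[V] (colimHom S).obj c)), IsWeightedColimit φ S c η →
        IsWeightedColimit φ (S.comp V F) (F.obj c) (mapUnit F η) :=
  ⟨fun h c η hη => h (op c) η hη, fun h c η hη => h c.unop η hη⟩

theorem preservesWeightedColimit_of_exists {F : EnrichedFunctor V A B}
    {φ : EnrichedFunctor V Kᵒᵖ V} {S : EnrichedFunctor V K A} {c : A}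
    {η : 𝟙_ V ⟶ (φ ⟶[V] (colimHom S).obj c)} (h : IsWeightedColimit φ S c η)
    (hF : IsWeightedColimit φ (S.comp V F) (F.obj c) (mapUnit F η)) :
    PreservesWeightedColimit F φ S :=
  preservesWeightedLimit_of_exists h hF

/-- Stated with an equation `hQ` because in the applications the composite `F.comp V P` is an
evaluation only up to propositional equality. -/
theorem isCoendAt_mapUnit {F : EnrichedFunctor V A B} {P : EnrichedFunctor V B V}
    {Q : EnrichedFunctor V A V} (hQ : F.comp V P = Q) {φ : EnrichedFunctor V Kᵒᵖ V}
    {S : EnrichedFunctor V K A} {c : A} {η : 𝟙_ V ⟶ (φ ⟶[V] (colimHom S).obj c)}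
    (h : IsCoendAt Q η) : IsCoendAt P (mapUnit F η) := by
  subst hQ
  have e1 : unitAt P (mapUnit F η) = unitAt (F.comp V P) η := by
    funext k
    rw [unitAt, unitCmp_mapUnit]
    exact congrArg uncurry (Category.assoc _ _ _)
  have e2 : (fun k k' => actAt P ((S.comp V F).map k k')) =
      fun k k' => actAt (F.comp V P) (S.map k k') := by
    funext k k'
    exact congrArg uncurry (Category.assoc _ _ _)
  rw [IsCoendAt, e1, e2]
  exact h

variable [HasColimits V] {J : Type w} [EnrichedCategory V J] {L : Type w} [EnrichedCategory V L]

theorem exists_isWeightedColimit (φ : EnrichedFunctor V Kᵒᵖ V)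
    (S : EnrichedFunctor V K (EnrichedFunctor V J V)) :
    ∃ (c : EnrichedFunctor V J V) (η : 𝟙_ V ⟶ (φ ⟶[V] (colimHom S).obj c)),
      IsWeightedColimit φ S c η := by
  obtain ⟨c, η, h⟩ := exists_isCoendAt φ S
  exact ⟨c, η, isWeightedColimit_of_isCoendAt_evalAt h⟩

theorem preservesWeightedColimit_evalAt (x : J) (φ : EnrichedFunctor V Kᵒᵖ V)
    (S : EnrichedFunctor V K (EnrichedFunctor V J V)) :
    PreservesWeightedColimit (evalAt V x) φ S := by
  obtain ⟨c, η, h⟩ := exists_isCoendAt φ S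
  refine preservesWeightedColimit_of_exists (isWeightedColimit_of_isCoendAt_evalAt h)
    (isWeightedColimit_of_isCoendAt_id (isCoendAt_mapUnit ?_ (h x)))
  exact EnrichedFunctor.ext V (fun _ => rfl) fun X Y => (Category.comp_id _).trans (Category.comp_id _)

theorem preservesWeightedColimit_restrictAlong (T : EnrichedFunctor V L J)
    (φ : EnrichedFunctor V Kᵒᵖ V) (S : EnrichedFunctor V K (EnrichedFunctor V J V)) :
    PreservesWeightedColimit (restrictAlong V T) φ S := by
  obtain ⟨c, η, h⟩ := exists_isCoendAt φ S
  refine preservesWeightedColimit_of_exists (isWeightedColimit_of_isCoendAt_evalAt h)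
    (isWeightedColimit_of_isCoendAt_evalAt fun x => isCoendAt_mapUnit ?_ (h (T.obj x)))
  exact EnrichedFunctor.ext V (fun _ => rfl) fun X Y =>
    (Category.comp_id _).trans (restrictAlong_map_π T X Y x)

end ColimitPreservation

/-! ### Partial left adjoints and colimits -/

section Transfer

variable {V : Type v} [Category.{w} V] [MonoidalCategory V] [SymmetricCategory V]
  [MonoidalClosed V] [HasLimits V]
variable {K : Type w} [EnrichedCategory V K] {A : Type u₁} [EnrichedCategory V A]
  {B : Type u₂} [EnrichedCategory V B] {E : Type u₃} [EnrichedCategory V E]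

theorem coconeCmp_unit {φ : EnrichedFunctor V Kᵒᵖ V} {S : EnrichedFunctor V K A} {c : A}
    (η : 𝟙_ V ⟶ (φ ⟶[V] (colimHom S).obj c)) (k : K) :
    coconeCmp η k = (ρ_ _).hom ≫ unitCmp η k := cmp_unit η (op k)

theorem unitCmp_ext {φ : EnrichedFunctor V Kᵒᵖ V} {S : EnrichedFunctor V K A} {c : A}
    {η η' : 𝟙_ V ⟶ (φ ⟶[V] (colimHom S).obj c)} (h : ∀ k, unitCmp η k = unitCmp η' k) : η = η' :=
  coconeCmp_ext fun k => by rw [coconeCmp_unit, coconeCmp_unit, h]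

theorem unitCmp_comparison {φ : EnrichedFunctor V Kᵒᵖ V} {S : EnrichedFunctor V K A} {c : A}
    (η : 𝟙_ V ⟶ (φ ⟶[V] (colimHom S).obj c)) {b : A} (g : 𝟙_ V ⟶ (c ⟶[V] b)) (k : K) :
    unitCmp (g ≫ (colimHom S).map c b ≫ ePre η ((colimHom S).obj b)) k =
      unitCmp η k ≫ ePost g (S.obj k) := by
  have h := coconeCmp_comparison η g k
  rw [coconeCmp_unit, MonoidalCategory.tensorHom_def, Category.assoc] at h
  rw [← cancel_epi (ρ_ _).hom, h, ePost, rightUnitor_inv_naturality_assoc, Iso.hom_inv_id_assoc]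

theorem unitCmp_comp_ePost {φ : EnrichedFunctor V Kᵒᵖ V} {R : EnrichedFunctor V K A}
    {S : EnrichedFunctor V K E} {t : A} {b : E} (θ : 𝟙_ V ⟶ (φ ⟶[V] (colimHom R).obj t))
    (τ : 𝟙_ V ⟶ ((colimHom R).obj t ⟶[V] (colimHom S).obj b)) (k : K)
    {p : (R.obj k ⟶[V] t) ⟶ (S.obj k ⟶[V] b)}
    (hp : τ ≫ natπ ((colimHom R).obj t) ((colimHom S).obj b) (op k) = elt p) :
    unitCmp (θ ≫ ePost τ φ) k = unitCmp θ k ≫ p := by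
  refine (congrArg unelt ((Category.assoc _ _ _).trans (congrArg (θ ≫ ·)
    (ePost_natπ τ φ (op k))))).trans ?_
  rw [← Category.assoc]
  refine (unelt_comp_ePost _ _).trans (congrArg (_ ≫ ·) ?_)
  exact (congrArg unelt hp).trans (unelt_elt _)

section

variable (I : EnrichedFunctor V A E) {S : EnrichedFunctor V K E}
    {R : EnrichedFunctor V K A} {u : ∀ k, 𝟙_ V ⟶ (S.obj k ⟶[V] I.obj (R.obj k))}
    (hu : IsENat S (R.comp V I) u) {φ : EnrichedFunctor V Kᵒᵖ V} {c : E} {t : A}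
    {η : 𝟙_ V ⟶ (φ ⟶[V] (colimHom S).obj c)} {θ : 𝟙_ V ⟶ (φ ⟶[V] (colimHom R).obj t)}
    {v : 𝟙_ V ⟶ (c ⟶[V] I.obj t)}

include hu in
-- Partial left adjoints preserve colimits: `E(c, I a)`, cocones under `S` to `I a`, cocones under
-- `R` to `a` and `A(t, a)` form a square by `transposeHom_comparison`, two of whose sides are
-- invertible by hypothesis. All hypotheses concern one fixed `a`, which permits the use of cocones
-- that are colimiting only for some test objects.
theorem isIso_comparison_iff
    (hv : ∀ k, unitCmp η k ≫ ePost v (S.obj k) =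
      unitCmp θ k ≫ I.map (R.obj k) t ≫ ePre (u k) (I.obj t)) (a : A)
    (h : ∀ k, IsIso (I.map (R.obj k) a ≫ ePre (u k) (I.obj a)))
    (hη : IsIso ((colimHom S).map c (I.obj a) ≫ ePre η _)) :
    IsIso (I.map t a ≫ ePre v (I.obj a)) ↔ IsIso ((colimHom R).map t a ≫ ePre θ _) := by
  have := isIso_ePost_transposeHom I hu a h φ
  have e := transposeHom_comparison I hu (η := η) (θ := θ) (v := v) (unitCmp_ext fun k => by
    rw [unitCmp_comparison, unitCmp_comp_ePost θ _ k (transposeHom_π I hu t (op k))]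
    exact hv k) a
  rw [← isIso_comp_right_iff _ ((colimHom S).map c (I.obj a) ≫ ePre η _), ← e,
    isIso_comp_right_iff]

include hu in
-- The arrow out of the colimit `c` is induced by the transpose of `θ`.
theorem exists_of_isIso_unit (θ : 𝟙_ V ⟶ (φ ⟶[V] (colimHom R).obj t))
    (hη : IsIso ((colimHom S).map c (I.obj t) ≫ ePre η _)) :
    ∃ v : 𝟙_ V ⟶ (c ⟶[V] I.obj t), ∀ k, unitCmp η k ≫ ePost v (S.obj k) =
      unitCmp θ k ≫ I.map (R.obj k) t ≫ ePre (u k) (I.obj t) := by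
  refine ⟨(θ ≫ ePost (transposeHom I hu t) φ) ≫ inv ((colimHom S).map c (I.obj t) ≫ ePre η _),
    fun k => ?_⟩
  rw [← unitCmp_comparison, Category.assoc, IsIso.inv_hom_id, Category.comp_id]
  exact unitCmp_comp_ePost θ _ k (transposeHom_π I hu t (op k))

include hu in
-- Converse to `exists_of_isIso_unit`: an arrow `v` gives a cocone on `S`, which is transposed back
-- to a cocone on `R`.
theorem exists_unit_of_isIso (η : 𝟙_ V ⟶ (φ ⟶[V] (colimHom S).obj c))
    (v : 𝟙_ V ⟶ (c ⟶[V] I.obj t))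
    (h : ∀ k, IsIso (I.map (R.obj k) t ≫ ePre (u k) (I.obj t))) :
    ∃ θ : 𝟙_ V ⟶ (φ ⟶[V] (colimHom R).obj t), ∀ k, unitCmp η k ≫ ePost v (S.obj k) =
      unitCmp θ k ≫ I.map (R.obj k) t ≫ ePre (u k) (I.obj t) := by
  have := isIso_ePost_transposeHom I hu t h φ
  refine ⟨(v ≫ (colimHom S).map c (I.obj t) ≫ ePre η _) ≫ inv (ePost (transposeHom I hu t) φ),
    fun k => ?_⟩
  rw [← unitCmp_comparison, ← unitCmp_comp_ePost _ _ k (transposeHom_π I hu t (op k)),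
    Category.assoc, IsIso.inv_hom_id, Category.comp_id]

end

section

variable {S R : EnrichedFunctor V K E} {u : ∀ k, 𝟙_ V ⟶ (S.obj k ⟶[V] R.obj k)}
    (hu : IsENat S R u) {φ : EnrichedFunctor V Kᵒᵖ V} {c t : E}
    {η : 𝟙_ V ⟶ (φ ⟶[V] (colimHom S).obj c)} {θ : 𝟙_ V ⟶ (φ ⟶[V] (colimHom R).obj t)}
    {v : 𝟙_ V ⟶ (c ⟶[V] t)}

include hu

theorem IsENat.comp_id : IsENat S (R.comp V (EnrichedFunctor.id V E)) u := fun k k' =>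
  (hu k k').trans (congrArg (· ≫ _) (Category.comp_id _).symm)

theorem isIso_ePre_iff
    (hv : ∀ k, unitCmp η k ≫ ePost v (S.obj k) = unitCmp θ k ≫ ePre (u k) t) (a : E)
    (h : ∀ k, IsIso (ePre (u k) a)) (hη : IsIso ((colimHom S).map c a ≫ ePre η _)) :
    IsIso (ePre v a) ↔ IsIso ((colimHom R).map t a ≫ ePre θ _) := by
  have e : ∀ (x y : E) {Z : V} (f : (x ⟶[V] y) ⟶ Z),
    (EnrichedFunctor.id V E).map x y ≫ f = f := fun x y Z f => Category.id_comp _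
  refine (iff_of_eq (congrArg (fun t => IsIso t) (e t a (ePre v a)))).symm.trans ?_
  exact isIso_comparison_iff (EnrichedFunctor.id V E) hu.comp_id
    (fun k => (hv k).trans (congrArg (_ ≫ ·) (e _ _ _).symm)) a
    (fun k => (congrArg (fun t => IsIso t) (e _ _ (ePre (u k) a))).mpr (h k)) hη

theorem exists_factor (θ : 𝟙_ V ⟶ (φ ⟶[V] (colimHom R).obj t))
    (hη : IsIso ((colimHom S).map c t ≫ ePre η _)) :
    ∃ v : 𝟙_ V ⟶ (c ⟶[V] t), ∀ k, unitCmp η k ≫ ePost v (S.obj k) =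
      unitCmp θ k ≫ ePre (u k) t := by
  obtain ⟨v, hv⟩ := exists_of_isIso_unit (EnrichedFunctor.id V E) hu.comp_id θ hη
  exact ⟨v, fun k => (hv k).trans (congrArg (_ ≫ ·) (Category.id_comp _))⟩

/-- The morphism of colimits induced by an invertible transformation is invertible. -/
theorem exists_areInverse_of_isWeightedColimit
    (hv : ∀ k, unitCmp η k ≫ ePost v (S.obj k) = unitCmp θ k ≫ ePre (u k) t)
    (h : ∀ k, ∃ g, AreInverse (u k) g) (hη : IsWeightedColimit φ S c η)
    (hθ : IsWeightedColimit φ R t θ) : ∃ g, AreInverse v g := by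
  rw [isWeightedColimit_iff] at hη hθ
  refine exists_areInverse_of_ePre _ fun z => (isIso_ePre_iff hu hv z (fun k => ?_) (hη z)).2 (hθ z)
  obtain ⟨g, hg⟩ := h k
  exact hg.isIso_ePre z

end

/-- Two opposite sides of the naturality square at `i` are invertible, so invertibility passes from
the component at `a` to that at `b`. This yields repleteness of `continuous`. -/
theorem IsENat.exists_areInverse {F G : EnrichedFunctor V A V}
    {α : ∀ a, 𝟙_ V ⟶ EnrichedCategory.Hom (F.obj a) (G.obj a)} (hα : IsENat F G α) {a b : A}
    {i : 𝟙_ V ⟶ (a ⟶[V] b)} {j : 𝟙_ V ⟶ (b ⟶[V] a)} (hij : AreInverse i j)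
    (h : IsIso (unelt (α a))) : IsIso (unelt (α b)) := by
  have e := congrArg (i ≫ ·) (hα a b)
  simp only [← Category.assoc] at e
  rw [← comp_ePost_eq_comp_ePre (α a)] at e
  have e := congrArg unelt e
  rw [unelt_comp_ePost, unelt_comp_ePost] at e
  have := (hij.map F).isIso_unelt
  have := (hij.map G).isIso_unelt
  rw [← isIso_comp_left_iff (unelt (i ≫ F.map a b)), e]
  infer_instance

end Transfer

/-! ### The canonical map `G l ⟶ {ψ, G T}` -/

section Continuous

variable {V : Type v} [Category.{w} V] [MonoidalCategory V] [SymmetricCategory V]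
  [MonoidalClosed V] [HasLimits V]
variable {J : Type w} [EnrichedCategory V J] {K : Type w} [EnrichedCategory V K]

/-- The canonical morphism `G l ⟶ [J, V](ψ, G T)`. -/
def limitMap {ψ : EnrichedFunctor V J V} {T : EnrichedFunctor V J K} {l : K}
    (μ : 𝟙_ V ⟶ (ψ ⟶[V] T.comp V (rep l))) (G : EnrichedFunctor V K V) :
    G.obj l ⟶ (ψ ⟶[V] T.comp V G) :=
  yonedaLift l G ≫ (restrictAlong V T).map (rep l) G ≫ ePre μ (T.comp V G)

theorem isWeightedLimit_mapCounit_iff_limitMap {ψ : EnrichedFunctor V J V}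
    {T : EnrichedFunctor V J K} {l : K} (μ : 𝟙_ V ⟶ (ψ ⟶[V] T.comp V (rep l)))
    (G : EnrichedFunctor V K V) :
    IsWeightedLimit ψ (T.comp V G) (G.obj l) (mapCounit G ψ T l μ) ↔ IsIso (limitMap μ G) := by
  rw [isWeightedLimit_mapCounit_iff]
  exact (isIso_comp_left_iff (yonedaLift l G) _).symm

theorem cmp_limitMap {ψ : EnrichedFunctor V J V} {T : EnrichedFunctor V J K} {l : K}
    (μ : 𝟙_ V ⟶ (ψ ⟶[V] T.comp V (rep l))) (G : EnrichedFunctor V K V) (j : J)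
    {m : ψ.obj j ⟶ (l ⟶[V] T.obj j)} (hm : μ ≫ natπ ψ (T.comp V (rep l)) j = elt m) :
    cmp (G := T.comp V G) (limitMap μ G) j = (β_ _ _).hom ≫ (_ ◁ m) ≫ act G l (T.obj j) := by
  rw [limitMap, ← Category.assoc]
  refine (cmp_comp_ePre (F := T.comp V (rep l)) (G := T.comp V G) _ μ j).trans ?_
  refine (congrArg₂ (fun s t => (s ▷ _) ≫ t) ((congrArg unelt hm).trans (unelt_elt m))
    ((cmp_restrictAlong T _ j).trans (cmp_yonedaLift l G _))).trans ?_
  exact braiding_naturality_left_assoc m _ _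

/-- Naturality in `G`, which allows this map for a colimit of presheaves to be computed from the
maps for the presheaves in the diagram. -/
theorem isENat_limitMap {ψ : EnrichedFunctor V J V} {T : EnrichedFunctor V J K} {l : K}
    (μ : 𝟙_ V ⟶ (ψ ⟶[V] T.comp V (rep l))) :
    IsENat (evalAt V l) ((restrictAlong V T).comp V (rep ψ)) fun G => elt (limitMap μ G) := by
  refine (isENat_elt_iff (F := evalAt V l) (G := (restrictAlong V T).comp V (rep ψ)) (limitMap μ)).2 fun G H => ?_
  refine Eq.trans ?_ (congrArg (_ ≫ ·) (act_comp_rep (restrictAlong V T) ψ G H)).symm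
  refine cmp_ext (G := T.comp V H) fun j => ?_
  obtain ⟨m, hm⟩ : ∃ m : ψ.obj j ⟶ (l ⟶[V] T.obj j), μ ≫ natπ ψ (T.comp V (rep l)) j = elt m :=
    ⟨unelt _, (elt_unelt _).symm⟩
  let N : V := (G ⟶[V] H)
  let d : ∀ x, G.obj x ⊗ N ⟶ H.obj x := cmp (F := G) (G := H) (𝟙 _)
  have hd : (d l ▷ (l ⟶[V] T.obj j)) ≫ act H l (T.obj j) =
      (α_ _ _ _).hom ≫ (_ ◁ (β_ _ _).hom) ≫ (α_ _ _ _).inv ≫ (act G l (T.obj j) ▷ _) ≫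
        d (T.obj j) := cmp_whiskerRight_act _ _ _
  have h1 : cmp (G := T.comp V H) (act (evalAt V l) G H ≫ limitMap μ H) j =
      (ψ.obj j ◁ d l) ≫ (β_ _ _).hom ≫ (_ ◁ m) ≫ act H l (T.obj j) := by
    refine (comp_cmp _ _ _).trans (congrArg₂ (fun s t => (ψ.obj j ◁ s) ≫ t) ?_
      (cmp_limitMap μ H j hm))
    exact congrArg uncurry (Category.id_comp _).symm
  have h2 : cmp (G := T.comp V H) ((limitMap μ G ⊗ₘ (restrictAlong V T).map G H) ≫
      eComp V ψ (T.comp V G) (T.comp V H)) j =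
      (α_ _ _ _).inv ≫ (((β_ _ _).hom ≫ (_ ◁ m) ≫ act G l (T.obj j)) ▷ N) ≫ d (T.obj j) := by
    refine (actAt_tensor_comp (evalAt V j) (limitMap μ G) ((restrictAlong V T).map G H)).trans ?_
    refine congrArg₂ (fun s t => (α_ _ _ _).inv ≫ (s ▷ N) ≫ t) (cmp_limitMap μ G j hm) ?_
    have := cmp_restrictAlong T (F := G) (G := H) (𝟙 _) j
    rwa [Category.id_comp] at this
  refine h1.trans (Eq.trans ?_ (h2.symm.trans ?_))
  · change (ψ.obj j ◁ d l) ≫ (β_ (ψ.obj j) (H.obj l)).hom ≫ (H.obj l ◁ m) ≫ act H l (T.obj j) =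
      (α_ _ _ _).inv ≫ (((β_ _ _).hom ≫ (_ ◁ m) ≫ act G l (T.obj j)) ▷ N) ≫ d (T.obj j)
    rw [braiding_naturality_right_assoc, ← whisker_exchange_assoc, hd, comp_whiskerRight_assoc,
      comp_whiskerRight_assoc, associator_naturality_right_assoc,
      ← MonoidalCategory.whiskerLeft_comp_assoc, braiding_naturality_right,
      MonoidalCategory.whiskerLeft_comp_assoc, associator_inv_naturality_middle_assoc,
      braiding_tensor_right_hom]
    have hb : (G.obj l ◁ (β_ (ψ.obj j) N).hom) ≫ (G.obj l ◁ (β_ N (ψ.obj j)).hom) = 𝟙 _ := by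
      rw [← MonoidalCategory.whiskerLeft_comp, SymmetricCategory.symmetry,
        MonoidalCategory.whiskerLeft_id]
    simp [reassoc_of% hb]
  · rw [MonoidalCategory.tensorHom_def_assoc]
    rfl

theorem natLift_yonedaFam {A : Type w} [EnrichedCategory V A] (a l : A) :
    natLift (yonedaFam (V := V) a l) = yonedaLift l (rep a) := cmp_ext fun x => by
  rw [cmp_yonedaLift, act_rep]
  exact (congrArg uncurry (natLift_π (yonedaFam a l) x)).trans (uncurry_curry _)

/-- For a representable, `limitMap` is the limit comparison itself, since restriction along `T`
after Yoneda is `limHom T`. -/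
theorem isIso_limitMap_rep {ψ : EnrichedFunctor V J V} {T : EnrichedFunctor V J K} {l : K}
    {μ : 𝟙_ V ⟶ (ψ ⟶[V] T.comp V (rep l))} (h : IsWeightedLimit ψ T l μ) (a : K) :
    IsIso (limitMap μ (rep a)) := by
  have h := (isWeightedLimit_iff _ _ _ _).1 h (op a)
  have e : (limHom T).map (op l) (op a) = yonedaLift l (rep a) ≫ (restrictAlong V T).map _ _ := by
    rw [← natLift_yonedaFam]
    refine natObj_hom_ext (F := T.comp V (rep l)) (G := T.comp V (rep a)) fun j => ?_
    refine (limHom_map_π T (op l) (op a) j).trans (Eq.trans ?_ (Category.assoc _ _ _).symm)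
    refine Eq.trans ?_ (congrArg (_ ≫ ·) (restrictAlong_map_π T (rep l) (rep a) j)).symm
    exact (natLift_π (yonedaFam a l) (T.obj j)).symm
  rw [e, Category.assoc] at h
  exact h

end Continuous

/-! ### Closures and repleteness -/

section Closure

variable {V : Type v} [Category.{w} V] [MonoidalCategory V] [SymmetricCategory V]
  [MonoidalClosed V] [HasLimits V]
variable (Φ : WeightClass V)

namespace WeightClass

theorem subset_closure {B : Type u} [EnrichedCategory V B] (P : Set B) : P ⊆ Φ.closure P :=
  fun _ hb _ hQ => hQ.1 hb

theorem closure_subset {B : Type u} [EnrichedCategory V B] {P Q : Set B} (h : P ⊆ Q)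
    (hr : Replete (V := V) Q) (hc : Φ.ClosedUnder Q) : Φ.closure P ⊆ Q :=
  fun _ hb => hb _ ⟨h, hr, hc⟩

theorem replete_closure {B : Type u} [EnrichedCategory V B] (P : Set B) :
    Replete (V := V) (Φ.closure P) :=
  fun b b' hb i Q hQ => hQ.2.1 b b' (hb Q hQ) i

theorem closedUnder_closure {B : Type u} [EnrichedCategory V B] (P : Set B) :
    Φ.ClosedUnder (Φ.closure P) :=
  fun K _ φ hφ S hS c η hη Q hQ => hQ.2.2 K φ hφ S (fun k => hS k Q hQ) c η hη

theorem closure_mono {B : Type u} [EnrichedCategory V B] {P P' : Set B} (h : P ⊆ P') :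
    Φ.closure P ⊆ Φ.closure P' :=
  Φ.closure_subset (h.trans (Φ.subset_closure P')) (Φ.replete_closure P') (Φ.closedUnder_closure P')

end WeightClass

theorem replete_of_areInverse {A : Type u} [EnrichedCategory V A] {Q : Set A}
    (h : ∀ (x y : A) (f : 𝟙_ V ⟶ (x ⟶[V] y)) (g : 𝟙_ V ⟶ (y ⟶[V] x)), AreInverse f g → x ∈ Q → y ∈ Q) :
    Replete (V := V) Q := fun x y hx i => by
  obtain ⟨f, g, hfg⟩ := exists_areInverse_of_iso i
  exact h x y f g hfg hx

theorem Replete.mem_of_areInverse {A : Type u} [EnrichedCategory V A] {Q : Set A}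
    (h : Replete (V := V) Q) {x y : A} {f : 𝟙_ V ⟶ (x ⟶[V] y)} {g : 𝟙_ V ⟶ (y ⟶[V] x)}
    (hfg : AreInverse f g) (hx : x ∈ Q) : y ∈ Q :=
  h x y hx (nonempty_iso_of_areInverse hfg)

end Closure

/-! ### `Φ⁺(N)` consists of continuous presheaves -/

section Continuous

variable {V : Type v} [Category.{w} V] [MonoidalCategory V] [SymmetricCategory V]
  [MonoidalClosed V] [HasLimits V]
variable (Φ : WeightClass V) (N : Type w) [EnrichedCategory V N]

namespace WeightClass

theorem mem_continuous_iff (G : EnrichedFunctor V Nᵒᵖ V) : G ∈ Φ.continuous N ↔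
    ∀ (K : Type w) [EnrichedCategory V K], ∀ ψ ∈ Φ K, ∀ (T : EnrichedFunctor V Kᵒᵖ Nᵒᵖ) (l : Nᵒᵖ)
      (μ : 𝟙_ V ⟶ (ψ ⟶[V] T.comp V (rep l))), IsWeightedLimit ψ T l μ →
        IsIso (limitMap μ G) :=
  ⟨fun h K _ ψ hψ T l μ hμ => (isWeightedLimit_mapCounit_iff_limitMap μ G).1 (h K ψ hψ T l μ hμ),
   fun h K _ ψ hψ T l μ hμ => (isWeightedLimit_mapCounit_iff_limitMap μ G).2 (h K ψ hψ T l μ hμ)⟩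

theorem rep_mem_continuous (n : Nᵒᵖ) : rep n ∈ Φ.continuous N :=
  (Φ.mem_continuous_iff N _).2 fun _ _ _ _ _ _ _ hμ => isIso_limitMap_rep hμ n

theorem replete_continuous : Replete (V := V) (Φ.continuous N) :=
  replete_of_areInverse fun G H f g hfg hG => by
    rw [mem_continuous_iff] at hG ⊢
    intro K _ ψ hψ T l μ hμ
    have h1 := hG K ψ hψ T l μ hμ
    have := (isENat_limitMap μ).exists_areInverse hfg
      (by change IsIso (unelt (elt (limitMap μ G))); rwa [unelt_elt])
    change IsIso (unelt (elt (limitMap μ H))) at this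
    rwa [unelt_elt] at this

variable [HasColimits V]

/-- `limitMap` at the colimit `c` is the map of colimits induced by the `limitMap`s at the `S k`,
which are invertible. -/
theorem closedUnder_continuous : Φ.flat.ClosedUnder (Φ.continuous N) := by
  intro L _ φ hφ S hS c η hη
  simp only [mem_continuous_iff] at hS ⊢
  intro K _ ψ hψ T l μ hμ
  have h1 := preservesWeightedColimit_iff.1 (preservesWeightedColimit_evalAt l φ S) c η hη
  have h2 := preservesWeightedColimit_iff.1 (preservesWeightedColimit_restrictAlong T φ S) c η hη
  -- Flatness of `φ` enters only here, for the diagram restricted along `T`.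
  have h3 := preservesWeightedColimit_iff.1 (hφ K ψ hψ (S.comp V (restrictAlong V T))) _ _ h2
  have hn : ∀ G H : EnrichedFunctor V Nᵒᵖ V, natπ G H l ≫ ePost (elt (limitMap μ H)) (G.obj l) =
      ((restrictAlong V T).map G H ≫ (rep ψ).map (T.comp V G) (T.comp V H)) ≫
        ePre (elt (limitMap μ G)) _ := isENat_limitMap μ
  have hu : IsENat (S.comp V (evalAt V l)) ((S.comp V (restrictAlong V T)).comp V (rep ψ))
      fun k => elt (limitMap μ (S.obj k)) := fun k k' => by
    have := congrArg (S.map k k' ≫ ·) (hn (S.obj k) (S.obj k'))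
    simp only [← Category.assoc] at this
    exact this
  obtain ⟨g, hg⟩ := exists_areInverse_of_isWeightedColimit hu (v := elt (limitMap μ c)) (fun k => by
    rw [unitCmp_mapUnit, unitCmp_mapUnit, unitCmp_mapUnit]
    have := congrArg (unitCmp η k ≫ ·) (hn (S.obj k) c)
    simp only [← Category.assoc] at this
    exact this) (fun k => by
      have h4 := hS k K ψ hψ T l μ hμ
      have : IsIso (unelt (elt (limitMap μ (S.obj k)))) := by rwa [unelt_elt]
      exact exists_areInverse_of_isIso (elt (limitMap μ (S.obj k)))) h1 h3
  have := hg.isIso_unelt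
  rwa [unelt_elt] at this

theorem freeCocompletion_flat_subset : Φ.flat.freeCocompletion N ⊆ Φ.continuous N :=
  Φ.flat.closure_subset (by rintro _ ⟨n, rfl⟩; exact Φ.rep_mem_continuous N (op n))
    (Φ.replete_continuous N) (Φ.closedUnder_continuous N)

end WeightClass

end Continuous

/-! ### The Yoneda embedding and colimits that exist in `N` -/

section YonedaFunctor

variable {V : Type v} [Category.{w} V] [MonoidalCategory V] [SymmetricCategory V]
  [MonoidalClosed V] [HasLimits V]
variable (N : Type w) [EnrichedCategory V N] {K : Type w} [EnrichedCategory V K]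

theorem cmp_natLift_yonedaFam {n m : N} {H : V} (f : H ⟶ (n ⟶[V] m)) (x : Nᵒᵖ) :
    cmp (F := rep (op n)) (G := rep (op m)) (f ≫ natLift (yonedaFam (op m) (op n))) x =
      (_ ◁ f) ≫ eComp V x.unop n m := by
  refine (comp_cmp f _ x).trans (congrArg (_ ≫ ·) ?_)
  refine (congrArg uncurry (natLift_π (yonedaFam (V := V) (op m) (op n)) x)).trans ?_
  refine (uncurry_curry _).trans ?_
  change (β_ _ _).hom ≫ (β_ _ _).hom ≫ eComp V x.unop n m = _
  rw [SymmetricCategory.symmetry_assoc]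

theorem cmp_natLift_yonedaFam' (n m : N) (x : Nᵒᵖ) :
    cmp (F := rep (op n)) (G := rep (op m)) (natLift (yonedaFam (op m) (op n))) x =
      eComp V x.unop n m := by
  have := cmp_natLift_yonedaFam N (𝟙 (n ⟶[V] m)) x
  rwa [Category.id_comp, MonoidalCategory.whiskerLeft_id, Category.id_comp] at this

variable (V) in
/-- The Yoneda embedding. -/
abbrev yonedaFunctor : EnrichedFunctor V N (EnrichedFunctor V Nᵒᵖ V) where
  obj n := rep (op n)
  map n m := natLift (yonedaFam (op m) (op n))
  map_id n := cmp_ext (F := rep (op n)) fun x => by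
    rw [cmp_natLift_yonedaFam]
    refine Eq.trans ?_ ((congrArg uncurry (natId_π (rep (op n)) x)).trans (uncurry_curry _)).symm
    exact ((Iso.inv_comp_eq _).1 (e_comp_id V x.unop n)).trans (Category.comp_id _)
  map_comp n m l := cmp_ext (F := rep (op n)) fun x => by
    rw [cmp_natLift_yonedaFam]
    refine Eq.trans ?_ (cmp_tensor_comp (natLift (yonedaFam (op m) (op n)))
      (natLift (yonedaFam (op l) (op m))) x).symm
    refine Eq.trans ?_ (congrArg₂ (fun s t => (α_ _ _ _).inv ≫ (s ▷ _) ≫ t)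
      (cmp_natLift_yonedaFam' N n m x) (cmp_natLift_yonedaFam' N m l x)).symm
    exact (e_assoc V x.unop n m l).symm

theorem isIso_yonedaFunctor_map (n m : N) : IsIso ((yonedaFunctor V N).map n m) := by
  change IsIso (natLift (yonedaFam (V := V) (op m) (op n)))
  rw [natLift_yonedaFam]
  exact isIso_yonedaLift (op n) (rep (op m))

variable {N}

/-- The Yoneda isomorphism from `H (R k)` to `[Y (R k), H]` is natural in `k`. -/
theorem isENat_yonedaLift (R : EnrichedFunctor V K N) (H : EnrichedFunctor V Nᵒᵖ V) :
    IsENat ((opFunctor R).comp V H) ((colimHom (R.comp V (yonedaFunctor V N))).obj H)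
      fun k => elt (yonedaLift (op (R.obj k.unop)) H) := by
  refine (isENat_elt_iff (F := (opFunctor R).comp V H)
    (G := (colimHom (R.comp V (yonedaFunctor V N))).obj H)
    fun k => yonedaLift (op (R.obj k.unop)) H).2 fun k k' => ?_
  obtain ⟨k⟩ := k
  obtain ⟨k'⟩ := k'
  refine Eq.trans ?_ (whiskerRight_act_colimHom (R.comp V (yonedaFunctor V N)) H k' k
    (yonedaLift (op (R.obj k)) H)).symm
  have hact : act ((opFunctor R).comp V H) (op k) (op k') =
      (_ ◁ R.map k' k) ≫ act H (op (R.obj k)) (op (R.obj k')) := uncurry_natural_left _ _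
  refine (congrArg (· ≫ _) hact).trans ?_
  refine cmp_ext (F := rep (op (R.obj k'))) fun x => ?_
  refine (comp_cmp _ _ x).trans (Eq.trans ?_ (comp_cmp _ _ x).symm)
  refine (congrArg (_ ≫ ·) (cmp_yonedaLift _ H x)).trans ?_
  refine Eq.trans ?_ (congrArg (fun t => _ ≫ t)
    (cmp_tensor_comp ((R.comp V (yonedaFunctor V N)).map k' k) (yonedaLift (op (R.obj k)) H) x)).symm
  refine Eq.trans ?_ (congrArg₂ (fun s t => _ ≫ (α_ _ _ _).inv ≫ (s ▷ _) ≫ t)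
    (cmp_natLift_yonedaFam N (R.map k' k) x) (cmp_yonedaLift (op (R.obj k)) H x)).symm
  change ((x.unop ⟶[V] R.obj k') ◁ ((H.obj (op (R.obj k)) ◁ R.map k' k) ≫
      act H (op (R.obj k)) (op (R.obj k')))) ≫ (β_ _ _).hom ≫ act H (op (R.obj k')) x =
    ((x.unop ⟶[V] R.obj k') ◁ (β_ (H.obj (op (R.obj k))) (k' ⟶[V] k)).hom) ≫
      (α_ _ _ _).inv ≫ (((_ ◁ R.map k' k) ≫ eComp V x.unop (R.obj k') (R.obj k)) ▷ _) ≫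
        (β_ _ _).hom ≫ act H (op (R.obj k)) x
  have ha : (act H (op (R.obj k)) (op (R.obj k')) ▷ (x.unop ⟶[V] R.obj k')) ≫
      act H (op (R.obj k')) x = (α_ _ _ _).hom ≫ (_ ◁ ((β_ _ _).hom ≫
        eComp V x.unop (R.obj k') (R.obj k))) ≫ act H (op (R.obj k)) x :=
    act_assoc H (op (R.obj k)) (op (R.obj k')) x
  rw [braiding_naturality_right_assoc, comp_whiskerRight_assoc, ha, braiding_naturality_left_assoc,
    braiding_tensor_left_hom, braiding_tensor_right_hom]
  have h1 : ((x.unop ⟶[V] R.obj k') ◁ (β_ (H.obj (op (R.obj k))) (k' ⟶[V] k)).hom) ≫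
      ((x.unop ⟶[V] R.obj k') ◁ (β_ (k' ⟶[V] k) (H.obj (op (R.obj k)))).hom) = 𝟙 _ := by
    rw [← MonoidalCategory.whiskerLeft_comp, SymmetricCategory.symmetry,
      MonoidalCategory.whiskerLeft_id]
  have h2 : (H.obj (op (R.obj k)) ◁ (β_ (x.unop ⟶[V] R.obj k') (k' ⟶[V] k)).hom) ≫
      (H.obj (op (R.obj k)) ◁ (R.map k' k ▷ (x.unop ⟶[V] R.obj k'))) ≫
      (H.obj (op (R.obj k)) ◁ (β_ (R.obj k' ⟶[V] R.obj k) (x.unop ⟶[V] R.obj k')).hom) =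
        H.obj (op (R.obj k)) ◁ ((x.unop ⟶[V] R.obj k') ◁ R.map k' k) := by
    rw [← MonoidalCategory.whiskerLeft_comp, ← MonoidalCategory.whiskerLeft_comp,
      braiding_naturality_left, SymmetricCategory.symmetry_assoc]
  simp [reassoc_of% h1, reassoc_of% h2]

/-- Through Yoneda, testing the cocone `Y θ` against `H` is the same as comparing `H n` with the
limit of `H R` weighted by `φ`. -/
theorem comparison_comp_yonedaEval {φ : EnrichedFunctor V Kᵒᵖ V} {R : EnrichedFunctor V K N} {n : N}
    (θ : 𝟙_ V ⟶ (φ ⟶[V] (colimHom R).obj n)) (H : EnrichedFunctor V Nᵒᵖ V) (k : K) :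
    coconeCmp ((colimHom (R.comp V (yonedaFunctor V N))).map (rep (op n)) H ≫
      ePre (mapUnit (yonedaFunctor V N) θ) _) k ≫ yonedaEval (op (R.obj k)) H =
        cmp (G := (opFunctor R).comp V H)
          ((restrictAlong V (opFunctor R)).map (rep (op n)) H ≫ ePre θ _) (op k) := by
  let M : V := rep (op n) ⟶[V] H
  have h1 := coconeCmp_comparison (mapUnit (yonedaFunctor V N) θ) (b := H) (𝟙 _) k
  rw [Category.id_comp, MonoidalCategory.tensorHom_id] at h1
  have h2 := unitCmp_mapUnit (yonedaFunctor V N) θ k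
  have h3 : cmp (G := (opFunctor R).comp V H) ((restrictAlong V (opFunctor R)).map (rep (op n)) H ≫
      ePre θ _) (op k) = (unitCmp θ k ▷ M) ≫ cmp (F := rep (op n)) (G := H) (𝟙 _) (op (R.obj k)) := by
    refine (cmp_comp_ePre (F := (opFunctor R).comp V (rep (op n))) (G := (opFunctor R).comp V H)
      _ θ (op k)).trans (congrArg (_ ≫ ·) ?_)
    have := cmp_restrictAlong (opFunctor R) (F := rep (op n)) (G := H) (𝟙 _) (op k)
    rwa [Category.id_comp] at this
  refine (congrArg (· ≫ _) h1).trans (Eq.trans ?_ h3.symm)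
  refine (comp_yonedaEval _ _ _).trans ?_
  have h4 : cmp (F := rep (op (R.obj k))) ((unitCmp (mapUnit (yonedaFunctor V N) θ) k ▷ M) ≫
      eComp V (rep (op (R.obj k))) (rep (op n)) H) (op (R.obj k)) = (α_ _ _ _).inv ≫
        (((_ ◁ unitCmp θ k) ≫ eComp V (R.obj k) (R.obj k) n) ▷ M) ≫
          cmp (F := rep (op n)) (G := H) (𝟙 _) (op (R.obj k)) := by
    refine (actAt_whiskerRight_comp (evalAt V (op (R.obj k))) _).trans ?_
    refine congrArg (fun t => (α_ _ _ _).inv ≫ (t ▷ M) ≫ _) ?_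
    exact (congrArg (fun t => cmp t (op (R.obj k))) h2).trans (cmp_natLift_yonedaFam N _ _)
  refine (congrArg (fun t => _ ≫ _ ≫ t) h4).trans ?_
  change (λ_ _).inv ≫ (eId V (R.obj k) ▷ _) ≫ (α_ _ _ _).inv ≫
        (((_ ◁ unitCmp θ k) ≫ eComp V (R.obj k) (R.obj k) n) ▷ M) ≫
          cmp (F := rep (op n)) (G := H) (𝟙 _) (op (R.obj k)) = _
  rw [associator_inv_naturality_left_assoc, ← comp_whiskerRight_assoc, ← whisker_exchange_assoc,
    (Iso.inv_comp_eq _).1 (e_id_comp V (R.obj k) n)]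
  simp

/-- A presheaf that preserves the limit corresponding to a colimit in `N` believes that the Yoneda
embedding preserves this colimit. -/
theorem isIso_comparison_yonedaFunctor {φ : EnrichedFunctor V Kᵒᵖ V} {R : EnrichedFunctor V K N}
    {n : N} (θ : 𝟙_ V ⟶ (φ ⟶[V] (colimHom R).obj n)) (H : EnrichedFunctor V Nᵒᵖ V)
    (h : IsIso ((restrictAlong V (opFunctor R)).map (rep (op n)) H ≫
      ePre θ ((opFunctor R).comp V H))) :
    IsIso ((colimHom (R.comp V (yonedaFunctor V N))).map (rep (op n)) H ≫
      ePre (mapUnit (yonedaFunctor V N) θ) _) := by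
  -- Postcomposition with this invertible transformation turns the comparison for the limit of `H R`
  -- into the one for the image cocone.
  let σ := natElt _ (isENat_yonedaLift R H)
  have hσ : ∀ k, σ ≫ natπ ((opFunctor R).comp V H)
      ((colimHom (R.comp V (yonedaFunctor V N))).obj H) k =
        elt (yonedaLift (op (R.obj k.unop)) H) := fun k => natElt_π _ (isENat_yonedaLift R H) k
  obtain ⟨ν, hν⟩ := exists_areInverse_natElt σ fun k => by
    have : IsIso (unelt (elt (yonedaLift (op (R.obj k.unop)) H))) := by
      rw [unelt_elt]; exact isIso_yonedaLift _ _
    exact (congrArg (fun t => ∃ g, AreInverse t g) (hσ k)).mpr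
      (exists_areInverse_of_isIso (elt (yonedaLift (op (R.obj k.unop)) H)))
  have := hν.isIso_ePost φ
  have e : ((restrictAlong V (opFunctor R)).map (rep (op n)) H ≫
      ePre θ ((opFunctor R).comp V H)) ≫ ePost σ φ =
      (colimHom (R.comp V (yonedaFunctor V N))).map (rep (op n)) H ≫
        ePre (mapUnit (yonedaFunctor V N) θ) _ := by
    refine coconeCmp_ext fun k => ?_
    refine (cmp_comp_ePost (G := (opFunctor R).comp V H) _ σ (op k)).trans ?_
    refine (congrArg₂ (· ≫ ·) (comparison_comp_yonedaEval θ H k).symm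
      ((congrArg unelt (hσ (op k))).trans (unelt_elt _))).trans ?_
    refine (Category.assoc _ _ _).trans ?_
    exact (congrArg (_ ≫ ·) (yonedaEval_lift (op (R.obj k)) H)).trans (Category.comp_id _)
  rw [← e]
  infer_instance

end YonedaFunctor

/-! ### Orthogonality to a class of objects -/

section Reflection

variable {V : Type v} [Category.{w} V] [MonoidalCategory V] [SymmetricCategory V]
  [MonoidalClosed V] [HasLimits V]
variable {E : Type u} [EnrichedCategory V E] {K : Type w} [EnrichedCategory V K]

/-- Every member of `Q` is orthogonal to `u`. -/
def IsOrthogonal (Q : Set E) {x y : E} (u : 𝟙_ V ⟶ (x ⟶[V] y)) : Prop :=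
  ∀ z ∈ Q, IsIso (ePre u z)

theorem IsOrthogonal.comp_areInverse {Q : Set E} {x x' y : E} {u : 𝟙_ V ⟶ (x ⟶[V] y)}
    (hu : IsOrthogonal Q u) {f : 𝟙_ V ⟶ (x ⟶[V] x')} {g : 𝟙_ V ⟶ (x' ⟶[V] x)}
    (h : AreInverse f g) : IsOrthogonal Q (g ≫ ePost u x') := fun z hz => by
  rw [ePre_comp]
  have := hu z hz
  have := h.symm.isIso_ePre z
  infer_instance

/-- The objects that have an orthogonal map to a member of `P`. -/
def orthogonalTo (V : Type v) [Category.{w} V] [MonoidalCategory V] {E : Type u}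
    [EnrichedCategory V E] (Q P : Set E) : Set E :=
  {x | ∃ y ∈ P, ∃ u : 𝟙_ V ⟶ (x ⟶[V] y), IsOrthogonal Q u}

theorem replete_orthogonalTo (Q P : Set E) : Replete (V := V) (orthogonalTo V Q P) :=
  replete_of_areInverse fun _ _ _ _ h ⟨y, hy, _, hu⟩ => ⟨y, hy, _, hu.comp_areInverse h⟩

theorem subset_orthogonalTo (Q P : Set E) : P ⊆ orthogonalTo V Q P := fun x hx =>
  ⟨x, hx, eId V x, fun z _ => by rw [ePre_eId]; infer_instance⟩

/-- For each `z` in `Q`, the case `I = id` of the transfer principle applies at `z` alone. Hence `θ`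
need be colimiting only for test objects in `Q`, although `η` is a true colimit. -/
theorem exists_isOrthogonal_of_isWeightedColimit {Q : Set E} {S R : EnrichedFunctor V K E}
    {u : ∀ k, 𝟙_ V ⟶ (S.obj k ⟶[V] R.obj k)} (hu : IsENat S R u)
    (h : ∀ k, IsOrthogonal Q (u k)) {φ : EnrichedFunctor V Kᵒᵖ V} {c t : E}
    {η : 𝟙_ V ⟶ (φ ⟶[V] (colimHom S).obj c)} (hη : IsWeightedColimit φ S c η)
    (θ : 𝟙_ V ⟶ (φ ⟶[V] (colimHom R).obj t))
    (hθ : ∀ z ∈ Q, IsIso ((colimHom R).map t z ≫ ePre θ _)) :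
    ∃ v : 𝟙_ V ⟶ (c ⟶[V] t), IsOrthogonal Q v := by
  rw [isWeightedColimit_iff] at hη
  obtain ⟨v, hv⟩ := exists_factor hu θ (hη t)
  exact ⟨v, fun z hz => (isIso_ePre_iff hu hv z (fun k => h k z hz) (hη z)).2 (hθ z hz)⟩

theorem IsOrthogonal.exists_areInverse {Q : Set E} {x y : E} {u : 𝟙_ V ⟶ (x ⟶[V] y)}
    (hu : IsOrthogonal Q u) (hx : x ∈ Q) (hy : y ∈ Q) : ∃ g, AreInverse u g := by
  have := hu x hx
  have := hu y hy
  exact exists_areInverse_of_isIso_ePre u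

end Reflection

/-! ### The criterion for `Φ⁺(N)` to be all continuous presheaves -/

section Main

variable {V : Type v} [Category.{w} V] [MonoidalCategory V] [SymmetricCategory V]
  [MonoidalClosed V] [HasLimits V]
variable (Φ : WeightClass V) (N : Type w) [EnrichedCategory V N]

namespace WeightClass

/-- The representables chosen for the `S k` form a diagram in `N`. Its colimit `n` there exists by
`Φ`-cocompleteness, and `Y n` is the colimit of the representables as far as continuous presheaves
can tell. -/
theorem closedUnder_orthogonalTo_range (hN : Φ.Cocomplete N) :
    Φ.ClosedUnder (orthogonalTo V (Φ.continuous N) (Set.range fun n : N => rep (op n))) := by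
  intro K _ φ hφ S hS c η hη
  have hS' : ∀ k, ∃ (n : N) (u : 𝟙_ V ⟶ (S.obj k ⟶[V] (yonedaFunctor V N).obj n)),
      IsOrthogonal (Φ.continuous N) u := fun k => by
    obtain ⟨_, ⟨n, rfl⟩, u, hu⟩ := hS k
    exact ⟨n, u, hu⟩
  choose R u hu using hS'
  -- `Y` is fully faithful, and the representable at `R k'` is continuous, so `u k` is orthogonal to
  -- it.
  have hi : ∀ k k', IsIso ((yonedaFunctor V N).map (R k) (R k') ≫
      ePre (u k) ((yonedaFunctor V N).obj (R k'))) := fun k k' => by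
    have h1 := isIso_yonedaFunctor_map (V := V) N (R k) (R k')
    have h2 := hu k _ (Φ.rep_mem_continuous N (op (R k')))
    exact IsIso.comp_isIso' h1 h2
  let R' := universalFunctor (yonedaFunctor V N) S R u hi
  have hR := isENat_universalFunctor (yonedaFunctor V N) S R u hi
  obtain ⟨n, θ, hθ⟩ := hN K φ hφ R'
  obtain ⟨v, hv⟩ := exists_isOrthogonal_of_isWeightedColimit (Q := Φ.continuous N) hR hu hη
    (mapUnit (yonedaFunctor V N) θ) fun H hH => isIso_comparison_yonedaFunctor θ H
      ((isWeightedLimit_mapCounit_iff H φ (opFunctor R') (op n) θ).1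
        (hH K φ hφ (opFunctor R') (op n) θ hθ))
  exact ⟨_, ⟨n, rfl⟩, v, hv⟩

variable [HasColimits V]

/-- Here the targets lie in `Φ⁺(N)`, which is inside the class of test objects. Their flat colimit
is taken in presheaves and stays in `Φ⁺(N)` by closure. -/
theorem closedUnder_orthogonalTo_freeCocompletion :
    Φ.flat.ClosedUnder (orthogonalTo V (Φ.continuous N) (Φ.flat.freeCocompletion N)) := by
  intro K _ φ hφ S hS c η hη
  choose R hR u hu using hS
  let I := EnrichedFunctor.id V (EnrichedFunctor V Nᵒᵖ V)
  have hi : ∀ k k', IsIso (I.map (R k) (R k') ≫ ePre (u k) (R k')) := fun k k' =>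
    IsIso.comp_isIso' (inferInstanceAs (IsIso (𝟙 _)))
      (hu k _ (Φ.freeCocompletion_flat_subset N (hR k')))
  let R' := universalFunctor I S R u hi
  have hR' : IsENat S R' u := fun k k' => (isENat_universalFunctor I S R u hi k k').trans
    (congrArg (· ≫ _) (Category.comp_id _))
  obtain ⟨t, θ, hθ⟩ := exists_isWeightedColimit φ R'
  have ht : t ∈ Φ.flat.freeCocompletion N := Φ.flat.closedUnder_closure _ K φ hφ R' hR t θ hθ
  rw [isWeightedColimit_iff] at hθ
  obtain ⟨v, hv⟩ := exists_isOrthogonal_of_isWeightedColimit (Q := Φ.continuous N) hR' hu hη θ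
    fun z _ => hθ z
  exact ⟨t, ht, v, hv⟩

theorem freeCocompletion_flat_eq_iff (hN : Φ.Cocomplete N) :
    Φ.flat.freeCocompletion N = Φ.continuous N ↔
      Φ.continuous N ⊆ Φ.flat.closure (Φ.freeCocompletion N) := by
  constructor
  · intro h
    rw [← h]
    exact Φ.flat.closure_mono (Φ.subset_closure _)
  · intro h
    refine (Φ.freeCocompletion_flat_subset N).antisymm fun G hG => ?_
    have h0 : Φ.freeCocompletion N ⊆
        orthogonalTo V (Φ.continuous N) (Set.range fun n : N => rep (op n)) :=
      Φ.closure_subset (subset_orthogonalTo _ _) (replete_orthogonalTo _ _)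
        (Φ.closedUnder_orthogonalTo_range N hN)
    have h1 : Φ.flat.closure (Φ.freeCocompletion N) ⊆
        orthogonalTo V (Φ.continuous N) (Φ.flat.freeCocompletion N) := by
      refine Φ.flat.closure_subset (h0.trans ?_) (replete_orthogonalTo _ _)
        (Φ.closedUnder_orthogonalTo_freeCocompletion N)
      rintro x ⟨y, hy, u, hu⟩
      exact ⟨y, Φ.flat.subset_closure _ hy, u, hu⟩
    obtain ⟨r, hr, u, hu⟩ := h1 (h hG)
    -- Both `G` and `r` are continuous, so they may serve as the two test objects that make `u`
    -- invertible.
    obtain ⟨g, hg⟩ := hu.exists_areInverse hG (Φ.freeCocompletion_flat_subset N hr)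
    exact (Φ.flat.replete_closure _).mem_of_areInverse hg.symm hr

end WeightClass

end Main

/-! ### Dependence of colimits on the weight -/

section WeightColimits

variable {V : Type v} [Category.{w} V] [MonoidalCategory V] [SymmetricCategory V]
  [MonoidalClosed V] [HasLimits V]
variable {N : Type w} [EnrichedCategory V N] {L : Type w} [EnrichedCategory V L]
  {A : Type u₁} [EnrichedCategory V A] {B : Type u₂} [EnrichedCategory V B]

theorem comparison_comp_yonedaEval_rep {T : EnrichedFunctor V N A} {n : N} {c : A}
    (η : 𝟙_ V ⟶ (rep (op n) ⟶[V] (colimHom T).obj c)) (b : A) :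
    ((colimHom T).map c b ≫ ePre η _) ≫ yonedaEval (op n) ((colimHom T).obj b) =
      ePre (eId V n ≫ unitCmp η n) b := by
  refine (comp_yonedaEval _ _ _).trans ?_
  have h := coconeCmp_comparison η (b := b) (𝟙 _) n
  rw [Category.id_comp, MonoidalCategory.tensorHom_id] at h
  refine (congrArg (fun t => _ ≫ _ ≫ t) h).trans ?_
  rw [ePre, comp_whiskerRight, Category.assoc]
  rfl

/-- By Yoneda a cocone with representable weight is one arrow `T n ⟶ c`, and it is colimiting
exactly when this arrow is invertible. Such colimits are therefore absolute. -/
theorem isWeightedColimit_rep_iff {T : EnrichedFunctor V N A} {n : N} {c : A}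
    (η : 𝟙_ V ⟶ (rep (op n) ⟶[V] (colimHom T).obj c)) :
    IsWeightedColimit (rep (op n)) T c η ↔ ∃ g, AreInverse (eId V n ≫ unitCmp η n) g := by
  rw [isWeightedColimit_iff]
  have key : ∀ b, IsIso ((colimHom T).map c b ≫ ePre η _) ↔
      IsIso (ePre (eId V n ≫ unitCmp η n) b) := fun b => by
    rw [← comparison_comp_yonedaEval_rep]
    exact (isIso_comp_right_iff _ (yonedaEval (op n) ((colimHom T).obj b))).symm
  exact ⟨fun h => exists_areInverse_of_ePre _ fun b => (key b).1 (h b),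
    fun ⟨g, hg⟩ b => (key b).2 (hg.isIso_ePre b)⟩

theorem preservesWeightedColimit_rep (F : EnrichedFunctor V A B) (n : N)
    (T : EnrichedFunctor V N A) : PreservesWeightedColimit F (rep (op n)) T := by
  rw [preservesWeightedColimit_iff]
  intro c η hη
  rw [isWeightedColimit_rep_iff] at hη ⊢
  obtain ⟨g, hg⟩ := hη
  rw [unitCmp_mapUnit]
  have h := hg.map F
  rw [Category.assoc] at h
  exact ⟨_, h⟩

theorem mapUnit_eq (F : EnrichedFunctor V A B) {φ : EnrichedFunctor V Nᵒᵖ V}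
    {T : EnrichedFunctor V N A} {c : A} (η : 𝟙_ V ⟶ (φ ⟶[V] (colimHom T).obj c)) :
    mapUnit F η = η ≫ ePost (mapElt (opFunctor F) (opFunctor T) (op c)) φ :=
  mapCounit_eq _ _ _ _ _

theorem isWeightedColimit_comp_areInverse_iff {φ φ' : EnrichedFunctor V Nᵒᵖ V}
    {f : 𝟙_ V ⟶ (φ ⟶[V] φ')} {g : 𝟙_ V ⟶ (φ' ⟶[V] φ)} (h : AreInverse f g)
    {T : EnrichedFunctor V N A} {c : A} (η : 𝟙_ V ⟶ (φ' ⟶[V] (colimHom T).obj c)) :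
    IsWeightedColimit φ T c (f ≫ ePost η φ) ↔ IsWeightedColimit φ' T c η := by
  rw [isWeightedColimit_iff, isWeightedColimit_iff]
  refine forall_congr' fun b => ?_
  have := h.isIso_ePre ((colimHom T).obj b)
  rw [ePre_comp, ← Category.assoc]
  exact isIso_comp_right_iff _ _

theorem PreservesWeightedColimit.of_areInverse {F : EnrichedFunctor V A B}
    {T : EnrichedFunctor V N A} {φ φ' : EnrichedFunctor V Nᵒᵖ V}
    {f : 𝟙_ V ⟶ (φ ⟶[V] φ')} {g : 𝟙_ V ⟶ (φ' ⟶[V] φ)} (h : AreInverse f g)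
    (hF : PreservesWeightedColimit F φ T) : PreservesWeightedColimit F φ' T := by
  rw [preservesWeightedColimit_iff] at hF ⊢
  intro c η hη
  have h1 := hF c _ ((isWeightedColimit_comp_areInverse_iff h η).2 hη)
  rw [mapUnit_eq, Category.assoc, ← ePost_comp, ← mapUnit_eq] at h1
  exact (isWeightedColimit_comp_areInverse_iff h _).1 h1

theorem colimHom_map_ePost_mapElt (F : EnrichedFunctor V A B) (T : EnrichedFunctor V N A) (a b : A) :
    (colimHom T).map a b ≫ ePost (mapElt (opFunctor F) (opFunctor T) (op b)) _ =
      F.map a b ≫ (colimHom (T.comp V F)).map (F.obj a) (F.obj b) ≫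
        ePre (mapElt (opFunctor F) (opFunctor T) (op a)) _ :=
  (isENat_mapElt (opFunctor F) (opFunctor T) (op (op a)) (op (op b))).trans (Category.assoc _ _ _)

/-- Pastes a square over `I` with the naturality square of `m : I ⟶ I' F`. It is used below for a
whole hom-object, giving naturality, and for single cocone components. -/
theorem comp_ePost_of_isENat {E : Type u₃} [EnrichedCategory V E] {F : EnrichedFunctor V A B}
    {I : EnrichedFunctor V A E} {I' : EnrichedFunctor V B E}
    {m : ∀ a, 𝟙_ V ⟶ (I.obj a ⟶[V] I'.obj (F.obj a))}
    (hm : ∀ a b, I.map a b ≫ ePost (m b) _ =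
      F.map a b ≫ I'.map (F.obj a) (F.obj b) ≫ ePre (m a) _)
    {s s' : E} {a b : A} {u : 𝟙_ V ⟶ (s ⟶[V] I.obj a)} {u' : 𝟙_ V ⟶ (s' ⟶[V] I.obj b)} {X : V}
    {p : X ⟶ (s ⟶[V] s')} {q : X ⟶ (a ⟶[V] b)}
    (e : p ≫ ePost u' s = q ≫ I.map a b ≫ ePre u _) :
    p ≫ ePost (u' ≫ ePost (m b) s') s =
      (q ≫ F.map a b) ≫ I'.map (F.obj a) (F.obj b) ≫ ePre (u ≫ ePost (m a) s) _ := by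
  rw [ePost_comp, ePre_comp, reassoc_of% e, ePre_ePost, reassoc_of% (hm a b), Category.assoc]

/-- If `F` preserves the colimits of `T` weighted by the members of a diagram of weights, and all
colimits weighted by `φ`, then it preserves the colimit of `T` weighted by the `φ`-colimit of the
diagram. -/
theorem preservesWeightedColimit_of_isWeightedColimit {F : EnrichedFunctor V A B}
    {T : EnrichedFunctor V N A} {φ : EnrichedFunctor V Lᵒᵖ V}
    {S : EnrichedFunctor V L (EnrichedFunctor V Nᵒᵖ V)} {c : EnrichedFunctor V Nᵒᵖ V}
    {η : 𝟙_ V ⟶ (φ ⟶[V] (colimHom S).obj c)} (hη : IsWeightedColimit φ S c η)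
    (hS : ∀ l, PreservesWeightedColimit F (S.obj l) T)
    (hT : ∀ l, ∃ (t : A) (ζ : 𝟙_ V ⟶ (S.obj l ⟶[V] (colimHom T).obj t)),
      IsWeightedColimit (S.obj l) T t ζ)
    (hφ : ∀ R : EnrichedFunctor V L A, PreservesWeightedColimit F φ R) :
    PreservesWeightedColimit F c T := by
  rw [preservesWeightedColimit_iff]
  intro t ζ hζ
  choose R u hu using hT
  have hu' := fun l => preservesWeightedColimit_iff.1 (hS l) (R l) (u l) (hu l)
  simp only [isWeightedColimit_iff] at hu hu' hζ hη
  -- `R'` is `l ↦ S l * T`, and `θ` will exhibit the colimit `t` of `T` weighted by `c` as the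
  -- `φ`-colimit of `R'`.
  let R' := universalFunctor (colimHom T) S R u fun l l' => hu l (R l')
  have hR := isENat_universalFunctor (colimHom T) S R u fun l l' => hu l (R l')
  obtain ⟨θ, hθ⟩ := exists_unit_of_isIso (colimHom T) hR η ζ fun l => hu l t
  have h1 : IsWeightedColimit φ R' t θ := (isWeightedColimit_iff _ _ _ _).2 fun a =>
    (isIso_comparison_iff (colimHom T) hR hθ a (fun l => hu l a) (hη _)).1 (hζ a)
  have h2 := preservesWeightedColimit_iff.1 (hφ R') t θ h1
  rw [isWeightedColimit_iff] at h2 ⊢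
  let m : ∀ a, 𝟙_ V ⟶ ((colimHom T).obj a ⟶[V] (colimHom (T.comp V F)).obj (F.obj a)) :=
    fun a => mapElt (opFunctor F) (opFunctor T) (op a)
  have hm : ∀ a b, (colimHom T).map a b ≫ ePost (m b) _ =
      F.map a b ≫ (colimHom (T.comp V F)).map (F.obj a) (F.obj b) ≫ ePre (m a) _ :=
    colimHom_map_ePost_mapElt F T
  have hmu : ∀ {φ : EnrichedFunctor V Nᵒᵖ V} {a : A} (ζ : 𝟙_ V ⟶ (φ ⟶[V] (colimHom T).obj a)),
    mapUnit F ζ = ζ ≫ ePost (m a) φ := mapUnit_eq F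
  simp only [hmu ζ]
  have hu2 : ∀ l, IsUniversal (colimHom (T.comp V F)) (S.obj l) (F.obj (R l))
      (u l ≫ ePost (m (R l)) (S.obj l)) := fun l => by
    rw [← hmu]
    exact hu' l
  -- The same decomposition after applying `F`: the arrows of `hR`, followed by `m`, exhibit `F (R
  -- l)` as `S l * (F T)`. The transfer principle is then read in the opposite direction.
  have hR2 : IsENat S ((R'.comp V F).comp V (colimHom (T.comp V F)))
      fun l => u l ≫ ePost (m (R l)) (S.obj l) := fun l l' =>
    (comp_ePost_of_isENat hm ((hR l l').trans (Category.assoc _ _ _))).trans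
      (Category.assoc _ _ _).symm
  refine fun a => (isIso_comparison_iff (colimHom (T.comp V F)) hR2 (θ := mapUnit F θ)
    (fun l => ?_) a (fun l => hu2 l a) (hη _)).2 (h2 a)
  exact (comp_ePost_of_isENat hm (hθ l)).trans (congrArg (· ≫ _) (unitCmp_mapUnit F θ l).symm)

/-- The unit of the expression of a presheaf as a colimit of representables weighted by itself. -/
def densityUnit (φ : EnrichedFunctor V Nᵒᵖ V) : 𝟙_ V ⟶ (φ ⟶[V]
    (colimHom ((EnrichedFunctor.id V N).comp V (yonedaFunctor V N))).obj φ) :=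
  natElt (fun k => elt (yonedaLift k φ)) fun x y =>
    (congrArg (· ≫ _) (Category.id_comp (φ.map x y))).symm.trans
      (isENat_yonedaLift (EnrichedFunctor.id V N) φ x y)

theorem densityUnit_π (φ : EnrichedFunctor V Nᵒᵖ V) (k : Nᵒᵖ) : densityUnit φ ≫ natπ φ
    ((colimHom ((EnrichedFunctor.id V N).comp V (yonedaFunctor V N))).obj φ) k =
      elt (yonedaLift k φ) :=
  natLift_π _ _

theorem whiskerRight_comp_yonedaEval {n : N} {G H : EnrichedFunctor V Nᵒᵖ V} {P : V}
    (f : P ⟶ (rep (op n) ⟶[V] G)) :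
    ((f ▷ (G ⟶[V] H)) ≫ eComp V (rep (op n)) G H) ≫ yonedaEval (op n) H =
      ((f ≫ yonedaEval (op n) G) ▷ _) ≫ cmp (F := G) (G := H) (𝟙 _) (op n) := by
  have h := cmp_tensor_comp f (𝟙 (G ⟶[V] H)) (op n)
  rw [MonoidalCategory.tensorHom_id] at h
  rw [comp_yonedaEval, comp_yonedaEval, h]
  simp

/-- The comparison at `H` is postcomposition with `densityUnit H`, whose components are Yoneda
isomorphisms. -/
theorem isWeightedColimit_densityUnit (φ : EnrichedFunctor V Nᵒᵖ V) :
    IsWeightedColimit φ ((EnrichedFunctor.id V N).comp V (yonedaFunctor V N)) φ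
      (densityUnit φ) := by
  rw [isWeightedColimit_iff]
  intro H
  have e : (colimHom ((EnrichedFunctor.id V N).comp V (yonedaFunctor V N))).map φ H ≫
      ePre (densityUnit φ) _ = ePost (densityUnit H) φ := by
    refine coconeCmp_ext fun k => ?_
    have h1 := coconeCmp_comparison (densityUnit φ) (b := H) (𝟙 _) k
    rw [Category.id_comp, MonoidalCategory.tensorHom_id] at h1
    have h2 : unitCmp (densityUnit φ) k = yonedaLift (op k) φ :=
      (congrArg unelt (densityUnit_π φ (op k))).trans (unelt_elt _)
    have h3 := cmp_comp_ePost (F := φ) (G := H) (𝟙 _) (densityUnit H) (op k)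
    rw [Category.id_comp] at h3
    have h4 : unelt (densityUnit H ≫ natπ H
      ((colimHom ((EnrichedFunctor.id V N).comp V (yonedaFunctor V N))).obj H) (op k)) =
        yonedaLift (op k) H := (congrArg unelt (densityUnit_π H (op k))).trans (unelt_elt _)
    rw [h2] at h1
    refine h1.trans (Eq.trans ?_ (h3.trans (congrArg (_ ≫ ·) h4)).symm)
    change (yonedaLift (op k) φ ▷ (φ ⟶[V] H)) ≫ eComp V (rep (op k)) φ H =
      cmp (F := φ) (G := H) (𝟙 _) (op k) ≫ yonedaLift (op k) H
    rw [← cancel_mono (yonedaEval (op k) H), whiskerRight_comp_yonedaEval, yonedaLift_eval,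
      Category.assoc, yonedaLift_eval]
    simp
  rw [e]
  obtain ⟨ν, hν⟩ := exists_areInverse_natElt (densityUnit H) fun k => by
    have : IsIso (unelt (elt (yonedaLift k H))) := by rw [unelt_elt]; infer_instance
    exact (congrArg (fun t => ∃ g, AreInverse t g) (densityUnit_π H k)).mpr
      (exists_areInverse_of_isIso (elt (yonedaLift k H)))
  exact hν.isIso_ePost φ

end WeightColimits

/-! ### Flat presheaves are the objects of `Φ⁺(N)` -/

section Main

variable {V : Type v} [Category.{w} V] [MonoidalCategory V] [SymmetricCategory V]
  [MonoidalClosed V] [HasLimits V] [HasColimits V]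
variable (Φ : WeightClass V) (N : Type w) [EnrichedCategory V N]

namespace WeightClass

/-- Flat presheaves contain the representables and are replete and closed under flat colimits, so
they contain `Φ⁺(N)`. Conversely, a flat `φ` is a colimit of representables weighted by the flat
weight `φ` itself. -/
theorem freeCocompletion_flat_eq : Φ.flat.freeCocompletion N = Φ.flat N := by
  refine (Φ.flat.closure_subset ?_ ?_ ?_).antisymm fun φ hφ => ?_
  · rintro _ ⟨n, rfl⟩ K _ ψ _ T
    exact preservesWeightedColimit_rep _ n T
  · exact replete_of_areInverse fun φ φ' f g h hφ K _ ψ hψ T => (hφ K ψ hψ T).of_areInverse h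
  · intro L _ φ hφ S hS c η hη K _ ψ hψ T
    exact preservesWeightedColimit_of_isWeightedColimit hη (fun l => hS l K ψ hψ T)
      (fun l => exists_isWeightedColimit (S.obj l) T) fun R => hφ K ψ hψ R
  · exact Φ.flat.closedUnder_closure _ N φ hφ _
      (fun k => Φ.flat.subset_closure _ (Set.mem_range_self (f := fun n : N => rep (op n)) k)) φ _ (isWeightedColimit_densityUnit φ)

end WeightClass

end Main

end EnrichedWeights

end

/-! ### The theorem -/

theorem mainTheorem10 {V : Type v} [Category.{w} V] [MonoidalCategory V] [SymmetricCategory V]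
    [MonoidalClosed V] [HasLimits V] [HasColimits V] (Φ : EnrichedWeights.WeightClass V)
    (N : Type w) [EnrichedCategory V N] (hN : Φ.Cocomplete N) :
    Φ.flat.freeCocompletion N ⊆ Φ.continuous N ∧
    (Φ.flat.freeCocompletion N = Φ.continuous N ↔
      Φ.continuous N ⊆ Φ.flat.closure (Φ.freeCocompletion N)) ∧
    (Φ.flat.closure (Φ.freeCocompletion N) = Set.univ →
      Φ.flat.freeCocompletion N = Φ.continuous N ∧ Φ.flat N = Φ.continuous N) := ⟨Φ.freeCocompletion_flat_subset N, Φ.freeCocompletion_flat_eq_iff N hN, fun h => by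
    have e := (Φ.freeCocompletion_flat_eq_iff N hN).2 (h ▸ Set.subset_univ _)
    exact ⟨e, (Φ.freeCocompletion_flat_eq N).symm.trans e⟩⟩
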